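/- Let $R<0$ and let $(M,g)$ be a hyperbolic surface of constant curvature $R$, i.e. a smooth surface with a Riemannian metric which is locally isometric to the upper half plane $H^2=\{(x,y): y>0\}$ with the metric $(dx^2+dy^2)/(-R\,y^2)$; for $R=-1$ this is the usual metric of the upper half plane. The Gauss curvature of $g$ is $R$. For a symmetric covariant $2$-tensor $S$ on $M$ let $S^*$ be the symmetric tensor obtained by applying the Hodge star of one-forms to both indices of $S$, let $\nabla$ be the Levi-Civita connection, and let $D^*S=-\nabla^iS_{ij}$, where $D$ is the exterior covariant derivative and $S$ is regarded as a $T^*M$-valued one-form. 1. If $S$ is smooth, then $D^*S=0$ if and only if locally (in a neighbourhood of every point) $S^*=\nabla dE+R\,g\,E$ for some smooth function $E$. If $S$ is only in $L^1_{loc}$, then $D^*S=0$ in the sense of distributions if and only if locally $S^*=\nabla dE+R\,g\,E$ for some function $E$ of class $W^{2,1}_{loc}$, with derivatives in the sense of distributions. 2. On $H^2$, with the metric above, the kernel $K$ of the operator $E\mapsto\nabla dE+R\,g\,E$ on $C^2$ functions is the $3$-dimensional space spanned by $$k_0=\frac{x}{y},\qquad k_1=\frac1y,\qquad k_2=\frac{x^2+y^2}{y}.$$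 Every $W^{2,1}_{loc}$ solution of $\nabla dE+R\,g\,E=0$ in the sense of distributions agrees almost everywhere with an element of $K$, and every function that agrees almost everywhere with an element of $K$ is such a solution. 3. Let $\mathfrak{so}(2,1)$ act on $H^2$ through the identification of $H^2$ with the sheet $w>0$ of the hyperboloid $u^2+v^2-w^2=-1$ given by $$(u,v,w)=\Big(\frac xy,\ \frac{x^2+y^2-1}{2y},\ \frac{x^2+y^2+1}{2y}\Big).$$ That is, $A\in\mathfrak{so}(2,1)$ acts by the vector field $W_A$ on $H^2$ which corresponds to $p\mapsto Ap$ on the hyperboloid. Then $A\mapsto W_A$ is a bijection from $\mathfrak{so}(2,1)$ onto the smooth Killing fields of $H^2$. 4. Let $\omega=\frac{dx\wedge dy}{-R\,y^2}$ be the area form of $H^2$, and call $f$ a Hamiltonian of a vector field $W$ if $f$ is smooth and $\iota_W\omega=df$. Then $K$ consists exactly of the Hamiltonians of the action of $SO(2,1)$, in the following sense. Every Killing field has exactly one Hamiltonian in $K$, and every element of $K$ is a Hamiltonian of a Killing field. There is exactly one linear map $\mu$ from $\mathfrak{so}(2,1)$ to functions on $H^2$ such that $\mu(A)$ is a Hamiltonian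 of $W_A$ and $W_A(\mu(B))=-\mu([A,B])$ for all $A,B$ (an equivariant comoment map); it is injective and its image is $K$. Moreover the fields $$\omega_0=x\,\partial_x+y\,\partial_y,\qquad \omega_1=\partial_x,\qquad \omega_2=(x^2-y^2)\,\partial_x+2xy\,\partial_y$$ are Killing, and $k_j$ is a Hamiltonian of $R\,\omega_j$ (of $-\omega_j$ if $R=-1$) for $j=0,1,2$. -/

import Mathlib

open MeasureTheory Set
open scoped ContDiff Manifold Matrix UpperHalfPlane

noncomputable section

/-! ### Tensor calculus in coordinates `(x⁰, x¹)` of a surface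

`G` always denotes the matrix `(g_ij)` of a Riemannian metric in the given coordinates, as a function
of the point; `∇` is its Levi-Civita connection. -/

/-- The coordinate plane. -/
abbrev Plane := EuclideanSpace ℝ (Fin 2)

/-- A field of `2 × 2` matrices, i.e. the components of a covariant 2-tensor. -/
abbrev MatField := Plane → Matrix (Fin 2) (Fin 2) ℝ

/-- The `i`-th coordinate vector. -/
def coordVec (i : Fin 2) : Plane := EuclideanSpace.single i (1 : ℝ)

/-- The partial derivative `∂_i f`. -/
def pd (i : Fin 2) (f : Plane → ℝ) (x : Plane) : ℝ := fderiv ℝ f x (coordVec i)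

/-- Christoffel symbols `Γ^k_ij = ½ g^{kl} (∂_i g_jl + ∂_j g_il - ∂_l g_ij)`. -/
def christoffel (G : MatField) (k i j : Fin 2) (x : Plane) : ℝ :=
  (1 / 2 : ℝ) * ∑ l, (G x)⁻¹ k l *
    (pd i (fun y => G y j l) x + pd j (fun y => G y i l) x - pd l (fun y => G y i j) x)

/-- The component `R^l_ijk` of the Riemann tensor: `R(∂_i, ∂_j) ∂_k = R^l_ijk ∂_l`. -/
def riemann (G : MatField) (l i j k : Fin 2) (x : Plane) : ℝ :=
  pd i (christoffel G l j k) x - pd j (christoffel G l i k) x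
    + ∑ m, (christoffel G l i m x * christoffel G m j k x
      - christoffel G l j m x * christoffel G m i k x)

/-- The Gauss curvature `g(R(∂_0, ∂_1) ∂_1, ∂_0) / det g`. -/
def gaussCurvature (G : MatField) (x : Plane) : ℝ :=
  (∑ l, G x 0 l * riemann G l 0 1 1 x) / (G x).det

/-- The Riemannian density: `dvol = √(det g) dx⁰ dx¹`. -/
def volDensity (G : MatField) (x : Plane) : ℝ := √(G x).det

/-- The component `(∇dE)_ij = ∂_i ∂_j E - Γ^k_ij ∂_k E`. -/
def hess (G : MatField) (E : Plane → ℝ) (i j : Fin 2) (x : Plane) : ℝ :=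
  pd i (pd j E) x - ∑ k, christoffel G k i j x * pd k E x

/-- The component `(∇_i η)_j` of the covariant derivative of a one-form. -/
def covDerivForm (G : MatField) (η : Fin 2 → Plane → ℝ) (i j : Fin 2) (x : Plane) : ℝ :=
  pd i (η j) x - ∑ k, christoffel G k i j x * η k x

/-- The component `(∇_k S)_ij` of the covariant derivative of a covariant 2-tensor. -/
def covDerivTensor (G S : MatField) (k i j : Fin 2) (x : Plane) : ℝ :=
  pd k (fun y => S y i j) x
    - ∑ l, (christoffel G l k i x * S x l j + christoffel G l k j x * S x i l)

/-- `(D^*S)_j = - g^{ik} ∇_i S_kj`, where `D` is the exterior covariant derivative and `S` is read as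
a one-form with values in the cotangent bundle. -/
def codiff (G S : MatField) (j : Fin 2) (x : Plane) : ℝ :=
  - ∑ i, ∑ k, (G x)⁻¹ i k * covDerivTensor G S i k j x

/-- The matrix `ε_ij` of the area form `√(det g) dx⁰ ∧ dx¹` of the metric matrix `A`. -/
def areaMatrix (A : Matrix (Fin 2) (Fin 2) ℝ) : Matrix (Fin 2) (Fin 2) ℝ :=
  √A.det • !![0, 1; -1, 0]

/-- `S ↦ S^*`, the Hodge star on one-forms applied to both indices of `S`:
`S^*_ij = ε_ik g^{kk'} S_k'l' g^{l'l} ε_jl`. It does not depend on the orientation. -/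
def starTensor (G S : MatField) : MatField := fun x =>
  areaMatrix (G x) * (G x)⁻¹ * S x * (areaMatrix (G x) * (G x)⁻¹)ᵀ

/-- `φ` is a test function on `Ω`: smooth, with compact support inside `Ω`. -/
def IsTest (Ω : Set Plane) (φ : Plane → ℝ) : Prop :=
  ContDiff ℝ ∞ φ ∧ HasCompactSupport φ ∧ tsupport φ ⊆ Ω

/-- `D^*S = 0` on `Ω` in the sense of distributions: `∫ ⟨S, ∇η⟩ dvol = 0` for every smooth one-form
`η` with compact support in `Ω`. -/
def WeakCodiffZero (G S : MatField) (Ω : Set Plane) : Prop :=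
  ∀ η : Fin 2 → Plane → ℝ, (∀ i, IsTest Ω (η i)) →
    ∫ x in Ω, (∑ i, ∑ j, ∑ k, ∑ l,
      (G x)⁻¹ i k * (G x)⁻¹ j l * S x k l * covDerivForm G η i j x) * volDensity G x = 0

/-- `f'` is the distributional partial derivative `∂_i f` on `Ω`. -/
def HasWeakPD (i : Fin 2) (f f' : Plane → ℝ) (Ω : Set Plane) : Prop :=
  ∀ φ, IsTest Ω φ → ∫ x in Ω, f x * pd i φ x = - ∫ x in Ω, f' x * φ x

/-- `E` is of class `W^{2,1}_loc` on `Ω` and `T = ∇dE + R g E` there, with the derivatives of `E`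
taken in the sense of distributions. -/
def WeakHessEq (G : MatField) (R : ℝ) (T : MatField) (E : Plane → ℝ) (Ω : Set Plane) : Prop :=
  LocallyIntegrableOn E Ω ∧
  ∃ (D : Fin 2 → Plane → ℝ) (H : Fin 2 → Fin 2 → Plane → ℝ),
    (∀ i, LocallyIntegrableOn (D i) Ω ∧ HasWeakPD i E (D i) Ω) ∧
    (∀ i j, LocallyIntegrableOn (H i j) Ω ∧ HasWeakPD i (D j) (H i j) Ω) ∧
    ∀ i j, ∀ᵐ x ∂(volume.restrict Ω),
      T x i j = (H i j x - ∑ k, christoffel G k i j x * D k x) + R * G x i j * E x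

/-! ### Hyperbolic surfaces -/

/-- The upper half plane `{y > 0}`, with coordinates `(x, y) = (x⁰, x¹)`. -/
def halfPlane : Set Plane := {x | 0 < x 1}

/-- The metric `(dx² + dy²) / (-R y²)` of the hyperbolic plane of constant curvature `R < 0`
(for `R = -1`, the usual metric of the upper half plane). -/
def hypMetric (R : ℝ) : MatField := fun x => (1 / (-R * x 1 ^ 2)) • (1 : Matrix (Fin 2) (Fin 2) ℝ)

section Surface

variable {M : Type*} [TopologicalSpace M] [ChartedSpace Plane M]

/-- The components in the chart `e` of a field `B` of bilinear forms on the tangent spaces. -/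
def comp (B : ∀ p : M, TangentSpace (𝓡 2) p →L[ℝ] TangentSpace (𝓡 2) p →L[ℝ] ℝ)
    (e : OpenPartialHomeomorph M Plane) : MatField := fun x =>
  Matrix.of fun i j =>
    B (e.symm x) (mfderiv (𝓡 2) (𝓡 2) e.symm x (coordVec i))
      (mfderiv (𝓡 2) (𝓡 2) e.symm x (coordVec j))

variable [IsManifold (𝓡 2) ∞ M]

/-- A smooth Riemannian metric on the surface `M`. -/
abbrev SurfaceMetric (M : Type*) [TopologicalSpace M] [ChartedSpace Plane M]
    [IsManifold (𝓡 2) ∞ M] :=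
  Bundle.ContMDiffRiemannianMetric (𝓡 2) ∞ Plane (fun p : M => TangentSpace (𝓡 2) p)

/-- `e` is a smooth chart of `M` which is an isometry onto an open subset of the hyperbolic plane of
curvature `R`. -/
structure IsHypChart (R : ℝ) (g : SurfaceMetric M) (e : OpenPartialHomeomorph M Plane) : Prop where
  mem_atlas : e ∈ IsManifold.maximalAtlas (𝓡 2) ∞ M
  target_subset : e.target ⊆ halfPlane
  isometric : ∀ x ∈ e.target, comp g.inner e x = hypMetric R x

/-- `(M, g)` is a hyperbolic surface of curvature `R`: it is locally isometric to the hyperbolic plane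
of curvature `R`. -/
def IsHyperbolicSurface (R : ℝ) (g : SurfaceMetric M) : Prop :=
  ∀ p : M, ∃ e : OpenPartialHomeomorph M Plane, p ∈ e.source ∧ IsHypChart R g e

/-! Since hyperbolic charts cover a hyperbolic surface and all the equations below are between tensors,
they are expressed by components in hyperbolic charts. -/

/-- The covariant 2-tensor `S` is smooth. -/
def IsSmoothTensor (R : ℝ) (g : SurfaceMetric M)
    (S : ∀ p : M, TangentSpace (𝓡 2) p →L[ℝ] TangentSpace (𝓡 2) p →L[ℝ] ℝ) : Prop :=
  ∀ e, IsHypChart R g e → ∀ i j, ContDiffOn ℝ ∞ (fun x => comp S e x i j) e.target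

/-- The covariant 2-tensor `S` is of class `L^1_loc`. -/
def IsLocIntegrableTensor (R : ℝ) (g : SurfaceMetric M)
    (S : ∀ p : M, TangentSpace (𝓡 2) p →L[ℝ] TangentSpace (𝓡 2) p →L[ℝ] ℝ) : Prop :=
  ∀ e, IsHypChart R g e → ∀ i j, LocallyIntegrableOn (fun x => comp S e x i j) e.target

/-- `D^*S = 0` on `M`, pointwise. -/
def CodiffZero (R : ℝ) (g : SurfaceMetric M)
    (S : ∀ p : M, TangentSpace (𝓡 2) p →L[ℝ] TangentSpace (𝓡 2) p →L[ℝ] ℝ) : Prop :=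
  ∀ e, IsHypChart R g e → ∀ x ∈ e.target, ∀ j, codiff (comp g.inner e) (comp S e) j x = 0

/-- `D^*S = 0` on `M`, in the sense of distributions. -/
def DistribCodiffZero (R : ℝ) (g : SurfaceMetric M)
    (S : ∀ p : M, TangentSpace (𝓡 2) p →L[ℝ] TangentSpace (𝓡 2) p →L[ℝ] ℝ) : Prop :=
  ∀ e, IsHypChart R g e → WeakCodiffZero (comp g.inner e) (comp S e) e.target

/-- Locally `S^* = ∇dE + R g E` with a smooth function `E`. -/
def LocallyHess (R : ℝ) (g : SurfaceMetric M)
    (S : ∀ p : M, TangentSpace (𝓡 2) p →L[ℝ] TangentSpace (𝓡 2) p →L[ℝ] ℝ) : Prop :=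
  ∀ e, IsHypChart R g e → ∀ p ∈ e.source,
    ∃ U : Set M, IsOpen U ∧ p ∈ U ∧ U ⊆ e.source ∧
    ∃ E : M → ℝ, ContMDiffOn (𝓡 2) 𝓘(ℝ, ℝ) ∞ E U ∧
      ∀ x ∈ e.target ∩ e.symm ⁻¹' U, ∀ i j,
        starTensor (comp g.inner e) (comp S e) x i j =
          hess (comp g.inner e) (E ∘ e.symm) i j x
            + R * comp g.inner e x i j * (E ∘ e.symm) x

/-- Locally `S^* = ∇dE + R g E`, in the sense of distributions, with `E` of class `W^{2,1}_loc`. -/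
def DistribLocallyHess (R : ℝ) (g : SurfaceMetric M)
    (S : ∀ p : M, TangentSpace (𝓡 2) p →L[ℝ] TangentSpace (𝓡 2) p →L[ℝ] ℝ) : Prop :=
  ∀ e, IsHypChart R g e → ∀ p ∈ e.source,
    ∃ U : Set M, IsOpen U ∧ p ∈ U ∧ U ⊆ e.source ∧
    ∃ E : M → ℝ,
      WeakHessEq (comp g.inner e) R (starTensor (comp g.inner e) (comp S e)) (E ∘ e.symm)
        (e.target ∩ e.symm ⁻¹' U)

end Surface

/-! ### The kernel of `∇d + R g`, and Hamiltonians, on the hyperbolic plane -/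

/-- A function on the upper half plane in the coordinates `(x, y)`. -/
def inCoord (f : ℍ → ℝ) : Plane → ℝ := fun x => f (UpperHalfPlane.ofComplex ⟨x 0, x 1⟩)

/-- The kernel of `∇d + R g` on the hyperbolic plane of curvature `R`. -/
def hessKernel (R : ℝ) : Set (ℍ → ℝ) :=
  {E | ContDiffOn ℝ 2 (inCoord E) halfPlane ∧ ∀ x ∈ halfPlane, ∀ i j,
    hess (hypMetric R) (inCoord E) i j x + R * hypMetric R x i j * inCoord E x = 0}

/-- The kernel of `∇d + R g` in the sense of distributions, on functions of class `W^{2,1}_loc`. -/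
def weakHessKernel (R : ℝ) : Set (ℍ → ℝ) :=
  {E | WeakHessEq (hypMetric R) R 0 (inCoord E) halfPlane}

/-- The functions `x/y`, `1/y`, `(x² + y²)/y`. -/
def kerFun : Fin 3 → ℍ → ℝ :=
  ![fun z => z.re / z.im, fun z => 1 / z.im, fun z => (z.re ^ 2 + z.im ^ 2) / z.im]

/-- The vector fields `x ∂_x + y ∂_y`, `∂_x`, `(x² - y²) ∂_x + 2xy ∂_y`. -/
def killingField : Fin 3 → Plane → Plane :=
  ![fun x => !₂[x 0, x 1], fun _ => !₂[1, 0], fun x => !₂[x 0 ^ 2 - x 1 ^ 2, 2 * x 0 * x 1]]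

/-- `W` is a Killing field of the hyperbolic plane: `(L_W g)_ij = 0`. -/
def IsKilling (R : ℝ) (W : Plane → Plane) : Prop :=
  ContDiffOn ℝ ∞ W halfPlane ∧ ∀ x ∈ halfPlane, ∀ i j,
    ∑ k, (W x k * pd k (fun y => hypMetric R y i j) x
      + hypMetric R x k j * pd i (fun y => W y k) x
      + hypMetric R x i k * pd j (fun y => W y k) x) = 0

/-- `f` is a Hamiltonian of `W`, i.e. `ι_W ω = df`, for the symplectic form
`ω = √(det g) dx ∧ dy` (the area form) of the hyperbolic plane. -/
def IsHamiltonian (R : ℝ) (f : ℍ → ℝ) (W : Plane → Plane) : Prop :=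
  ContDiffOn ℝ ∞ (inCoord f) halfPlane ∧ ∀ x ∈ halfPlane, ∀ v : Plane,
    volDensity (hypMetric R) x * (W x 0 * v 1 - W x 1 * v 0) = fderiv ℝ (inCoord f) x v

/-- The Lie algebra `so(2,1)` of `SO(2,1)`. -/
abbrev so21 := LieAlgebra.Orthogonal.so' (Fin 2) (Fin 1) ℝ

/-- The identification of the upper half plane with the hyperboloid `u² + v² - w² = -1`, `w > 0`, on
which `SO(2,1)` acts by isometries. -/
def hyperboloid (x : Plane) : Fin 2 ⊕ Fin 1 → ℝ :=
  Sum.elim ![x 0 / x 1, (x 0 ^ 2 + x 1 ^ 2 - 1) / (2 * x 1)]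
    ![(x 0 ^ 2 + x 1 ^ 2 + 1) / (2 * x 1)]

/-- `W` is the vector field by which `A ∈ so(2,1)` acts on the hyperbolic plane: on the hyperboloid it
is the field `v ↦ A v`, the velocity of `v ↦ exp(tA) v` at `t = 0`. -/
def IsGenerator (A : so21) (W : Plane → Plane) : Prop :=
  ∀ x ∈ halfPlane,
    fderiv ℝ hyperboloid x (W x) = (A : Matrix (Fin 2 ⊕ Fin 1) (Fin 2 ⊕ Fin 1) ℝ) *ᵥ hyperboloid x

/-- `μ` assigns to each `A ∈ so(2,1)` a Hamiltonian of the vector field of `A`, equivariantly: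
`W_A (μ B) = - μ [A, B]`, the infinitesimal form of `μ (Ad_h B) ∘ h = μ B`. That is, `μ` gives the
Hamiltonians of the Hamiltonian action of `SO(2,1)`. -/
def IsComoment (R : ℝ) (μ : so21 →ₗ[ℝ] (ℍ → ℝ)) : Prop :=
  ∀ A W, IsGenerator A W → IsHamiltonian R (μ A) W ∧
    ∀ B : so21, ∀ x ∈ halfPlane,
      fderiv ℝ (inCoord (μ B)) x (W x) = - inCoord (μ ⁅A, B⁆) x

end

/-! ### Partial derivatives -/

/-! In half-plane coordinates `(x, y)` the Christoffel symbols are constants divided by `y` and `R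
g` is `-1/y²` times the identity, so `R` drops out of `∇dE + R g E`. With `a, b, c` for the
components `00, 01, 11` of `T = S^*`, the equation `D^*S = 0` becomes the Codazzi system `∂₀c =
∂₁b`, `∂₁a + (a + c)/y = ∂₀b`. Tensors `∇dE + R g E` satisfy it: commuting covariant derivatives of
`dE` produces a curvature term, which `R g E` cancels exactly when the curvature is `R`.

For the converse the second order equation is rewritten as a triangular first order system. With `p
= (E/y + ∂₁E)/2`, `q = y ∂₀E - 2xp`, `u = yE` it reads `dp = ½(b dx + c dy)`, `dq = (ya - xb) dx +
(yb - xc) dy`, `du = (q + 2xp) dx + 2yp dy`. The Codazzi system says precisely that the first two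
right-hand sides are closed, and then the third is closed as well. Three applications of the
Poincaré lemma give `E = u/y`: `exists_hypHess_eq` for smooth tensors,
`WeakCodazzi.exists_weakHessEq` for integrable ones. For `T = 0` the functions `p`, `q` and `u - qx
- p(x² + y²)` are constant, which gives the three parameters of the kernel.

The distributional half rests on two facts on boxes: a function with vanishing weak derivatives is
constant (`exists_ae_eq_const_of_hasWeakPD_zero`), and an integrable weakly closed one-form has a
primitive (`exists_hasWeakPD_of_closed`), found by averaging path integrals over starting points.
Both are proved by duality with `antideriv`, a primitive of test functions that keeps compact
support. A partition of unity (`divPairing_eq_zero_of_local`) extends the Codazzi equations from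
small neighbourhoods to a whole chart.

The Killing equations are integrated by hand and give the fields `killComb c`. These are the
generators of `so(2,1)` on the hyperboloid (`isGenerator_iff`), and `R` times them are the
Hamiltonian fields of the kernel functions with the same coefficients. The comoment map is unique
because `so(2,1)` is spanned by brackets, and equivariance determines its values on brackets. -/

theorem pd_eq_of_eventuallyEq {f g : Plane → ℝ} {x : Plane} (h : f =ᶠ[nhds x] g) (i : Fin 2) :
    pd i f x = pd i g x := by
  unfold pd; rw [h.fderiv_eq]

theorem pd_eq_of_eqOn {Ω : Set Plane} (hΩ : IsOpen Ω) {f g : Plane → ℝ} (h : EqOn f g Ω)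
    {x : Plane} (hx : x ∈ Ω) (i : Fin 2) : pd i f x = pd i g x :=
  pd_eq_of_eventuallyEq (Filter.eventuallyEq_of_mem (hΩ.mem_nhds hx) h) i

theorem pd_const (i : Fin 2) (c : ℝ) (x : Plane) : pd i (fun _ => c) x = 0 := by
  simp [pd]

theorem pd_coord (i j : Fin 2) (x : Plane) : pd i (fun y => y j) x = if j = i then 1 else 0 := by
  have h : HasFDerivAt (fun y : Plane => y j) (EuclideanSpace.proj j : Plane →L[ℝ] ℝ) x :=
    (EuclideanSpace.proj j : Plane →L[ℝ] ℝ).hasFDerivAt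
  simp [pd, h.fderiv, coordVec]

theorem differentiableAt_coord (j : Fin 2) (x : Plane) :
    DifferentiableAt ℝ (fun y : Plane => y j) x :=
  (EuclideanSpace.proj j : Plane →L[ℝ] ℝ).differentiableAt

theorem contDiff_coord (j : Fin 2) {n : WithTop ℕ∞} : ContDiff ℝ n (fun y : Plane => y j) :=
  (EuclideanSpace.proj j : Plane →L[ℝ] ℝ).contDiff

section pdRules

variable {f g : Plane → ℝ} {x : Plane}

theorem pd_add (hf : DifferentiableAt ℝ f x) (hg : DifferentiableAt ℝ g x) (i : Fin 2) :
    pd i (fun y => f y + g y) x = pd i f x + pd i g x := by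
  simp [pd, fderiv_fun_add hf hg]

theorem pd_sub (hf : DifferentiableAt ℝ f x) (hg : DifferentiableAt ℝ g x) (i : Fin 2) :
    pd i (fun y => f y - g y) x = pd i f x - pd i g x := by
  simp [pd, fderiv_fun_sub hf hg]

theorem pd_neg (i : Fin 2) : pd i (fun y => - f y) x = - pd i f x := by
  have : (fun y => - f y) = -f := rfl
  simp [pd, this, fderiv_neg]

theorem pd_mul (hf : DifferentiableAt ℝ f x) (hg : DifferentiableAt ℝ g x) (i : Fin 2) :
    pd i (fun y => f y * g y) x = pd i f x * g x + f x * pd i g x := by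
  simp [pd, fderiv_fun_mul hf hg]; ring

theorem pd_const_mul (hf : DifferentiableAt ℝ f x) (c : ℝ) (i : Fin 2) :
    pd i (fun y => c * f y) x = c * pd i f x := by
  rw [pd_mul (differentiableAt_const c) hf, pd_const]; ring

theorem pd_inv (hf : DifferentiableAt ℝ f x) (h0 : f x ≠ 0) (i : Fin 2) :
    pd i (fun y => (f y)⁻¹) x = - pd i f x / f x ^ 2 := by
  have := (hasDerivAt_inv h0).comp_hasFDerivAt x hf.hasFDerivAt
  have h2 : HasFDerivAt (fun y => (f y)⁻¹) (-(f x ^ 2)⁻¹ • fderiv ℝ f x) x := this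
  simp [pd, h2.fderiv]; ring

theorem pd_div (hf : DifferentiableAt ℝ f x) (hg : DifferentiableAt ℝ g x) (h0 : g x ≠ 0)
    (i : Fin 2) :
    pd i (fun y => f y / g y) x = (pd i f x * g x - f x * pd i g x) / g x ^ 2 := by
  simp only [div_eq_mul_inv]
  rw [pd_mul hf (hg.fun_inv h0), pd_inv hg h0]
  field_simp
  ring

theorem pd_pow (hf : DifferentiableAt ℝ f x) (n : ℕ) (i : Fin 2) :
    pd i (fun y => f y ^ n) x = n * f x ^ (n - 1) * pd i f x := by
  simp [pd, fderiv_fun_pow n hf, mul_assoc]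

theorem fderiv_apply_eq_pd (f : Plane → ℝ) (x v : Plane) :
    fderiv ℝ f x v = v 0 * pd 0 f x + v 1 * pd 1 f x := by
  have : v = v 0 • coordVec 0 + v 1 • coordVec 1 := by
    ext i; fin_cases i <;> simp [coordVec]
  conv_lhs => rw [this]
  simp [pd]

theorem pd_pd_comm {Ω : Set Plane} (hΩ : IsOpen Ω) (hf : ContDiffOn ℝ 2 f Ω) (hx : x ∈ Ω)
    (i j : Fin 2) : pd i (pd j f) x = pd j (pd i f) x := by
  have hat : ContDiffAt ℝ 2 f x := hf.contDiffAt (hΩ.mem_nhds hx)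
  have hs : IsSymmSndFDerivAt ℝ f x := hat.isSymmSndFDerivAt (by simp)
  have hd : DifferentiableAt ℝ (fderiv ℝ f) x :=
    (hat.fderiv_right (m := 1) (by norm_num)).differentiableAt (by norm_num)
  have key : ∀ a b : Fin 2, pd a (pd b f) x = fderiv ℝ (fderiv ℝ f) x (coordVec a) (coordVec b) := by
    intro a b
    have : HasFDerivAt (fun y => fderiv ℝ f y (coordVec b))
        ((fderiv ℝ (fderiv ℝ f) x).flip (coordVec b)) x := by
      simpa using hd.hasFDerivAt.clm_apply (hasFDerivAt_const (coordVec b) x)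
    change fderiv ℝ (fun y => fderiv ℝ f y (coordVec b)) x (coordVec a) = _
    rw [this.fderiv]; rfl
  rw [key, key, hs.eq]

theorem ContDiffOn.pd {Ω : Set Plane} {m n : WithTop ℕ∞} (hf : ContDiffOn ℝ n f Ω)
    (hΩ : IsOpen Ω) (hmn : m + 1 ≤ n) (i : Fin 2) : ContDiffOn ℝ m (pd i f) Ω :=
  (hf.fderiv_of_isOpen hΩ hmn).clm_apply contDiffOn_const

theorem ContDiff.pd {m n : WithTop ℕ∞} (hf : ContDiff ℝ n f) (hmn : m + 1 ≤ n) (i : Fin 2) :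
    ContDiff ℝ m (pd i f) :=
  (hf.fderiv_right hmn).clm_apply contDiff_const

end pdRules

/-! ### Test functions -/

namespace IsTest

variable {Ω Ω' : Set Plane} {φ ψ : Plane → ℝ}

theorem mono (h : IsTest Ω φ) (hs : Ω ⊆ Ω') : IsTest Ω' φ := ⟨h.1, h.2.1, h.2.2.trans hs⟩

theorem differentiableAt (h : IsTest Ω φ) (x : Plane) : DifferentiableAt ℝ φ x :=
  (h.1.differentiable (by simp)) x

theorem continuous (h : IsTest Ω φ) : Continuous φ := h.1.continuous

theorem eq_zero (h : IsTest Ω φ) {x : Plane} (hx : x ∉ Ω) : φ x = 0 :=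
  image_eq_zero_of_notMem_tsupport fun h' => hx (h.2.2 h')

theorem of_contDiff_of_subset {K : Set Plane} (hφ : ContDiff ℝ ∞ φ) (hK : IsCompact K)
    (hKΩ : K ⊆ Ω) (h : ∀ x ∉ K, φ x = 0) : IsTest Ω φ :=
  ⟨hφ, HasCompactSupport.intro hK (fun x hx => h x hx),
    (closure_minimal (fun x (hx : φ x ≠ 0) => by_contra fun hn => hx (h x hn))
      hK.isClosed).trans hKΩ⟩

theorem pd (h : IsTest Ω φ) (i : Fin 2) : IsTest Ω (pd i φ) :=
  of_contDiff_of_subset (h.1.pd (by simp) i) h.2.1 h.2.2 fun x hx => by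
    have : fderiv ℝ φ x = 0 := image_eq_zero_of_notMem_tsupport fun h' =>
      hx (tsupport_fderiv_subset ℝ h')
    simp [_root_.pd, this]

theorem add (h : IsTest Ω φ) (h' : IsTest Ω ψ) : IsTest Ω (fun x => φ x + ψ x) :=
  of_contDiff_of_subset (h.1.add h'.1) (h.2.1.isCompact.union h'.2.1.isCompact)
    (union_subset h.2.2 h'.2.2) fun x hx => by
      rw [mem_union, not_or] at hx
      rw [image_eq_zero_of_notMem_tsupport hx.1, image_eq_zero_of_notMem_tsupport hx.2, add_zero]

/-- The values of `c` off `Ω` are irrelevant: near a point outside the support of `φ` the product is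
zero. -/
theorem mul_smooth (h : IsTest Ω φ) (hΩ : IsOpen Ω) {c : Plane → ℝ} (hc : ContDiffOn ℝ ∞ c Ω) :
    IsTest Ω (fun x => c x * φ x) := by
  refine of_contDiff_of_subset ?_ h.2.1.isCompact h.2.2 fun x hx => by
    rw [image_eq_zero_of_notMem_tsupport hx, mul_zero]
  rw [contDiff_iff_contDiffAt]
  intro x
  by_cases hx : x ∈ tsupport φ
  · exact (hc.contDiffAt (hΩ.mem_nhds (h.2.2 hx))).mul h.1.contDiffAt
  · have : (fun x => c x * φ x) =ᶠ[nhds x] fun _ => 0 := by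
      filter_upwards [(notMem_tsupport_iff_eventuallyEq.mp hx)] with y hy
      rw [hy]; simp
    exact contDiffAt_const.congr_of_eventuallyEq this

/-- Cutting off a test function on `Ω` by a smooth function supported in `Ω'`. -/
theorem mul_of_tsupport_subset (h : IsTest Ω φ) {c : Plane → ℝ} (hc : ContDiff ℝ ∞ c)
    (hs : tsupport c ⊆ Ω') : IsTest (Ω ∩ Ω') (fun x => c x * φ x) := by
  refine of_contDiff_of_subset (hc.mul h.1)
    (h.2.1.isCompact.inter_right (isClosed_tsupport c)) (inter_subset_inter h.2.2 hs) ?_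
  intro x hx
  by_cases h1 : x ∈ tsupport φ
  · rw [image_eq_zero_of_notMem_tsupport fun h2 => hx ⟨h1, h2⟩, zero_mul]
  · rw [image_eq_zero_of_notMem_tsupport h1, mul_zero]

theorem setIntegral_mul (h : IsTest Ω φ) (f : Plane → ℝ) :
    ∫ x in Ω, f x * φ x = ∫ x, f x * φ x :=
  setIntegral_eq_integral_of_forall_compl_eq_zero fun x hx => by rw [h.eq_zero hx, mul_zero]

theorem integrable_mul (h : IsTest Ω φ) {f : Plane → ℝ} (hf : LocallyIntegrableOn f Ω) :
    Integrable (fun x => f x * φ x) := by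
  have h1 : IntegrableOn f (tsupport φ) := hf.integrableOn_compact_subset h.2.2 h.2.1
  have h2 : IntegrableOn (fun x => f x * φ x) (tsupport φ) :=
    h1.mul_continuousOn h.continuous.continuousOn h.2.1
  refine (integrableOn_iff_integrable_of_support_subset fun x hx => ?_).mp h2
  by_contra hn
  exact hx (by simp [image_eq_zero_of_notMem_tsupport hn])

theorem integrable (h : IsTest Ω φ) : Integrable φ := h.continuous.integrable_of_hasCompactSupport h.2.1

end IsTest

/-! ### Weak derivatives -/

theorem hasWeakPD_iff {i : Fin 2} {f f' : Plane → ℝ} {Ω : Set Plane} :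
    HasWeakPD i f f' Ω ↔ ∀ φ, IsTest Ω φ → ∫ x, f x * pd i φ x = - ∫ x, f' x * φ x := by
  unfold HasWeakPD
  refine forall₂_congr fun φ hφ => ?_
  rw [hφ.setIntegral_mul, (hφ.pd i).setIntegral_mul]

namespace HasWeakPD

variable {i : Fin 2} {f f' g g' c : Plane → ℝ} {Ω : Set Plane}

theorem add (hf : LocallyIntegrableOn f Ω) (hf' : LocallyIntegrableOn f' Ω)
    (hg : LocallyIntegrableOn g Ω) (hg' : LocallyIntegrableOn g' Ω)
    (h : HasWeakPD i f f' Ω) (h' : HasWeakPD i g g' Ω) :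
    HasWeakPD i (fun x => f x + g x) (fun x => f' x + g' x) Ω := by
  rw [hasWeakPD_iff] at *
  intro φ hφ
  simp only [add_mul]
  rw [integral_add ((hφ.pd i).integrable_mul hf) ((hφ.pd i).integrable_mul hg),
    integral_add (hφ.integrable_mul hf') (hφ.integrable_mul hg'), h φ hφ, h' φ hφ]
  ring

theorem congr_ae {f₂ f₂' : Plane → ℝ} (h : HasWeakPD i f f' Ω)
    (e : ∀ᵐ x ∂(volume.restrict Ω), f x = f₂ x) (e' : ∀ᵐ x ∂(volume.restrict Ω), f' x = f₂' x) :
    HasWeakPD i f₂ f₂' Ω := by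
  intro φ hφ
  have h1 := h φ hφ
  rw [integral_congr_ae (g := fun x => f₂ x * pd i φ x) (by filter_upwards [e] with x hx; rw [hx]),
    integral_congr_ae (μ := volume.restrict Ω) (f := fun x => f' x * φ x) (g := fun x => f₂' x * φ x)
    (by filter_upwards [e'] with x hx; rw [hx])] at h1
  exact h1

/-- The Leibniz rule is moved to the test side: `c φ` is again a test function, and the hypothesis
on `f` is applied to it. -/
theorem smooth_mul (hΩ : IsOpen Ω) (hc : ContDiffOn ℝ ∞ c Ω)
    (hf : LocallyIntegrableOn f Ω) (hf' : LocallyIntegrableOn f' Ω) (h : HasWeakPD i f f' Ω) :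
    HasWeakPD i (fun x => c x * f x) (fun x => pd i c x * f x + c x * f' x) Ω := by
  rw [hasWeakPD_iff] at *
  intro φ hφ
  have hc' : ContDiffOn ℝ ∞ (pd i c) Ω := hc.pd hΩ (by simp) i
  have t1 := hφ.mul_smooth hΩ hc
  have t2 := hφ.mul_smooth hΩ hc'
  have t3 := (hφ.pd i).mul_smooth hΩ hc
  have key : ∀ x, pd i (fun x => c x * φ x) x = pd i c x * φ x + c x * pd i φ x := by
    intro x
    by_cases hx : x ∈ Ω
    · exact pd_mul ((hc.contDiffAt (hΩ.mem_nhds hx)).differentiableAt (by simp))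
        (hφ.differentiableAt x) i
    · rw [(t1.pd i).eq_zero hx, hφ.eq_zero hx, (hφ.pd i).eq_zero hx]; ring
  have h1 := h _ t1
  simp only [key, mul_add] at h1
  rw [integral_add (t2.integrable_mul hf) (t3.integrable_mul hf)] at h1
  have e1 : ∀ x, c x * f x * pd i φ x = f x * (c x * pd i φ x) := fun x => by ring
  have e2 : ∀ x, (pd i c x * f x + c x * f' x) * φ x
    = f x * (pd i c x * φ x) + f' x * (c x * φ x) := fun x => by ring
  simp only [e1, e2]
  rw [integral_add (t2.integrable_mul hf) (t1.integrable_mul hf')]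
  linarith

end HasWeakPD

theorem integral_pd_eq_zero {φ : Plane → ℝ} (h : IsTest univ φ) (i : Fin 2) :
    ∫ x, pd i φ x = 0 := by
  have h1 : ∀ x, (1 : ℝ) * fderiv ℝ φ x (coordVec i) = pd i φ x := fun x => one_mul _
  have := integral_mul_fderiv_eq_neg_fderiv_mul_of_integrable (𝕜 := ℝ) (μ := (volume : Measure Plane))
    (f := fun _ => (1 : ℝ)) (g := φ) (v := coordVec i) (by simp)
    (by simpa only [h1] using (h.pd i).integrable)
    (by simpa using h.integrable) (fun x _ => differentiableAt_const _)
    (fun x _ => h.differentiableAt x)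
  simp only [h1] at this
  simpa using this

/-- Classical derivatives of functions that are smooth on an open set are weak derivatives. -/
theorem HasWeakPD.of_contDiffOn {Ω : Set Plane} (hΩ : IsOpen Ω) {f : Plane → ℝ}
    (hf : ContDiffOn ℝ ∞ f Ω) (i : Fin 2) : HasWeakPD i f (pd i f) Ω := by
  -- The function `f` is regarded as `f · 1`, so the Leibniz rule reduces the claim to the constant
  -- `1`.
  have h1 : HasWeakPD i (fun _ => (1 : ℝ)) (fun _ => 0) Ω := by
    rw [hasWeakPD_iff]
    intro φ hφ
    simpa using integral_pd_eq_zero (hφ.mono (subset_univ _)) i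
  have h2 := h1.smooth_mul hΩ hf ((locallyIntegrable_const 1).locallyIntegrableOn Ω)
    ((locallyIntegrable_const 0).locallyIntegrableOn Ω)
  simpa using h2

/-! ### Weighted integrals along coordinate lines -/

/-- The integral of `φ` along the line through `x` in direction `i`, weighted by `K`. -/
noncomputable def lineInt (K : ℝ → ℝ) (i : Fin 2) (φ : Plane → ℝ) (x : Plane) : ℝ :=
  ∫ r, K r * φ (x - r • coordVec i)

theorem norm_coordVec (i : Fin 2) : ‖coordVec i‖ = 1 := by simp [coordVec]

theorem coordVec_apply (i j : Fin 2) : (coordVec i) j = if j = i then 1 else 0 := by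
  simp [coordVec]

/-- Lines starting in a bounded set meet the compact support only at uniformly bounded parameters.
This uniformity justifies smoothness and differentiation of line integrals. -/
theorem IsTest.exists_radius {Ω : Set Plane} {φ : Plane → ℝ} (h : IsTest Ω φ) (i : Fin 2) (n : ℝ) :
    ∃ N, ∀ x ∈ Metric.ball (0 : Plane) n, ∀ r : ℝ, r ∉ Metric.closedBall (0 : ℝ) N →
      φ (x - r • coordVec i) = 0 := by
  obtain ⟨R, hR⟩ := h.2.1.isCompact.isBounded.subset_closedBall (0 : Plane)
  refine ⟨n + R, fun x hx r hr => image_eq_zero_of_notMem_tsupport fun ht => hr ?_⟩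
  have h1 := hR ht
  rw [mem_closedBall_zero_iff] at h1 ⊢
  rw [mem_ball_zero_iff] at hx
  have h2 : r • coordVec i = x - (x - r • coordVec i) := by abel
  have h3 : ‖r • coordVec i‖ ≤ ‖x‖ + ‖x - r • coordVec i‖ := by
    conv_lhs => rw [h2]
    exact norm_sub_le _ _
  rw [norm_smul, norm_coordVec, mul_one] at h3
  linarith

section

variable {Ω : Set Plane} {φ : Plane → ℝ} {K : ℝ → ℝ}

/-- The line integral is the value at `0` of the convolution of `K` with `t ↦ φ (x + t eᵢ)`, in
which `x` is a parameter; convolutions depend smoothly on such parameters. -/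
theorem contDiff_lineInt (hK : LocallyIntegrable K) (h : IsTest Ω φ) (i : Fin 2) :
    ContDiff ℝ ∞ (lineInt K i φ) := by
  rw [contDiff_iff_contDiffAt]
  intro x₀
  obtain ⟨N, hN⟩ := h.exists_radius i (‖x₀‖ + 1)
  have hg : ContDiff ℝ ∞ (fun p : Plane × ℝ => φ (p.1 + p.2 • coordVec i)) :=
    h.1.comp (contDiff_fst.add (contDiff_snd.smul contDiff_const))
  have := contDiffOn_convolution_right_with_param_comp (n := (⊤ : ℕ∞)) (μ := (volume : Measure ℝ))
    (ContinuousLinearMap.mul ℝ ℝ) (s := Metric.ball (0 : Plane) (‖x₀‖ + 1)) (v := fun _ => (0 : ℝ))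
    contDiffOn_const (f := K) (g := fun x t => φ (x + t • coordVec i))
    (k := Metric.closedBall (0 : ℝ) N) Metric.isOpen_ball (isCompact_closedBall 0 N)
    (fun p t hp ht => by
      have := hN p hp (-t) (by simpa using ht)
      simpa using this) hK hg.contDiffOn
  have h2 := this.contDiffAt (Metric.isOpen_ball.mem_nhds (x := x₀) (by simp))
  convert h2 using 1
  ext x
  simp [lineInt, convolution, sub_eq_add_neg]

/-- The derivative along `s ↦ x + s eⱼ` at `0` is computed twice: by the chain rule, and under the
integral sign with `‖K‖ C` on a fixed ball as dominating function. -/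
theorem pd_lineInt (hK : LocallyIntegrable K) (h : IsTest Ω φ) (i j : Fin 2) (x : Plane) :
    pd j (lineInt K i φ) x = lineInt K i (pd j φ) x := by
  have hdiff : DifferentiableAt ℝ (lineInt K i φ) x :=
    ((contDiff_lineInt hK h i).differentiable (by simp)) x
  have hline : ∀ (y v : Plane) (s : ℝ), HasDerivAt (fun s : ℝ => y + s • v) v s := fun y v s => by
    simpa using ((hasDerivAt_id s).smul_const v).const_add y
  have h1 : HasDerivAt (fun s : ℝ => lineInt K i φ (x + s • coordVec j))
      (pd j (lineInt K i φ) x) 0 := by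
    have h0 := hline x (coordVec j) 0
    have := HasFDerivAt.comp_hasDerivAt (x := (0 : ℝ)) (f := fun s : ℝ => x + s • coordVec j)
      (l := lineInt K i φ) (l' := fderiv ℝ (lineInt K i φ) x)
      (by simpa using hdiff.hasFDerivAt) h0
    exact this
  obtain ⟨N, hN⟩ := (h.pd j).exists_radius i (‖x‖ + 1)
  obtain ⟨N', hN'⟩ := h.exists_radius i (‖x‖ + 1)
  obtain ⟨C, hC⟩ := (h.pd j).2.1.exists_bound_of_continuous (h.pd j).continuous
  have hball : ∀ s ∈ Metric.ball (0 : ℝ) 1, x + s • coordVec j ∈ Metric.ball (0 : Plane) (‖x‖ + 1) := by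
    intro s hs
    rw [mem_ball_zero_iff] at hs ⊢
    calc _ ≤ ‖x‖ + ‖s • coordVec j‖ := norm_add_le _ _
      _ < _ := by rw [norm_smul, norm_coordVec, mul_one]; linarith
  have hmeas : ∀ (χ : Plane → ℝ) (y : Plane), Continuous χ →
      AEStronglyMeasurable (fun r => K r * χ (y - r • coordVec i)) volume := fun χ y hχ =>
    hK.aestronglyMeasurable.mul (by fun_prop : Continuous _).aestronglyMeasurable
  have h2 := hasDerivAt_integral_of_dominated_loc_of_deriv_le (μ := (volume : Measure ℝ))
    (F := fun s r => K r * φ (x + s • coordVec j - r • coordVec i))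
    (F' := fun s r => K r * pd j φ (x + s • coordVec j - r • coordVec i)) (x₀ := (0 : ℝ))
    (bound := fun r => (Metric.closedBall (0 : ℝ) N).indicator (fun r => ‖K r‖ * C) r)
    (Metric.ball_mem_nhds 0 one_pos) (Filter.Eventually.of_forall fun s => hmeas _ _ h.continuous)
    (by
      have hk : IntegrableOn K (Metric.closedBall (0 : ℝ) N') :=
        hK.integrableOn_isCompact (isCompact_closedBall _ _)
      refine (integrableOn_iff_integrable_of_support_subset (s := Metric.closedBall (0 : ℝ) N')
        fun r hr => ?_).mp (hk.mul_continuousOn (g' := fun r =>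
          φ (x + (0 : ℝ) • coordVec j - r • coordVec i))
          (by have := h.continuous; fun_prop) (isCompact_closedBall _ _))
      by_contra hn
      exact hr (by simp only [hN' _ (hball 0 (by simp)) r hn, mul_zero]))
    (hmeas _ _ (h.pd j).continuous)
    (Filter.Eventually.of_forall fun r s hs => by
      by_cases hr : r ∈ Metric.closedBall (0 : ℝ) N
      · rw [indicator_of_mem hr, norm_mul]
        exact mul_le_mul_of_nonneg_left (hC _) (norm_nonneg _)
      · rw [indicator_of_notMem hr, hN _ (hball s hs) r hr, mul_zero, norm_zero])
    ((integrable_indicator_iff measurableSet_closedBall).mpr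
      ((hK.integrableOn_isCompact (isCompact_closedBall _ _)).norm.mul_const C))
    (Filter.Eventually.of_forall fun r s hs => by
      refine HasDerivAt.const_mul _ ?_
      have h0 := (hline x (coordVec j) s).sub_const (r • coordVec i)
      have := HasFDerivAt.comp_hasDerivAt (x := s) (l := φ)
        (h.differentiableAt _).hasFDerivAt h0
      exact this)
  have h3 := h1.unique h2.2
  rw [h3]
  simp [lineInt]

theorem hasDerivAt_line (h : IsTest Ω φ) (i : Fin 2) (x : Plane) (r : ℝ) :
    HasDerivAt (fun r : ℝ => φ (x - r • coordVec i)) (-pd i φ (x - r • coordVec i)) r := by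
  have h0 : HasDerivAt (fun r : ℝ => x - r • coordVec i) (-coordVec i) r := by
    simpa using ((hasDerivAt_id r).smul_const (coordVec i)).const_sub x
  have := HasFDerivAt.comp_hasDerivAt (x := r) (l := φ) (h.differentiableAt _).hasFDerivAt h0
  rw [map_neg] at this
  exact this

theorem hasCompactSupport_line (h : IsTest Ω φ) (i : Fin 2) (x : Plane) :
    HasCompactSupport (fun r : ℝ => φ (x - r • coordVec i)) := by
  obtain ⟨N, hN⟩ := h.exists_radius i (‖x‖ + 1)
  exact HasCompactSupport.intro (isCompact_closedBall (0 : ℝ) N) fun r hr => hN x (by simp) r hr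

theorem contDiff_line (h : IsTest Ω φ) (i : Fin 2) (x : Plane) :
    ContDiff ℝ ∞ (fun r : ℝ => φ (x - r • coordVec i)) :=
  h.1.comp (contDiff_const.sub (contDiff_id.smul contDiff_const))

/-- The Heaviside function. -/
noncomputable def heaviside : ℝ → ℝ := indicator (Ioi 0) 1

theorem locallyIntegrable_heaviside : LocallyIntegrable heaviside :=
  (locallyIntegrable_const (1 : ℝ)).indicator measurableSet_Ioi

theorem lineInt_heaviside (i : Fin 2) (φ : Plane → ℝ) (x : Plane) :
    lineInt heaviside i φ x = ∫ r in Ioi (0 : ℝ), φ (x - r • coordVec i) := by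
  rw [lineInt, ← integral_indicator measurableSet_Ioi]
  congr 1; ext r
  by_cases hr : r ∈ Ioi (0 : ℝ) <;> simp [heaviside, hr]

/-- On the ray, `∂ᵢφ` is minus the derivative in `r`, so only the value at `r = 0` survives. -/
theorem lineInt_heaviside_pd (h : IsTest Ω φ) (i : Fin 2) (x : Plane) :
    lineInt heaviside i (pd i φ) x = φ x := by
  rw [lineInt_heaviside]
  have := (hasCompactSupport_line h i x).integral_Ioi_deriv_eq
    ((contDiff_line h i x).of_le (by simp)) 0
  simp only [(hasDerivAt_line h i x _).deriv, integral_neg] at this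
  simpa using this

theorem lineInt_one_pd (h : IsTest Ω φ) (i : Fin 2) (x : Plane) :
    lineInt (fun _ => 1) i (pd i φ) x = 0 := by
  have := integral_eq_zero_of_hasDerivAt_of_integrable (hasDerivAt_line h i x)
    ((((contDiff_line (h.pd i) i x).continuous.integrable_of_hasCompactSupport
      (hasCompactSupport_line (h.pd i) i x))).neg)
    ((contDiff_line h i x).continuous.integrable_of_hasCompactSupport (hasCompactSupport_line h i x))
  rw [integral_neg] at this
  simpa [lineInt] using this

end

/-! ### Primitives of test functions on boxes -/

/-- The product of two sets of real numbers, in the coordinate plane. -/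
def box (A : Fin 2 → Set ℝ) : Set Plane := {x | ∀ i, x i ∈ A i}

theorem isOpen_box {A : Fin 2 → Set ℝ} (hA : ∀ i, IsOpen (A i)) : IsOpen (box A) := by
  have : box A = ⋂ i, (fun x : Plane => x i) ⁻¹' A i := by ext; simp [box]
  rw [this]
  exact isOpen_iInter_of_finite fun i => (hA i).preimage (contDiff_coord i (n := 0)).continuous

theorem isCompact_box_Icc (m M : Fin 2 → ℝ) : IsCompact (box fun i => Icc (m i) (M i)) := by
  have h : IsCompact (Set.pi univ fun i : Fin 2 => Icc (m i) (M i)) :=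
    isCompact_univ_pi fun i => isCompact_Icc
  convert h.image (PiLp.continuous_toLp 2 fun _ : Fin 2 => ℝ) using 1
  ext x
  constructor
  · intro hx
    exact ⟨x.ofLp, fun i _ => hx i, rfl⟩
  · rintro ⟨y, hy, rfl⟩ i
    exact hy i trivial

/-- `ψ` is a smooth function with integral `1` and compact support in `A`. -/
structure IsUnitBump (A : Set ℝ) (ψ : ℝ → ℝ) : Prop where
  contDiff : ContDiff ℝ ∞ ψ
  hasCompactSupport : HasCompactSupport ψ
  tsupport_subset : tsupport ψ ⊆ A
  integral_eq : ∫ r, ψ r = 1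

theorem exists_isUnitBump {A : Set ℝ} (hA : IsOpen A) (hne : A.Nonempty) : ∃ ψ, IsUnitBump A ψ := by
  obtain ⟨a, ha⟩ := hne
  obtain ⟨ε, hε, hball⟩ := Metric.isOpen_iff.mp hA a ha
  let f : ContDiffBump a := ⟨ε / 4, ε / 2, by positivity, by linarith⟩
  refine ⟨f.normed volume, f.contDiff_normed, f.hasCompactSupport_normed, ?_, f.integral_normed⟩
  rw [f.tsupport_normed_eq]
  exact (Metric.closedBall_subset_ball (by change ε / 2 < ε; linarith)).trans hball

namespace IsUnitBump

variable {A : Set ℝ} {ψ : ℝ → ℝ}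

theorem integrable (h : IsUnitBump A ψ) : Integrable ψ :=
  h.contDiff.continuous.integrable_of_hasCompactSupport h.hasCompactSupport

end IsUnitBump

/-- The distribution function of `ψ`. -/
noncomputable def cumul (ψ : ℝ → ℝ) (s : ℝ) : ℝ := ∫ r in Iic s, ψ r

theorem IsUnitBump.hasDerivAt_cumul {A : Set ℝ} {ψ : ℝ → ℝ} (h : IsUnitBump A ψ) (s : ℝ) :
    HasDerivAt (cumul ψ) (ψ s) s := by
  have h1 : cumul ψ = fun s => (∫ r in (0 : ℝ)..s, ψ r) + cumul ψ 0 := by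
    ext s
    have := intervalIntegral.integral_Iic_sub_Iic (f := ψ) (μ := volume) (a := 0) (b := s)
      h.integrable.integrableOn h.integrable.integrableOn
    rw [← this]; simp [cumul]
  rw [h1]
  exact (intervalIntegral.integral_hasDerivAt_right h.integrable.intervalIntegrable
    (h.contDiff.continuous.stronglyMeasurableAtFilter _ _)
    h.contDiff.continuous.continuousAt).add_const _

theorem IsUnitBump.contDiff_cumul {A : Set ℝ} {ψ : ℝ → ℝ} (h : IsUnitBump A ψ) :
    ContDiff ℝ ∞ (cumul ψ) := by
  rw [contDiff_infty_iff_deriv]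
  refine ⟨fun s => (h.hasDerivAt_cumul s).differentiableAt, ?_⟩
  have : deriv (cumul ψ) = ψ := by ext s; exact (h.hasDerivAt_cumul s).deriv
  rw [this]; exact h.contDiff

/-- A primitive in direction `i` of `φ - ψ(xᵢ) ∫ φ`. -/
noncomputable def antideriv (ψ : ℝ → ℝ) (i : Fin 2) (φ : Plane → ℝ) (x : Plane) : ℝ :=
  lineInt heaviside i φ x - cumul ψ (x i) * lineInt (fun _ => 1) i φ x

theorem exists_Icc_of_isCompact {A C : Set ℝ} (hA : A.OrdConnected) (hne : A.Nonempty)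
    (hC : IsCompact C) (hCA : C ⊆ A) : ∃ m M, C ⊆ Icc m M ∧ Icc m M ⊆ A := by
  obtain rfl | hCne := C.eq_empty_or_nonempty
  · obtain ⟨a, ha⟩ := hne
    exact ⟨a, a, by simp, by simpa using ha⟩
  · exact ⟨sInf C, sSup C, fun x hx => ⟨csInf_le hC.bddBelow hx, le_csSup hC.bddAbove hx⟩,
      hA.out (hCA (hC.sInf_mem hCne)) (hCA (hC.sSup_mem hCne))⟩

/-- A single closed box inside `box A` controls the supports of `φ` and of all `ψ i`.
Order-connectedness keeps the interval hull of each projected support inside `A i`. -/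
theorem IsTest.exists_Icc {A : Fin 2 → Set ℝ} (hA : ∀ i, (A i).OrdConnected)
    (hne : ∀ i, (A i).Nonempty) {φ : Plane → ℝ} (h : IsTest (box A) φ) {ψ : Fin 2 → ℝ → ℝ}
    (hψ : ∀ i, IsUnitBump (A i) (ψ i)) :
    ∃ m M : Fin 2 → ℝ, (∀ i, Icc (m i) (M i) ⊆ A i) ∧
      (∀ x, x ∉ box (fun i => Icc (m i) (M i)) → φ x = 0) ∧
      ∀ i, ∀ r ∉ Icc (m i) (M i), ψ i r = 0 := by
  have key : ∀ i, ∃ m M, (((fun x : Plane => x i) '' tsupport φ) ∪ tsupport (ψ i)) ⊆ Icc m M ∧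
      Icc m M ⊆ A i := fun i => by
    refine exists_Icc_of_isCompact (hA i) (hne i) ((h.2.1.isCompact.image
      (contDiff_coord i (n := 0)).continuous).union (hψ i).hasCompactSupport.isCompact)
      (union_subset ?_ (hψ i).tsupport_subset)
    rintro _ ⟨x, hx, rfl⟩
    exact h.2.2 hx i
  choose m M h1 h2 using key
  refine ⟨m, M, h2, fun x hx => ?_, fun i r hr => ?_⟩
  · refine image_eq_zero_of_notMem_tsupport fun ht => hx fun i => h1 i (Or.inl ⟨x, ht, rfl⟩)
  · exact image_eq_zero_of_notMem_tsupport fun ht => hr (h1 i (Or.inr ht))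

section

variable {A : Fin 2 → Set ℝ} {φ : Plane → ℝ} {ψ : Fin 2 → ℝ → ℝ}

theorem contDiff_comp_coord {f : ℝ → ℝ} (hf : ContDiff ℝ ∞ f) (i : Fin 2) :
    ContDiff ℝ ∞ (fun x : Plane => f (x i)) := hf.comp (contDiff_coord i)

theorem pd_comp_coord {f : ℝ → ℝ} {f' : ℝ} {x : Plane} (i j : Fin 2)
    (hf : HasDerivAt f f' (x i)) : pd j (fun x : Plane => f (x i)) x = if i = j then f' else 0 := by
  have h1 : HasFDerivAt (fun y : Plane => y i) (EuclideanSpace.proj i : Plane →L[ℝ] ℝ) x :=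
    (EuclideanSpace.proj i : Plane →L[ℝ] ℝ).hasFDerivAt
  have h2 : HasFDerivAt (fun x : Plane => f (x i)) _ x := hf.comp_hasFDerivAt x h1
  rw [pd, h2.fderiv]
  simp [coordVec_apply]

theorem IsTest.lineInt_one_mul (hA : ∀ i, (A i).OrdConnected) (hne : ∀ i, (A i).Nonempty)
    (h : IsTest (box A) φ) (hψ : ∀ i, IsUnitBump (A i) (ψ i)) (i : Fin 2) :
    IsTest (box A) (fun x => ψ i (x i) * lineInt (fun _ => 1) i φ x) := by
  obtain ⟨m, M, hmM, hφ, hψ0⟩ := h.exists_Icc hA hne hψ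
  refine IsTest.of_contDiff_of_subset ((contDiff_comp_coord (hψ i).contDiff i).mul
    (contDiff_lineInt (locallyIntegrable_const 1) h i)) (isCompact_box_Icc m M)
    (fun x hx j => hmM j (hx j)) fun x hx => ?_
  have : ∃ j, x j ∉ Icc (m j) (M j) := not_forall.mp hx
  obtain ⟨j, hj⟩ := this
  by_cases hij : j = i
  · subst hij
    rw [hψ0 j _ hj, zero_mul]
  · have : ∀ r : ℝ, φ (x - r • coordVec i) = 0 := fun r => hφ _ fun hb => hj (by
      have := hb j
      simpa [coordVec_apply, hij] using this)
    simp [lineInt, this]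

/-- Before the closed box both terms vanish. Beyond it the Heaviside integral has become the full
line integral and `cumul` has reached `1`, so the terms cancel. Off the box in the other direction
the whole line misses the support of `φ`. -/
theorem IsTest.antideriv (hA : ∀ i, (A i).OrdConnected) (hne : ∀ i, (A i).Nonempty)
    (h : IsTest (box A) φ) (hψ : ∀ i, IsUnitBump (A i) (ψ i)) (i : Fin 2) :
    IsTest (box A) (antideriv (ψ i) i φ) := by
  obtain ⟨m, M, hmM, hφ, hψ0⟩ := h.exists_Icc hA hne hψ
  refine IsTest.of_contDiff_of_subset ((contDiff_lineInt locallyIntegrable_heaviside h i).sub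
    ((contDiff_comp_coord (hψ i).contDiff_cumul i).mul
    (contDiff_lineInt (locallyIntegrable_const 1) h i))) (isCompact_box_Icc m M)
    (fun x hx j => hmM j (hx j)) fun x hx => ?_
  have : ∃ j, x j ∉ Icc (m j) (M j) := not_forall.mp hx
  obtain ⟨j, hj⟩ := this
  by_cases hij : j = i
  · subst hij
    have hφ' : ∀ r : ℝ, x j - r ∉ Icc (m j) (M j) → φ (x - r • coordVec j) = 0 := fun r hr =>
      hφ _ fun hb => hr (by simpa [coordVec_apply] using hb j)
    rcases lt_or_ge (x j) (m j) with hlt | hge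
    · have h1 : cumul (ψ j) (x j) = 0 := setIntegral_eq_zero_of_forall_eq_zero fun r hr =>
        hψ0 j r fun hr' => by have := hr'.1; have := mem_Iic.mp hr; linarith
      have h2 : lineInt heaviside j φ x = 0 := by
        rw [lineInt_heaviside]
        exact setIntegral_eq_zero_of_forall_eq_zero fun r hr =>
          hφ' r fun hr' => by have := hr'.1; have := mem_Ioi.mp hr; linarith
      simp [_root_.antideriv, h1, h2]
    · have hgt : M j < x j := by
        by_contra hle
        exact hj ⟨hge, not_lt.mp hle⟩
      have h1 : cumul (ψ j) (x j) = 1 := by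
        rw [← (hψ j).integral_eq, cumul]
        exact setIntegral_eq_integral_of_forall_compl_eq_zero fun r hr => hψ0 j r fun hr' => by
          have := hr'.2; simp only [mem_Iic, not_le] at hr; linarith
      have h2 : lineInt heaviside j φ x = lineInt (fun _ => 1) j φ x := by
        rw [lineInt_heaviside, lineInt]
        simp only [one_mul]
        exact setIntegral_eq_integral_of_forall_compl_eq_zero fun r hr => hφ' r fun hr' => by
          have := hr'.2; simp only [mem_Ioi, not_lt] at hr; linarith
      simp [_root_.antideriv, h1, h2]
  · have : ∀ r : ℝ, φ (x - r • coordVec i) = 0 := fun r => hφ _ fun hb => hj (by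
      have := hb j
      simpa [coordVec_apply, hij] using this)
    simp [_root_.antideriv, lineInt, this]

/-- The full line integral is constant along its own line, so the derivative falls only on `cumul χ`
and on the Heaviside term. -/
theorem pd_antideriv_self {Ω : Set Plane} {B : Set ℝ} {χ : ℝ → ℝ} (h : IsTest Ω φ)
    (hχ : IsUnitBump B χ) (i : Fin 2) (x : Plane) :
    pd i (antideriv χ i φ) x = φ x - χ (x i) * lineInt (fun _ => 1) i φ x := by
  have d1 := (contDiff_lineInt locallyIntegrable_heaviside h i).differentiable (by simp) x
  have d2 := (contDiff_lineInt (locallyIntegrable_const 1) h i).differentiable (by simp) x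
  have d3 := (contDiff_comp_coord hχ.contDiff_cumul i).differentiable (by simp) x
  unfold antideriv
  rw [pd_sub d1 (d3.fun_mul d2), pd_mul d3 d2, pd_lineInt locallyIntegrable_heaviside h,
    pd_lineInt (locallyIntegrable_const 1) h, lineInt_heaviside_pd h, lineInt_one_pd h,
    pd_comp_coord i i (hχ.hasDerivAt_cumul _)]
  simp

theorem pd_antideriv_of_ne {Ω : Set Plane} {B : Set ℝ} {χ : ℝ → ℝ} (h : IsTest Ω φ)
    (hχ : IsUnitBump B χ) {i j : Fin 2} (hij : i ≠ j) (x : Plane) :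
    pd j (antideriv χ i φ) x = antideriv χ i (pd j φ) x := by
  have d1 := (contDiff_lineInt locallyIntegrable_heaviside h i).differentiable (by simp) x
  have d2 := (contDiff_lineInt (locallyIntegrable_const 1) h i).differentiable (by simp) x
  have d3 := (contDiff_comp_coord hχ.contDiff_cumul i).differentiable (by simp) x
  unfold antideriv
  rw [pd_sub d1 (d3.fun_mul d2), pd_mul d3 d2, pd_lineInt locallyIntegrable_heaviside h,
    pd_lineInt (locallyIntegrable_const 1) h,
    pd_comp_coord i j (hχ.hasDerivAt_cumul _)]
  simp [hij]

theorem antideriv_pd_self {Ω : Set Plane} (χ : ℝ → ℝ) (h : IsTest Ω φ) (i : Fin 2) (x : Plane) :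
    antideriv χ i (pd i φ) x = φ x := by
  rw [antideriv, lineInt_heaviside_pd h, lineInt_one_pd h]; simp

end

/-! ### Fubini's theorem in the coordinate plane -/

/-- The coordinate plane as a product of two lines. -/
noncomputable def prodPlane : ℝ × ℝ ≃ᵐ Plane :=
  MeasurableEquiv.finTwoArrow.symm.trans (MeasurableEquiv.toLp 2 (Fin 2 → ℝ))

theorem measurePreserving_prodPlane : MeasurePreserving prodPlane :=
  (EuclideanSpace.volume_preserving_symm_measurableEquiv_toLp (Fin 2)).symm.comp
    (volume_preserving_finTwoArrow ℝ).symm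

@[simp] theorem prodPlane_zero (p : ℝ × ℝ) : prodPlane p 0 = p.1 := rfl
@[simp] theorem prodPlane_one (p : ℝ × ℝ) : prodPlane p 1 = p.2 := rfl

theorem prodPlane_eta (x : Plane) : prodPlane (x 0, x 1) = x := by
  ext i; fin_cases i <;> rfl

theorem integral_prodPlane (f : Plane → ℝ) : ∫ p, f (prodPlane p) = ∫ x, f x :=
  measurePreserving_prodPlane.integral_comp' f

theorem integrable_prodPlane {f : Plane → ℝ} :
    Integrable (fun p => f (prodPlane p)) ↔ Integrable f :=
  measurePreserving_prodPlane.integrable_comp_emb prodPlane.measurableEmbedding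

theorem prodPlane_sub (p : ℝ × ℝ) (r : ℝ) : prodPlane p - r • coordVec 0 = prodPlane (p.1 - r, p.2) := by
  ext i; fin_cases i <;> simp [coordVec_apply]

theorem prodPlane_sub' (p : ℝ × ℝ) (r : ℝ) : prodPlane p - r • coordVec 1 = prodPlane (p.1, p.2 - r) := by
  ext i; fin_cases i <;> simp [coordVec_apply]

theorem lineInt_one_zero (φ : Plane → ℝ) (x : Plane) :
    lineInt (fun _ => 1) 0 φ x = ∫ r, φ (prodPlane (r, x 1)) := by
  rw [lineInt, ← integral_sub_left_eq_self (fun r => φ (prodPlane (r, x 1))) volume (x 0)]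
  congr 1; ext r
  rw [← prodPlane_eta x, prodPlane_sub]; simp

theorem lineInt_one_one (φ : Plane → ℝ) (x : Plane) :
    lineInt (fun _ => 1) 1 φ x = ∫ r, φ (prodPlane (x 0, r)) := by
  rw [lineInt, ← integral_sub_left_eq_self (fun r => φ (prodPlane (x 0, r))) volume (x 1)]
  congr 1; ext r
  rw [← prodPlane_eta x, prodPlane_sub']; simp

theorem lineInt_heaviside_zero (φ : Plane → ℝ) (x : Plane) :
    lineInt heaviside 0 φ x = ∫ r, heaviside (x 0 - r) * φ (prodPlane (r, x 1)) := by
  rw [lineInt, ← integral_sub_left_eq_self (fun r => heaviside (x 0 - r) * φ (prodPlane (r, x 1)))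
    volume (x 0)]
  congr 1; ext r
  rw [← prodPlane_eta x, prodPlane_sub]; simp

/-! ### Functions with vanishing weak derivatives -/

/-- Testing `∂ᵢf = 0` against `antideriv` replaces `φ` by `ψ i (xᵢ)` times its integral in direction
`i`, without changing the pairing with `f`. Doing this in both directions replaces `φ` by `(∫ φ) ψ 0
ψ 1`, so `f` pairs with `φ` as a constant does. -/
theorem exists_ae_eq_const_of_hasWeakPD_zero {A : Fin 2 → Set ℝ} (hAo : ∀ i, IsOpen (A i))
    (hA : ∀ i, (A i).OrdConnected) (hne : ∀ i, (A i).Nonempty) {f : Plane → ℝ}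
    (hf : LocallyIntegrableOn f (box A)) (h : ∀ i, HasWeakPD i f (fun _ => 0) (box A)) :
    ∃ c, ∀ᵐ x ∂(volume.restrict (box A)), f x = c := by
  choose ψ hψ using fun i => exists_isUnitBump (hAo i) (hne i)
  have step : ∀ i φ, IsTest (box A) φ →
      ∫ x, f x * φ x = ∫ x, f x * (ψ i (x i) * lineInt (fun _ => 1) i φ x) := by
    intro i φ hφ
    have t := hφ.antideriv hA hne hψ i
    have t' := hφ.lineInt_one_mul hA hne hψ i
    have h1 := hasWeakPD_iff.mp (h i) _ t
    simp only [pd_antideriv_self hφ (hψ i), zero_mul, integral_zero, neg_zero, mul_sub] at h1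
    rw [integral_sub (hφ.integrable_mul hf) (t'.integrable_mul hf)] at h1
    linarith
  have total : ∀ φ, IsTest (box A) φ → ∀ x,
      lineInt (fun _ => 1) 1 (fun x => ψ 0 (x 0) * lineInt (fun _ => 1) 0 φ x) x
        = ψ 0 (x 0) * ∫ y, φ y := by
    intro φ hφ x
    rw [lineInt_one_one]
    simp only [lineInt_one_zero, prodPlane_zero, prodPlane_one]
    rw [integral_const_mul, ← integral_prodPlane φ]
    congr 1
    exact (integral_prod_symm _ (integrable_prodPlane.mpr hφ.integrable)).symm
  -- The constant is the mean of `f` against the product bump, whose integral is `1`.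
  set c := ∫ x, f x * (ψ 1 (x 1) * ψ 0 (x 0))
  refine ⟨c, ?_⟩
  have hbox : IsOpen (box A) := isOpen_box hAo
  have hc : LocallyIntegrableOn (fun _ : Plane => c) (box A) :=
    (locallyIntegrable_const c).locallyIntegrableOn _
  have := hbox.ae_eq_zero_of_integral_contDiff_smul_eq_zero (hf.sub hc) (fun φ h1 h2 h3 => by
    have hφ : IsTest (box A) φ := ⟨h1, h2, h3⟩
    have e1 : ∀ x, φ x • (f x - c) = f x * φ x - c * φ x := fun x => by
      rw [smul_eq_mul]; ring
    simp only [Pi.sub_apply, e1]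
    rw [integral_sub (hφ.integrable_mul hf) (hφ.integrable_mul hc), step 0 φ hφ,
      step 1 _ (hφ.lineInt_one_mul hA hne hψ 0)]
    simp only [total φ hφ]
    rw [integral_const_mul]
    have e2 : ∀ x, f x * (ψ 1 (x 1) * (ψ 0 (x 0) * ∫ y, φ y))
      = f x * (ψ 1 (x 1) * ψ 0 (x 0)) * ∫ y, φ y := fun x => by ring
    simp only [e2]
    rw [integral_mul_const, sub_self])
  rw [ae_restrict_iff' hbox.measurableSet]
  filter_upwards [this] with x hx hxA
  have := hx hxA
  simp at this
  linarith

/-! ### The Poincaré lemma for integrable one-forms -/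

theorem locallyIntegrable_of_forall_ball {f : Plane → ℝ}
    (h : ∀ N : ℝ, IntegrableOn f {x | |x 0| ≤ N ∧ |x 1| ≤ N}) : LocallyIntegrable f := by
  intro x
  refine ⟨{y | |y 0| ≤ ‖x‖ + 1 ∧ |y 1| ≤ ‖x‖ + 1}, ?_, h _⟩
  filter_upwards [Metric.ball_mem_nhds x one_pos] with y hy
  have h1 : ‖y‖ ≤ ‖x‖ + 1 := by
    rw [mem_ball_iff_norm] at hy
    linarith [norm_le_norm_add_norm_sub' y x]
  exact ⟨(PiLp.norm_apply_le y 0).trans h1, (PiLp.norm_apply_le y 1).trans h1⟩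

/-- The permutation `((r, y), s) ↦ (r, (s, y))`. -/
noncomputable def prodPerm : (ℝ × ℝ) × ℝ ≃ᵐ ℝ × (ℝ × ℝ) :=
  MeasurableEquiv.prodAssoc.trans ((MeasurableEquiv.refl ℝ).prodCongr MeasurableEquiv.prodComm)

theorem measurePreserving_prodPerm : MeasurePreserving prodPerm :=
  ((MeasurePreserving.id (volume : Measure ℝ)).prod
    (Measure.measurePreserving_swap (μ := (volume : Measure ℝ)) (ν := (volume : Measure ℝ)))).comp
    (measurePreserving_prodAssoc (volume : Measure ℝ) volume volume)

section kernels

variable {k : ℝ × ℝ → ℝ} {C : ℝ} {a : Plane → ℝ}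

/-- Up to the bounded factor `k χ` the integrand is a product of integrable functions: the indicator
of `[-N, N]` in the first variable and `a` in the other two. This licenses every use of Fubini for
the kernel `k`. -/
theorem integrable_kernel_prod (hk : Measurable k) (hC : ∀ p, ‖k p‖ ≤ C) (ha : Integrable a)
    {χ : ℝ × ℝ → ℝ} (hχ : Measurable χ) {D N : ℝ} (hD : ∀ p, ‖χ p‖ ≤ D)
    (hN : ∀ p : ℝ × ℝ, p.1 ∉ Icc (-N) N → χ p = 0) :
    Integrable (fun q : ℝ × (ℝ × ℝ) =>
      k (q.1, q.2.1) * a (prodPlane q.2) * χ (q.1, q.2.2)) := by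
  have h1 : Integrable ((Icc (-N) N).indicator (fun _ => (1 : ℝ))) := by
    rw [integrable_indicator_iff measurableSet_Icc]
    exact integrableOn_const (by simp)
  have h2 := h1.mul_prod (integrable_prodPlane.mpr ha)
  have h3 : Measurable (fun q : ℝ × (ℝ × ℝ) => k (q.1, q.2.1) * χ (q.1, q.2.2)) := by fun_prop
  have h4 := h2.bdd_mul (c := C * D) h3.aestronglyMeasurable (Filter.Eventually.of_forall fun q => by
    rw [norm_mul]
    exact mul_le_mul (hC _) (hD _) (norm_nonneg _) ((norm_nonneg _).trans (hC (0, 0))))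
  refine h4.congr (Filter.Eventually.of_forall fun q => ?_)
  by_cases hq : q.1 ∈ Icc (-N) N
  · simp only [indicator_of_mem hq]; ring
  · simp [hN (q.1, q.2.2) hq]

theorem locallyIntegrable_kernel (hk : Measurable k) (hC : ∀ p, ‖k p‖ ≤ C) (ha : Integrable a) :
    LocallyIntegrable (fun x : Plane => ∫ s, k (x 0, s) * a (prodPlane (s, x 1))) := by
  refine locallyIntegrable_of_forall_ball fun N => ?_
  have h1 := integrable_kernel_prod hk hC ha
    (χ := fun p => (Icc (-N) N).indicator (fun _ => (1 : ℝ)) p.1) (D := 1) (N := N)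
    ((measurable_const.indicator measurableSet_Icc).comp measurable_fst)
    (fun p => by by_cases hp : p.1 ∈ Icc (-N) N <;> simp [indicator, hp])
    (fun p hp => by simp only [indicator_of_notMem hp])
  have h2 := (measurePreserving_prodPerm.integrable_comp_emb
    prodPerm.measurableEmbedding).mpr h1
  have h3 := h2.integral_prod_left
  simp only [Function.comp_def] at h3
  have h4 : Integrable (fun x : Plane => ∫ s, k (x 0, s) * a (prodPlane (s, x 1)) *
      (Icc (-N) N).indicator (fun _ => (1 : ℝ)) (x 0)) := integrable_prodPlane.mp h3
  refine (h4.integrableOn (s := {x | |x 0| ≤ N ∧ |x 1| ≤ N})).congr_fun (fun x hx => ?_) ?_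
  · have : x 0 ∈ Icc (-N) N := abs_le.mp hx.1
    simp only [indicator_of_mem this, mul_one]
  · have h0 : ∀ i, Measurable fun x : Plane => x i := fun i => (contDiff_coord i (n := 0)).continuous.measurable
    exact (measurableSet_le (h0 0).abs measurable_const).inter
      (measurableSet_le (h0 1).abs measurable_const)

/-- Fubini in three variables transposes the kernel operator from `a` to the test function. -/
theorem integral_kernel_mul (hk : Measurable k) (hC : ∀ p, ‖k p‖ ≤ C) (ha : Integrable a)
    {φ : Plane → ℝ} (hφ : Continuous φ) (hc : HasCompactSupport φ) :
    ∫ x, (∫ s, k (x 0, s) * a (prodPlane (s, x 1))) * φ x =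
      ∫ z, a z * ∫ r, k (r, z 0) * φ (prodPlane (r, z 1)) := by
  obtain ⟨D, hD⟩ := hc.exists_bound_of_continuous hφ
  obtain ⟨N, hN⟩ := hc.isCompact.isBounded.subset_closedBall (0 : Plane)
  have h1 := integrable_kernel_prod hk hC ha (χ := fun p => φ (prodPlane p)) (D := D) (N := N)
    (hφ.measurable.comp prodPlane.measurable) (fun p => hD _)
    (fun p hp => image_eq_zero_of_notMem_tsupport fun ht => hp (abs_le.mp (by
      have h1 := hN ht
      rw [mem_closedBall_zero_iff] at h1
      exact (PiLp.norm_apply_le (prodPlane p) 0).trans h1)))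
  have h2 := (measurePreserving_prodPerm.integrable_comp_emb
    prodPerm.measurableEmbedding).mpr h1
  rw [← integral_prodPlane, ← integral_prodPlane]
  have e1 : ∀ p : ℝ × ℝ, (∫ s, k (prodPlane p 0, s) * a (prodPlane (s, prodPlane p 1))) *
      φ (prodPlane p) = ∫ s, k (p.1, s) * a (prodPlane (s, p.2)) * φ (prodPlane p) := fun p => by
    rw [integral_mul_const]; rfl
  have e2 : ∀ p : ℝ × ℝ, a (prodPlane p) * ∫ r, k (r, prodPlane p 0) * φ (prodPlane (r, prodPlane p 1))
      = ∫ r, k (r, p.1) * a (prodPlane p) * φ (prodPlane (r, p.2)) := fun p => by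
    rw [← integral_const_mul]
    congr 1; ext r; simp only [prodPlane_zero, prodPlane_one]; ring
  simp only [e1, e2]
  have h3 := integral_prod _ h2
  have h4 := integral_prod_symm _ h1
  have h5 := measurePreserving_prodPerm.integral_comp' (fun q : ℝ × (ℝ × ℝ) =>
      k (q.1, q.2.1) * a (prodPlane q.2) * φ (prodPlane (q.1, q.2.2)))
  exact h3.symm.trans (h5.trans h4)

theorem measurable_heaviside : Measurable heaviside :=
  measurable_const.indicator measurableSet_Ioi

theorem norm_heaviside_le (r : ℝ) : ‖heaviside r‖ ≤ 1 := by
  by_cases h : r ∈ Ioi (0 : ℝ) <;> simp [heaviside, indicator, h]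

theorem measurable_plane_coord (i : Fin 2) : Measurable fun x : Plane => x i :=
  (contDiff_coord i (n := 0)).continuous.measurable

theorem integrable_heaviside_prod {b φ : Plane → ℝ} (hb : Integrable b) (hφ : Integrable φ) :
    Integrable (fun q : Plane × Plane => heaviside (q.2 1 - q.1 1) * (φ q.1 * b q.2)) := by
  refine (hφ.mul_prod hb).bdd_mul (c := 1) ?_ (Filter.Eventually.of_forall fun q => norm_heaviside_le _)
  exact (measurable_heaviside.comp (((measurable_plane_coord 1).comp measurable_snd).sub
    ((measurable_plane_coord 1).comp measurable_fst))).aestronglyMeasurable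

theorem locallyIntegrable_heaviside_kernel {b : Plane → ℝ} (hb : Integrable b) :
    LocallyIntegrable (fun x : Plane => ∫ z, heaviside (z 1 - x 1) * b z) := by
  intro x
  refine ⟨Metric.ball x 1, Metric.ball_mem_nhds x one_pos, ?_⟩
  have h1 : Integrable ((Metric.ball x 1).indicator (fun _ => (1 : ℝ))) := by
    rw [integrable_indicator_iff measurableSet_ball]
    exact integrableOn_const (by finiteness)
  have h2 := (integrable_heaviside_prod hb h1).integral_prod_left
  refine (h2.integrableOn (s := Metric.ball x 1)).congr_fun (fun y hy => ?_) measurableSet_ball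
  simp only [indicator_of_mem hy, one_mul]

theorem integral_heaviside_kernel_mul {b φ : Plane → ℝ} (hb : Integrable b) (hφ : Integrable φ) :
    ∫ x, (∫ z, heaviside (z 1 - x 1) * b z) * φ x =
      ∫ z, b z * ∫ x, heaviside (z 1 - x 1) * φ x := by
  have h := integral_integral_swap
    (f := fun x z : Plane => heaviside (z 1 - x 1) * (φ x * b z)) (integrable_heaviside_prod hb hφ)
  have e1 : ∀ x, (∫ z, heaviside (z 1 - x 1) * b z) * φ x =
      ∫ z, heaviside (z 1 - x 1) * (φ x * b z) := fun x => by
    rw [← integral_mul_const]; congr 1; ext z; ring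
  have e2 : ∀ z, b z * (∫ x, heaviside (z 1 - x 1) * φ x) =
      ∫ x, heaviside (z 1 - x 1) * (φ x * b z) := fun z => by
    rw [← integral_const_mul]; congr 1; ext x; ring
  simp only [e1, e2]
  exact h

end kernels

theorem integrable_heaviside_mul {φ : Plane → ℝ} (hφ : Integrable φ) (t : ℝ) :
    Integrable (fun x : Plane => heaviside (t - x 1) * φ x) :=
  hφ.bdd_mul (c := 1) (measurable_heaviside.comp
    (measurable_const.sub (measurable_plane_coord 1))).aestronglyMeasurable
    (Filter.Eventually.of_forall fun _ => norm_heaviside_le _)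

/-- The weight is constant on horizontal lines, and on each of them `∂₀φ` integrates to zero. -/
theorem integral_heaviside_pd_zero {Ω : Set Plane} {φ : Plane → ℝ} (h : IsTest Ω φ) (z : Plane) :
    ∫ x, heaviside (z 1 - x 1) * pd 0 φ x = 0 := by
  have h1 := integrable_prodPlane.mpr (integrable_heaviside_mul (h.pd 0).integrable (z 1))
  rw [← integral_prodPlane]
  refine (integral_prod_symm _ h1).trans ?_
  simp only [prodPlane_one]
  have : ∀ y, ∫ r, heaviside (z 1 - y) * pd 0 φ (prodPlane (r, y)) = 0 := fun y => by
    have := lineInt_one_pd h 0 (prodPlane (0, y))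
    rw [lineInt_one_zero] at this
    rw [integral_const_mul]
    simp only [prodPlane_one] at this
    rw [this, mul_zero]
  simp [this]

theorem lineInt_heaviside_one (φ : Plane → ℝ) (x : Plane) :
    lineInt heaviside 1 φ x = ∫ r, heaviside (x 1 - r) * φ (prodPlane (x 0, r)) := by
  rw [lineInt, ← integral_sub_left_eq_self (fun r => heaviside (x 1 - r) * φ (prodPlane (x 0, r)))
    volume (x 1)]
  congr 1; ext r
  rw [← prodPlane_eta x, prodPlane_sub']; simp

theorem integral_heaviside_pd_one {Ω : Set Plane} {φ : Plane → ℝ} (h : IsTest Ω φ) (z : Plane) :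
    ∫ x, heaviside (z 1 - x 1) * pd 1 φ x = lineInt (fun _ => 1) 0 φ z := by
  have h1 := integrable_prodPlane.mpr (integrable_heaviside_mul (h.pd 1).integrable (z 1))
  rw [← integral_prodPlane, lineInt_one_zero]
  refine (integral_prod _ h1).trans ?_
  simp only [prodPlane_one]
  congr 1; ext r
  have := lineInt_heaviside_pd h 1 (prodPlane (r, z 1))
  rw [lineInt_heaviside_one] at this
  exact this

/-- An integrable one-form `a dx⁰ + b dx¹` that is closed on a box in the sense of distributions has
a primitive there. -/
theorem exists_hasWeakPD_of_closed {A : Fin 2 → Set ℝ} (hAo : ∀ i, IsOpen (A i))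
    (hA : ∀ i, (A i).OrdConnected) (hne : ∀ i, (A i).Nonempty) {a b : Plane → ℝ}
    (ha : Integrable a) (hb : Integrable b)
    (h : ∀ φ, IsTest (box A) φ → ∫ x, a x * pd 1 φ x = ∫ x, b x * pd 0 φ x) :
    ∃ f, LocallyIntegrable f ∧ HasWeakPD 0 f a (box A) ∧ HasWeakPD 1 f b (box A) := by
  choose ψ hψ using fun i => exists_isUnitBump (hAo i) (hne i)
  obtain ⟨D, hD⟩ := (hψ 0).hasCompactSupport.exists_bound_of_continuous (hψ 0).contDiff.continuous
  have hψb : Integrable (fun z : Plane => ψ 0 (z 0) * b z) :=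
    hb.bdd_mul (c := D) (contDiff_comp_coord (hψ 0).contDiff 0).continuous.aestronglyMeasurable
      (Filter.Eventually.of_forall fun _ => hD _)
  -- For almost every `s`, `k (r, s)` is the average, over `t` with density `ψ 0`, of the signed
  -- indicator of the segment from `t` to `r`. Hence `F` below averages the horizontal integrals of
  -- `a` from `(t, x 1)` to `x`.
  set k : ℝ × ℝ → ℝ := fun p => cumul (ψ 0) p.2 - heaviside (p.2 - p.1)
  have hk : Measurable k := ((hψ 0).contDiff_cumul.continuous.measurable.comp measurable_snd).sub
    (measurable_heaviside.comp (measurable_snd.sub measurable_fst))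
  have hC : ∀ p, ‖k p‖ ≤ (∫ r, ‖ψ 0 r‖) + 1 := fun p => by
    refine (norm_sub_le _ _).trans (add_le_add ?_ (norm_heaviside_le _))
    exact (norm_integral_le_integral_norm _).trans (setIntegral_le_integral (hψ 0).integrable.norm
      (Filter.Eventually.of_forall fun _ => norm_nonneg _))
  set F : Plane → ℝ := fun x => ∫ s, k (x 0, s) * a (prodPlane (s, x 1))
  -- With the same average over `t`, `-g` integrates `b` along the vertical line at `t`, from `+∞`
  -- down to height `x 1`. So `F - g` averages the path integrals of the one-form that come down at
  -- `t` and then run horizontally to `x`.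
  set g : Plane → ℝ := fun x => ∫ z, heaviside (z 1 - x 1) * (ψ 0 (z 0) * b z)
  have hF : LocallyIntegrable F := locallyIntegrable_kernel hk hC ha
  have hg : LocallyIntegrable g := locallyIntegrable_heaviside_kernel hψb
  -- The transposed formula: `F` acts on `φ` as minus the pairing of `a` with `antideriv`, so no
  -- regularity of `a` or `b` is needed.
  have key : ∀ φ, IsTest (box A) φ → ∫ x, (F x - g x) * φ x = -(∫ x, a x * antideriv (ψ 0) 0 φ x)
      - ∫ z, ψ 0 (z 0) * b z * ∫ x, heaviside (z 1 - x 1) * φ x := by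
    intro φ hφ
    simp only [sub_mul]
    rw [integral_sub (hφ.integrable_mul (hF.locallyIntegrableOn _))
      (hφ.integrable_mul (hg.locallyIntegrableOn _)),
      integral_kernel_mul hk hC ha hφ.continuous hφ.2.1,
      integral_heaviside_kernel_mul hψb hφ.integrable, ← integral_neg]
    congr 2; ext z
    rw [← mul_neg]
    congr 1
    rw [antideriv, lineInt_heaviside_zero, lineInt_one_zero, neg_sub,
      ← integral_const_mul, ← integral_sub]
    · congr 1; ext r; simp only [k]; ring
    all_goals
      have hl : Integrable (fun r => φ (prodPlane (r, z 1))) := by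
        have := (contDiff_line hφ 0 z).continuous.integrable_of_hasCompactSupport (μ := volume)
          (hasCompactSupport_line hφ 0 z)
        have h2 := this.comp_sub_left (z 0)
        refine h2.congr (Filter.Eventually.of_forall fun r => ?_)
        change φ (z - (z 0 - r) • coordVec 0) = _
        conv_lhs => rw [← prodPlane_eta z, prodPlane_sub]
        simp
    · exact hl.const_mul _
    · exact hl.bdd_mul (c := 1) (measurable_heaviside.comp
        (measurable_const.sub measurable_id)).aestronglyMeasurable
        (Filter.Eventually.of_forall fun _ => norm_heaviside_le _)
  refine ⟨fun x => F x - g x, hF.sub hg, ?_, ?_⟩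
  · rw [hasWeakPD_iff]
    intro φ hφ
    rw [key _ (hφ.pd 0)]
    simp only [antideriv_pd_self _ hφ, integral_heaviside_pd_zero hφ, mul_zero, integral_zero,
      sub_zero]
  · rw [hasWeakPD_iff]
    intro φ hφ
    have t := hφ.antideriv hA hne hψ 0
    have t' := hφ.lineInt_one_mul hA hne hψ 0
    rw [key _ (hφ.pd 1)]
    simp only [← pd_antideriv_of_ne hφ (hψ 0) (show (0 : Fin 2) ≠ 1 by decide),
      integral_heaviside_pd_one hφ]
    -- Closedness turns `a` against `∂₁` of the primitive into `b` against its `∂₀`, which is `φ`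
    -- minus the bump term; the bump term cancels the contribution of `g`.
    rw [h _ t]
    simp only [pd_antideriv_self hφ (hψ 0), mul_sub]
    rw [integral_sub (hφ.integrable_mul (hb.locallyIntegrable.locallyIntegrableOn _))
      (t'.integrable_mul (hb.locallyIntegrable.locallyIntegrableOn _))]
    have e : ∀ z, ψ 0 (z 0) * b z * lineInt (fun _ => 1) 0 φ z =
      b z * (ψ 0 (z 0) * lineInt (fun _ => 1) 0 φ z) := fun z => by ring
    simp only [e]
    ring

/-! ### The hyperbolic metric in coordinates -/

theorem isOpen_halfPlane : IsOpen halfPlane :=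
  isOpen_lt continuous_const (contDiff_coord 1 (n := 0)).continuous

theorem hypMetric_apply (R : ℝ) (x : Plane) (i j : Fin 2) :
    hypMetric R x i j = if i = j then 1 / (-R * x 1 ^ 2) else 0 := by
  simp [hypMetric, Matrix.one_apply]

theorem det_hypMetric (R : ℝ) (x : Plane) : (hypMetric R x).det = (1 / (-R * x 1 ^ 2)) ^ 2 := by
  rw [hypMetric, Matrix.det_smul]; simp

theorem hypMetric_inv {R : ℝ} (hR : R < 0) {x : Plane} (hx : x ∈ halfPlane) (i j : Fin 2) :
    (hypMetric R x)⁻¹ i j = if i = j then -R * x 1 ^ 2 else 0 := by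
  have h0 : -R * x 1 ^ 2 ≠ 0 := mul_ne_zero (by linarith) (pow_ne_zero _ (ne_of_gt hx))
  have : (hypMetric R x)⁻¹ = (-R * x 1 ^ 2) • (1 : Matrix (Fin 2) (Fin 2) ℝ) := by
    apply Matrix.inv_eq_left_inv
    simp only [hypMetric, Matrix.smul_mul, Matrix.mul_smul, Matrix.one_mul, smul_smul]
    rw [one_div_mul_cancel h0, one_smul]
  rw [this]
  simp [Matrix.one_apply]

theorem volDensity_hypMetric {R : ℝ} (hR : R < 0) {x : Plane} (hx : x ∈ halfPlane) :
    volDensity (hypMetric R) x = 1 / (-R * x 1 ^ 2) := by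
  rw [volDensity, det_hypMetric, Real.sqrt_sq]
  have : (0 : ℝ) < x 1 := hx
  have : 0 < -R := by linarith
  positivity

theorem pd_hypMetric {R : ℝ} (hR : R < 0) {x : Plane} (hx : x ∈ halfPlane) (k i j : Fin 2) :
    pd k (fun y => hypMetric R y i j) x =
      if i = j ∧ k = 1 then -2 / (-R * x 1 ^ 3) else 0 := by
  have hx0 : x 1 ≠ 0 := ne_of_gt hx
  have hR0 : -R ≠ 0 := by linarith
  simp only [hypMetric_apply]
  by_cases hij : i = j
  · simp only [hij, if_true, true_and]
    have hd : DifferentiableAt ℝ (fun y : Plane => y 1 ^ 2) x := (differentiableAt_coord 1 x).fun_pow 2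
    rw [pd_div (differentiableAt_const _) (hd.const_mul _) (mul_ne_zero hR0 (pow_ne_zero _ hx0)),
      pd_const, pd_const_mul hd, pd_pow (differentiableAt_coord 1 x), pd_coord]
    fin_cases k
    · simp
    · simp
      field_simp
  · simp only [hij, if_false, false_and, pd_const]

/-- `y` times the Christoffel symbols of the hyperbolic metric. -/
def hypChr : Fin 2 → Fin 2 → Fin 2 → ℝ := ![![![0, -1], ![-1, 0]], ![![1, 0], ![0, -1]]]

section

variable {R : ℝ} {G : MatField} {Ω : Set Plane}

theorem christoffel_eq (hR : R < 0) (hΩ : IsOpen Ω) (hΩh : Ω ⊆ halfPlane)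
    (hG : ∀ x ∈ Ω, G x = hypMetric R x) {x : Plane} (hx : x ∈ Ω) (k i j : Fin 2) :
    christoffel G k i j x = hypChr k i j / x 1 := by
  have hpd : ∀ k i j, pd k (fun y => G y i j) x = pd k (fun y => hypMetric R y i j) x :=
    fun k i j => pd_eq_of_eqOn hΩ (fun y hy => by simp only [hG y hy]) hx k
  have hx0 : x 1 ≠ 0 := ne_of_gt (hΩh hx)
  have hR0 : R ≠ 0 := by linarith
  simp only [christoffel, hpd, hG x hx, hypMetric_inv hR (hΩh hx), pd_hypMetric hR (hΩh hx),
    Fin.sum_univ_two]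
  fin_cases k <;> fin_cases i <;> fin_cases j <;> simp [hypChr] <;> field_simp

theorem pd_christoffel_eq (hR : R < 0) (hΩ : IsOpen Ω) (hΩh : Ω ⊆ halfPlane)
    (hG : ∀ x ∈ Ω, G x = hypMetric R x) {x : Plane} (hx : x ∈ Ω) (l k i j : Fin 2) :
    pd l (christoffel G k i j) x = if l = 1 then -hypChr k i j / x 1 ^ 2 else 0 := by
  rw [pd_eq_of_eqOn hΩ (g := fun x => hypChr k i j / x 1)
    (fun y hy => christoffel_eq hR hΩ hΩh hG hy k i j) hx,
    pd_div (differentiableAt_const _) (differentiableAt_coord 1 x) (ne_of_gt (hΩh hx)),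
    pd_const, pd_coord]
  fin_cases l <;> simp

theorem gaussCurvature_eq (hR : R < 0) (hΩ : IsOpen Ω) (hΩh : Ω ⊆ halfPlane)
    (hG : ∀ x ∈ Ω, G x = hypMetric R x) {x : Plane} (hx : x ∈ Ω) : gaussCurvature G x = R := by
  have hx0 : x 1 ≠ 0 := ne_of_gt (hΩh hx)
  have hR0 : R ≠ 0 := by linarith
  simp only [gaussCurvature, riemann, pd_christoffel_eq hR hΩ hΩh hG hx,
    christoffel_eq hR hΩ hΩh hG hx, hG x hx, det_hypMetric, hypMetric_apply, Fin.sum_univ_two]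
  simp [hypChr]
  field_simp

/-- The metric is conformal to the Euclidean one, and in dimension two the star on one-forms is
conformally invariant: it is a quarter turn. -/
theorem starTensor_eq (hR : R < 0) (hΩh : Ω ⊆ halfPlane) (hG : ∀ x ∈ Ω, G x = hypMetric R x)
    {x : Plane} (hx : x ∈ Ω) (S : MatField) :
    starTensor G S x = !![S x 1 1, -S x 1 0; -S x 0 1, S x 0 0] := by
  have h0 : -R * x 1 ^ 2 ≠ 0 := mul_ne_zero (by linarith) (pow_ne_zero _ (ne_of_gt (hΩh hx)))
  have h1 : areaMatrix (hypMetric R x) * (hypMetric R x)⁻¹ = !![0, 1; -1, 0] := by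
    have hx0 : x 1 ≠ 0 := ne_of_gt (hΩh hx)
    have hR0 : R ≠ 0 := by linarith
    have hv := volDensity_hypMetric hR (hΩh hx)
    unfold volDensity at hv
    rw [areaMatrix, hv]
    ext i j
    fin_cases i <;> fin_cases j <;>
      simp [Matrix.mul_apply, hypMetric_inv hR (hΩh hx)] <;> field_simp
  rw [starTensor, hG x hx, h1]
  ext i j
  fin_cases i <;> fin_cases j <;> simp [Matrix.mul_apply, Matrix.vecMul, dotProduct]

theorem hess_eq (hR : R < 0) (hΩ : IsOpen Ω) (hΩh : Ω ⊆ halfPlane)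
    (hG : ∀ x ∈ Ω, G x = hypMetric R x) {x : Plane} (hx : x ∈ Ω) (E : Plane → ℝ) (i j : Fin 2) :
    hess G E i j x + R * G x i j * E x =
      pd i (pd j E) x - ∑ k, hypChr k i j / x 1 * pd k E x - if i = j then E x / x 1 ^ 2 else 0 := by
  have hR0 : R ≠ 0 := by linarith
  simp only [hess, christoffel_eq hR hΩ hΩh hG hx, hG x hx, hypMetric_apply]
  have hx0 : x 1 ≠ 0 := ne_of_gt (hΩh hx)
  by_cases hij : i = j
  · simp only [hij, if_true]
    field_simp
    ring
  · simp [hij]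

theorem codiff_eq (hR : R < 0) (hΩ : IsOpen Ω) (hΩh : Ω ⊆ halfPlane)
    (hG : ∀ x ∈ Ω, G x = hypMetric R x) {x : Plane} (hx : x ∈ Ω) {S : MatField}
    (hS : ∀ x i j, S x i j = S x j i) :
    codiff G S 0 x = R * x 1 ^ 2 * (pd 0 (fun y => S y 0 0) x + pd 1 (fun y => S y 0 1) x) ∧
    codiff G S 1 x = R * x 1 ^ 2 * (pd 0 (fun y => S y 0 1) x + pd 1 (fun y => S y 1 1) x
      + (S x 0 0 + S x 1 1) / x 1) := by
  have hx0 : x 1 ≠ 0 := ne_of_gt (hΩh hx)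
  simp only [codiff, covDerivTensor, christoffel_eq hR hΩ hΩh hG hx, hG x hx,
    hypMetric_inv hR (hΩh hx), Fin.sum_univ_two, hS _ 1 0]
  constructor
  · simp [hypChr]
    field_simp
    ring
  · simp [hypChr]
    field_simp
    ring

/-- The volume density cancels one of the two inverse metrics, which leaves a single factor `-R y²`.
-/
theorem weakCodiff_integrand_eq (hR : R < 0) (hΩ : IsOpen Ω) (hΩh : Ω ⊆ halfPlane)
    (hG : ∀ x ∈ Ω, G x = hypMetric R x) {x : Plane} (hx : x ∈ Ω) {S : MatField}
    (hS : ∀ x i j, S x i j = S x j i) (η : Fin 2 → Plane → ℝ) :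
    (∑ i, ∑ j, ∑ k, ∑ l,
      (G x)⁻¹ i k * (G x)⁻¹ j l * S x k l * covDerivForm G η i j x) * volDensity G x =
    -R * x 1 ^ 2 * (S x 0 0 * pd 0 (η 0) x + S x 0 1 * pd 0 (η 1) x + S x 0 1 * pd 1 (η 0) x
      + S x 1 1 * pd 1 (η 1) x + 2 * S x 0 1 * η 0 x / x 1 - (S x 0 0 - S x 1 1) * η 1 x / x 1) := by
  have hx0 : x 1 ≠ 0 := ne_of_gt (hΩh hx)
  have hR0 : R ≠ 0 := by linarith
  have hv : volDensity G x = 1 / (-R * x 1 ^ 2) := by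
    rw [volDensity, hG x hx, ← volDensity_hypMetric hR (hΩh hx), volDensity]
  simp only [hv, covDerivForm, christoffel_eq hR hΩ hΩh hG hx, hG x hx,
    hypMetric_inv hR (hΩh hx), Fin.sum_univ_two, hS _ 1 0]
  simp [hypChr]
  field_simp
  ring

end

/-! ### The equation for smooth tensors -/

theorem two_le_infty : (2 : WithTop ℕ∞) ≤ ∞ := by
  simpa using (WithTop.coe_le_coe.2 (le_top : (2 : ℕ∞) ≤ ⊤))

theorem differentiableAt_fun_div {f g : Plane → ℝ} {x : Plane} (hf : DifferentiableAt ℝ f x)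
    (hg : DifferentiableAt ℝ g x) (h0 : g x ≠ 0) : DifferentiableAt ℝ (fun y => f y / g y) x := by
  simpa only [div_eq_mul_inv] using hf.fun_mul (hg.fun_inv h0)

/-- A smooth closed one-form on an open convex set has a smooth primitive. -/
theorem exists_pd_eq_of_closed {B : Set Plane} (hB : Convex ℝ B) (hBo : IsOpen B) {a b : Plane → ℝ}
    (ha : ContDiffOn ℝ ∞ a B) (hb : ContDiffOn ℝ ∞ b B) (h : ∀ x ∈ B, pd 1 a x = pd 0 b x) :
    ∃ f, ContDiffOn ℝ ∞ f B ∧ ∀ x ∈ B, pd 0 f x = a x ∧ pd 1 f x = b x := by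
  set e : Fin 2 → (Plane →L[ℝ] ℝ) := fun i => EuclideanSpace.proj i
  set θ : Plane → (Plane →L[ℝ] ℝ) := fun x => a x • e 0 + b x • e 1
  have hθ : ContDiffOn ℝ ∞ θ B := (ha.smul contDiffOn_const).add (hb.smul contDiffOn_const)
  have hda : ∀ x ∈ B, DifferentiableAt ℝ a x := fun x hx =>
    (ha.contDiffAt (hBo.mem_nhds hx)).differentiableAt (by simp)
  have hdb : ∀ x ∈ B, DifferentiableAt ℝ b x := fun x hx =>
    (hb.contDiffAt (hBo.mem_nhds hx)).differentiableAt (by simp)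
  have hfd : ∀ x ∈ B, ∀ v w, fderiv ℝ θ x v w = fderiv ℝ a x v * w 0 + fderiv ℝ b x v * w 1 := by
    intro x hx v w
    have : HasFDerivAt θ ((fderiv ℝ a x).smulRight (e 0) + (fderiv ℝ b x).smulRight (e 1)) x :=
      ((hda x hx).hasFDerivAt.smul_const (e 0)).add ((hdb x hx).hasFDerivAt.smul_const (e 1))
    rw [this.fderiv]
    simp [e]
  -- Closedness of the form is the symmetry of the derivative of `θ` as a bilinear form.
  obtain ⟨f, hf⟩ := hB.exists_forall_hasFDerivAt_of_fderiv_symmetric hBo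
    (hθ.differentiableOn (by simp)) (fun x hx v w => by
      rw [hfd x hx, hfd x hx, fderiv_apply_eq_pd, fderiv_apply_eq_pd, fderiv_apply_eq_pd,
        fderiv_apply_eq_pd, h x hx]
      ring)
  refine ⟨f, ?_, fun x hx => ?_⟩
  · rw [contDiffOn_infty_iff_fderiv_of_isOpen hBo]
    exact ⟨fun x hx => (hf x hx).differentiableAt.differentiableWithinAt,
      hθ.congr fun x hx => (hf x hx).fderiv⟩
  · simp [pd, (hf x hx).fderiv, θ, e, coordVec_apply]

/-- The components of `∇dE + R g E` for the hyperbolic metric of curvature `R`. -/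
noncomputable def hypHess (E : Plane → ℝ) (i j : Fin 2) (x : Plane) : ℝ :=
  pd i (pd j E) x - ∑ k, hypChr k i j / x 1 * pd k E x - if i = j then E x / x 1 ^ 2 else 0

theorem hypHess_zero_zero (E : Plane → ℝ) (x : Plane) :
    hypHess E 0 0 x = pd 0 (pd 0 E) x - pd 1 E x / x 1 - E x / x 1 ^ 2 := by
  simp [hypHess, hypChr]; ring

theorem hypHess_zero_one (E : Plane → ℝ) (x : Plane) :
    hypHess E 0 1 x = pd 0 (pd 1 E) x + pd 0 E x / x 1 := by
  simp [hypHess, hypChr]; ring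

theorem hypHess_one_zero (E : Plane → ℝ) (x : Plane) :
    hypHess E 1 0 x = pd 1 (pd 0 E) x + pd 0 E x / x 1 := by
  simp [hypHess, hypChr]; ring

theorem hypHess_one_one (E : Plane → ℝ) (x : Plane) :
    hypHess E 1 1 x = pd 1 (pd 1 E) x + pd 1 E x / x 1 - E x / x 1 ^ 2 := by
  simp [hypHess, hypChr]; ring

section

variable {V : Set Plane}

theorem ContDiffOn.differentiableAt_of_isOpen {f : Plane → ℝ} (hf : ContDiffOn ℝ ∞ f V)
    (hV : IsOpen V) {x : Plane} (hx : x ∈ V) : DifferentiableAt ℝ f x :=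
  (hf.contDiffAt (hV.mem_nhds hx)).differentiableAt (by simp)

/-- The Codazzi equations for `∇dE + R g E`. -/
theorem hypHess_codazzi (hV : IsOpen V) (hVh : V ⊆ halfPlane) {E : Plane → ℝ}
    (hE : ContDiffOn ℝ ∞ E V) {x : Plane} (hx : x ∈ V) :
    pd 0 (hypHess E 1 1) x = pd 1 (hypHess E 0 1) x ∧
    pd 1 (hypHess E 0 0) x + (hypHess E 0 0 x + hypHess E 1 1 x) / x 1 = pd 0 (hypHess E 0 1) x := by
  have hx0 : x 1 ≠ 0 := ne_of_gt (hVh hx)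
  have hsq : x 1 ^ 2 ≠ 0 := pow_ne_zero _ hx0
  have h1 : ∀ i, ContDiffOn ℝ ∞ (pd i E) V := fun i => hE.pd hV (by simp) i
  have h2 : ∀ i j, ContDiffOn ℝ ∞ (pd i (pd j E)) V := fun i j => (h1 j).pd hV (by simp) i
  have dE := hE.differentiableAt_of_isOpen hV hx
  have d1 := fun i => (h1 i).differentiableAt_of_isOpen hV hx
  have d2 := fun i j => (h2 i j).differentiableAt_of_isOpen hV hx
  have dy := differentiableAt_coord 1 x
  have c2 : pd 0 (pd 1 E) x = pd 1 (pd 0 E) x := pd_pd_comm hV (hE.of_le two_le_infty) hx 0 1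
  have c3 : ∀ i, pd 0 (pd 1 (pd i E)) x = pd 1 (pd 0 (pd i E)) x := fun i =>
    pd_pd_comm hV ((h1 i).of_le two_le_infty) hx 0 1
  -- The derivative in `y` passes two derivatives in `x`, one exchange at the point and one on a
  -- neighbourhood.
  have c3' : pd 1 (pd 0 (pd 0 E)) x = pd 0 (pd 0 (pd 1 E)) x := by
    rw [← c3, pd_eq_of_eqOn hV (fun y hy => pd_pd_comm hV (hE.of_le two_le_infty) hy 1 0) hx]
  have e00 : hypHess E 0 0 = fun x => pd 0 (pd 0 E) x - pd 1 E x / x 1 - E x / x 1 ^ 2 :=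
    funext (hypHess_zero_zero E)
  have e01 : hypHess E 0 1 = fun x => pd 0 (pd 1 E) x + pd 0 E x / x 1 := funext (hypHess_zero_one E)
  have e11 : hypHess E 1 1 = fun x => pd 1 (pd 1 E) x + pd 1 E x / x 1 - E x / x 1 ^ 2 :=
    funext (hypHess_one_one E)
  have dq := fun i => differentiableAt_fun_div (d1 i) dy hx0
  have dq' := differentiableAt_fun_div dE (dy.fun_pow 2) hsq
  rw [e00, e01, e11]
  rw [pd_sub ((d2 1 1).fun_add (dq 1)) dq', pd_add (d2 1 1) (dq 1), pd_div (d1 1) dy hx0,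
    pd_div dE (dy.fun_pow 2) hsq, pd_pow dy, pd_coord, pd_add (d2 0 1) (dq 0), pd_div (d1 0) dy hx0,
    pd_coord, pd_sub ((d2 0 0).fun_sub (dq 1)) dq', pd_sub (d2 0 0) (dq 1), pd_div (d1 1) dy hx0,
    pd_div dE (dy.fun_pow 2) hsq, pd_pow dy, pd_coord, pd_add (d2 0 1) (dq 0), pd_div (d1 0) dy hx0,
    pd_coord, c3 1, c3', c2]
  constructor
  · simp
    field_simp
    ring
  · simp
    field_simp
    ring

/-- The Codazzi equations are sufficient for `T = ∇dE + R g E` to be solvable on convex sets. -/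
theorem exists_hypHess_eq (hV : IsOpen V) (hVh : V ⊆ halfPlane) (hc : Convex ℝ V)
    {a b c : Plane → ℝ} (ha : ContDiffOn ℝ ∞ a V) (hb : ContDiffOn ℝ ∞ b V) (hcc : ContDiffOn ℝ ∞ c V)
    (h0 : ∀ x ∈ V, pd 0 c x = pd 1 b x)
    (h1 : ∀ x ∈ V, pd 1 a x + (a x + c x) / x 1 = pd 0 b x) :
    ∃ E, ContDiffOn ℝ ∞ E V ∧ ∀ x ∈ V, hypHess E 0 0 x = a x ∧ hypHess E 0 1 x = b x ∧
      hypHess E 1 0 x = b x ∧ hypHess E 1 1 x = c x := by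
  have cX : ∀ i, ContDiffOn ℝ ∞ (fun x : Plane => x i) V := fun i => (contDiff_coord i).contDiffOn
  have dX := fun i (x : Plane) => differentiableAt_coord i x
  have da := fun x (hx : x ∈ V) => ha.differentiableAt_of_isOpen hV hx
  have db := fun x (hx : x ∈ V) => hb.differentiableAt_of_isOpen hV hx
  have dc := fun x (hx : x ∈ V) => hcc.differentiableAt_of_isOpen hV hx
  have hy : ∀ x ∈ V, x 1 ≠ 0 := fun x hx => ne_of_gt (hVh hx)
  -- The function `p` is to become `(E/y + ∂₁E)/2`; its differential is closed by the first Codazzi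
  -- equation.
  obtain ⟨p, hp, hpd⟩ := exists_pd_eq_of_closed hc hV (a := fun x => 1 / 2 * b x)
    (b := fun x => 1 / 2 * c x) (contDiffOn_const.mul hb) (contDiffOn_const.mul hcc) (fun x hx => by
      rw [pd_const_mul (db x hx), pd_const_mul (dc x hx), h0 x hx])
  -- The function `q` is to become `y ∂₀E - 2xp`. The failure of closedness is `y` times the second
  -- Codazzi equation plus `x` times the first, hence zero.
  obtain ⟨q, hq, hqd⟩ := exists_pd_eq_of_closed hc hV (a := fun x => x 1 * a x - x 0 * b x)
    (b := fun x => x 1 * b x - x 0 * c x) (((cX 1).mul ha).sub ((cX 0).mul hb))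
    (((cX 1).mul hb).sub ((cX 0).mul hcc)) (fun x hx => by
      have := hy x hx
      rw [pd_sub ((dX 1 x).fun_mul (da x hx)) ((dX 0 x).fun_mul (db x hx)),
        pd_sub ((dX 1 x).fun_mul (db x hx)) ((dX 0 x).fun_mul (dc x hx)),
        pd_mul (dX 1 x) (da x hx), pd_mul (dX 0 x) (db x hx), pd_mul (dX 1 x) (db x hx),
        pd_mul (dX 0 x) (dc x hx), h0 x hx, ← h1 x hx]
      simp only [pd_coord]
      simp
      field_simp
      ring)
  have dp := fun x (hx : x ∈ V) => hp.differentiableAt_of_isOpen hV hx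
  have dq := fun x (hx : x ∈ V) => hq.differentiableAt_of_isOpen hV hx
  -- The function `u` is to become `yE`. Both cross derivatives of its differential equal `y b`, so
  -- no further condition appears.
  obtain ⟨u, hu, hud⟩ := exists_pd_eq_of_closed hc hV (a := fun x => q x + 2 * (x 0 * p x))
    (b := fun x => 2 * (x 1 * p x)) (hq.add (contDiffOn_const.mul ((cX 0).mul hp)))
    (contDiffOn_const.mul ((cX 1).mul hp)) (fun x hx => by
      rw [pd_add (dq x hx) (((dX 0 x).fun_mul (dp x hx)).const_mul 2),
        pd_const_mul ((dX 0 x).fun_mul (dp x hx)), pd_const_mul ((dX 1 x).fun_mul (dp x hx)),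
        pd_mul (dX 0 x) (dp x hx), pd_mul (dX 1 x) (dp x hx), (hqd x hx).2, (hpd x hx).1,
        (hpd x hx).2]
      simp only [pd_coord]
      simp
      ring)
  have du := fun x (hx : x ∈ V) => hu.differentiableAt_of_isOpen hV hx
  have hE0 : ∀ x ∈ V, pd 0 (fun x => u x / x 1) x = (q x + 2 * (x 0 * p x)) / x 1 := fun x hx => by
    rw [pd_div (du x hx) (dX 1 x) (hy x hx), pd_coord, (hud x hx).1]
    have := hy x hx
    simp
    field_simp
  have hE1 : ∀ x ∈ V, pd 1 (fun x => u x / x 1) x = 2 * p x - u x / x 1 ^ 2 := fun x hx => by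
    rw [pd_div (du x hx) (dX 1 x) (hy x hx), pd_coord, (hud x hx).2]
    have := hy x hx
    simp
    field_simp
  refine ⟨fun x => u x / x 1, hu.div (cX 1) hy, fun x hx => ?_⟩
  have hx0 := hy x hx
  have hsq : x 1 ^ 2 ≠ 0 := pow_ne_zero _ hx0
  have d1 := (dq x hx).fun_add (((dX 0 x).fun_mul (dp x hx)).const_mul 2)
  have H0 : ∀ i, pd i (pd 0 (fun x => u x / x 1)) x = pd i (fun x => (q x + 2 * (x 0 * p x)) / x 1) x :=
    fun i => pd_eq_of_eqOn hV hE0 hx i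
  have H1 : ∀ i, pd i (pd 1 (fun x => u x / x 1)) x = pd i (fun x => 2 * p x - u x / x 1 ^ 2) x :=
    fun i => pd_eq_of_eqOn hV hE1 hx i
  simp only [pd_div d1 (dX 1 x) hx0, pd_add (dq x hx) (((dX 0 x).fun_mul (dp x hx)).const_mul 2),
        pd_const_mul ((dX 0 x).fun_mul (dp x hx)), pd_mul (dX 0 x) (dp x hx), pd_coord] at H0
  simp only [pd_sub ((dp x hx).const_mul 2) (differentiableAt_fun_div (du x hx) ((dX 1 x).fun_pow 2) hsq),
    pd_const_mul (dp x hx), pd_div (du x hx) ((dX 1 x).fun_pow 2) hsq, pd_pow (dX 1 x), pd_coord] at H1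
  rw [hypHess_zero_zero, hypHess_zero_one, hypHess_one_zero, hypHess_one_one, H0, H1, H0, H1,
    hE0 x hx, hE1 x hx, (hqd x hx).1, (hqd x hx).2, (hpd x hx).1, (hpd x hx).2, (hud x hx).1,
    (hud x hx).2]
  refine ⟨?_, ?_, ?_, ?_⟩ <;> simp <;> field_simp <;> ring

end

/-! ### First order distributional equations are local -/

section

variable {Ω : Set Plane} {f₀ f₁ f₂ : Plane → ℝ}

/-- The distribution `-∂₀ f₀ - ∂₁ f₁ + f₂` applied to `φ`. -/
noncomputable def divPairing (f₀ f₁ f₂ φ : Plane → ℝ) : ℝ :=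
  ∫ x, (f₀ x * pd 0 φ x + f₁ x * pd 1 φ x + f₂ x * φ x)

theorem integrable_divPairing {φ : Plane → ℝ} (hφ : IsTest Ω φ)
    (h₀ : LocallyIntegrableOn f₀ Ω) (h₁ : LocallyIntegrableOn f₁ Ω) (h₂ : LocallyIntegrableOn f₂ Ω) :
    Integrable (fun x => f₀ x * pd 0 φ x + f₁ x * pd 1 φ x + f₂ x * φ x) :=
  (((hφ.pd 0).integrable_mul h₀).add ((hφ.pd 1).integrable_mul h₁)).add (hφ.integrable_mul h₂)

theorem divPairing_add (h₀ : LocallyIntegrableOn f₀ Ω) (h₁ : LocallyIntegrableOn f₁ Ω)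
    (h₂ : LocallyIntegrableOn f₂ Ω) {φ ψ : Plane → ℝ} (hφ : IsTest Ω φ) (hψ : IsTest Ω ψ) :
    divPairing f₀ f₁ f₂ (fun x => φ x + ψ x) = divPairing f₀ f₁ f₂ φ + divPairing f₀ f₁ f₂ ψ := by
  unfold divPairing
  rw [← integral_add (integrable_divPairing hφ h₀ h₁ h₂) (integrable_divPairing hψ h₀ h₁ h₂)]
  congr 1; ext x
  beta_reduce
  rw [pd_add (hφ.differentiableAt x) (hψ.differentiableAt x),
    pd_add (hφ.differentiableAt x) (hψ.differentiableAt x)]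
  ring

/-- Finitely many of the sets `V x` cover the support of `φ`. A subordinate smooth partition of
unity splits `φ` into test functions on these sets, and the pairing is additive. -/
theorem divPairing_eq_zero_of_local (h₀ : LocallyIntegrableOn f₀ Ω)
    (h₁ : LocallyIntegrableOn f₁ Ω) (h₂ : LocallyIntegrableOn f₂ Ω)
    (h : ∀ x ∈ Ω, ∃ V, IsOpen V ∧ x ∈ V ∧ ∀ φ, IsTest V φ → divPairing f₀ f₁ f₂ φ = 0)
    {φ : Plane → ℝ} (hφ : IsTest Ω φ) : divPairing f₀ f₁ f₂ φ = 0 := by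
  choose! V hVo hxV hV using h
  obtain ⟨t, htΩ, ht⟩ := hφ.2.1.isCompact.elim_nhds_subcover V
    fun x hx => (hVo x (hφ.2.2 hx)).mem_nhds (hxV x (hφ.2.2 hx))
  obtain ⟨ρ, hρ⟩ := SmoothPartitionOfUnity.exists_isSubordinate (modelWithCornersSelf ℝ Plane)
    (isClosed_tsupport φ) (fun i : t => V i) (fun i => hVo _ (hφ.2.2 (htΩ i i.2)))
    (by simpa [iUnion_subtype] using ht)
  have tst : ∀ i : t, IsTest (Ω ∩ V i) (fun x => ρ i x * φ x) := fun i =>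
    hφ.mul_of_tsupport_subset (ρ i).contMDiff.contDiff (hρ i)
  have hsum : φ = fun x => ∑ i, ρ i x * φ x := by
    ext x
    by_cases hx : x ∈ tsupport φ
    · have := ρ.sum_eq_one hx
      rw [finsum_eq_sum_of_fintype] at this
      rw [← Finset.sum_mul, this, one_mul]
    · simp [image_eq_zero_of_notMem_tsupport hx]
  have key : ∀ s : Finset t, IsTest Ω (fun x => ∑ i ∈ s, ρ i x * φ x) ∧
      divPairing f₀ f₁ f₂ (fun x => ∑ i ∈ s, ρ i x * φ x) = 0 := by
    classical
    intro s
    induction s using Finset.induction_on with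
    | empty =>
      simp only [Finset.sum_empty]
      refine ⟨IsTest.of_contDiff_of_subset contDiff_const isCompact_empty (empty_subset _)
        fun _ _ => rfl, ?_⟩
      simp [divPairing, pd_const]
    | insert i s hi ih =>
      simp only [Finset.sum_insert hi]
      have ti := (tst i).mono inter_subset_left
      refine ⟨ti.add ih.1, ?_⟩
      rw [divPairing_add h₀ h₁ h₂ ti ih.1, ih.2, add_zero]
      exact hV _ (hφ.2.2 (htΩ i i.2)) _ ((tst i).mono inter_subset_right)
  rw [hsum]
  exact (key Finset.univ).2

end

/-! ### The Codazzi equations in the sense of distributions -/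

/-- The one-form `α dx⁰ + β dx¹` is closed on `Ω` in the sense of distributions. -/
def WeakClosed (α β : Plane → ℝ) (Ω : Set Plane) : Prop :=
  ∀ φ, IsTest Ω φ → ∫ x, α x * pd 1 φ x = ∫ x, β x * pd 0 φ x

/-- The Codazzi equations `∂₀ c = ∂₁ b`, `∂₁ a + (a + c) / y = ∂₀ b` in the sense of distributions. -/
def WeakCodazzi (a b c : Plane → ℝ) (Ω : Set Plane) : Prop :=
  ∀ φ, IsTest Ω φ → divPairing c (fun x => -b x) (fun _ => 0) φ = 0 ∧
    divPairing (fun x => -b x) a (fun x => -(a x + c x) / x 1) φ = 0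

theorem contDiffOn_inv_coord {Ω : Set Plane} (hΩh : Ω ⊆ halfPlane) :
    ContDiffOn ℝ ∞ (fun x : Plane => 1 / x 1) Ω :=
  contDiffOn_const.div (contDiff_coord 1).contDiffOn fun _ hx => ne_of_gt (hΩh hx)

/-- This is `d² = 0`: both pairings equal minus the integral of `p` against the mixed second
derivative of `φ`. -/
theorem WeakClosed.of_hasWeakPD {p α β : Plane → ℝ} {Ω : Set Plane} (h0 : HasWeakPD 0 p α Ω)
    (h1 : HasWeakPD 1 p β Ω) : WeakClosed α β Ω := by
  intro φ hφ
  have e0 := hasWeakPD_iff.mp h0 _ (hφ.pd 1)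
  have e1 := hasWeakPD_iff.mp h1 _ (hφ.pd 0)
  have : ∀ x, pd 0 (pd 1 φ) x = pd 1 (pd 0 φ) x := fun x =>
    pd_pd_comm isOpen_univ (hφ.1.of_le two_le_infty).contDiffOn (mem_univ x) 0 1
  simp only [this] at e0
  linarith

section

variable {Ω : Set Plane} {a b c : Plane → ℝ}

theorem MeasureTheory.LocallyIntegrableOn.contDiffOn_mul {g : Plane → ℝ} (hΩ : IsOpen Ω)
    (ha : LocallyIntegrableOn a Ω) (hg : ContDiffOn ℝ ∞ g Ω) :
    LocallyIntegrableOn (fun x => g x * a x) Ω := ha.continuousOn_mul hg.continuousOn hΩ.isLocallyClosed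

/-- The exterior derivative of the second one-form is a combination of the two Codazzi equations
with coefficients `y` and `x`. Since `y` is invertible on `Ω`, the second equation can be recovered
from closedness. -/
theorem weakCodazzi_iff (hΩ : IsOpen Ω) (hΩh : Ω ⊆ halfPlane) (ha : LocallyIntegrableOn a Ω)
    (hb : LocallyIntegrableOn b Ω) (hc : LocallyIntegrableOn c Ω) :
    WeakCodazzi a b c Ω ↔ WeakClosed b c Ω ∧
      WeakClosed (fun x => x 1 * a x - x 0 * b x) (fun x => x 1 * b x - x 0 * c x) Ω := by
  have cX : ∀ i, ContDiffOn ℝ ∞ (fun x : Plane => x i) Ω := fun i => (contDiff_coord i).contDiffOn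
  have A1 : (∀ φ, IsTest Ω φ → divPairing c (fun x => -b x) (fun _ => 0) φ = 0) ↔
      WeakClosed b c Ω := by
    refine forall₂_congr fun φ hφ => ?_
    have : divPairing c (fun x => -b x) (fun _ => 0) φ =
        (∫ x, c x * pd 0 φ x) - ∫ x, b x * pd 1 φ x := by
      rw [divPairing, ← integral_sub ((hφ.pd 0).integrable_mul hc) ((hφ.pd 1).integrable_mul hb)]
      congr 1; ext x; ring
    rw [this, sub_eq_zero]
    exact eq_comm
  have pdmul : ∀ i {χ : Plane → ℝ}, IsTest Ω χ → ∀ j x, pd j (fun x => x i * χ x) x =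
      (if i = j then 1 else 0) * χ x + x i * pd j χ x := fun i χ hχ j x => by
    rw [pd_mul (differentiableAt_coord i x) (hχ.differentiableAt x), pd_coord]
  -- The coefficients `y` and `x` are absorbed into the test functions `y χ` and `x χ`.
  have key : ∀ χ, IsTest Ω χ →
      divPairing (fun x => -b x) a (fun x => -(a x + c x) / x 1) (fun x => x 1 * χ x) =
      ((∫ x, (x 1 * a x - x 0 * b x) * pd 1 χ x) - ∫ x, (x 1 * b x - x 0 * c x) * pd 0 χ x) -
        divPairing c (fun x => -b x) (fun _ => 0) (fun x => x 0 * χ x) := by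
    intro χ hχ
    have hχ0 := hχ.mul_smooth hΩ (cX 0)
    have i1 : Integrable (fun x => (x 1 * a x - x 0 * b x) * pd 1 χ x) := (hχ.pd 1).integrable_mul
      ((ha.contDiffOn_mul hΩ (cX 1)).sub (hb.contDiffOn_mul hΩ (cX 0)))
    have i2 : Integrable (fun x => (x 1 * b x - x 0 * c x) * pd 0 χ x) := (hχ.pd 0).integrable_mul
      ((hb.contDiffOn_mul hΩ (cX 1)).sub (hc.contDiffOn_mul hΩ (cX 0)))
    have i3 : Integrable (fun x => c x * pd 0 (fun x => x 0 * χ x) x +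
        -b x * pd 1 (fun x => x 0 * χ x) x + 0 * (x 0 * χ x)) := integrable_divPairing hχ0 hc hb.neg
      ((locallyIntegrable_const (0 : ℝ)).locallyIntegrableOn Ω)
    have i12 : Integrable (fun x => (x 1 * a x - x 0 * b x) * pd 1 χ x -
        (x 1 * b x - x 0 * c x) * pd 0 χ x) := i1.sub i2
    unfold divPairing
    rw [← integral_sub i1 i2]
    beta_reduce
    rw [← integral_sub i12 i3]
    congr 1; ext x
    by_cases hx : x ∈ Ω
    · have : x 1 ≠ 0 := ne_of_gt (hΩh hx)
      simp only [pdmul _ hχ]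
      simp
      field_simp
      ring
    · simp [pdmul _ hχ, hχ.eq_zero hx, (hχ.pd _).eq_zero hx]
  constructor
  · intro h
    refine ⟨A1.mp fun φ hφ => (h φ hφ).1, fun χ hχ => ?_⟩
    have k := key χ hχ
    rw [(h _ (hχ.mul_smooth hΩ (cX 1))).2, (h _ (hχ.mul_smooth hΩ (cX 0))).1] at k
    linarith
  · rintro ⟨h1, h2⟩ φ hφ
    refine ⟨A1.mpr h1 φ hφ, ?_⟩
    -- The identity is used for `χ = φ / y`, so that `y χ = φ`.
    have t := hφ.mul_smooth hΩ (contDiffOn_inv_coord hΩh)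
    have k := key _ t
    rw [h2 _ t, A1.mpr h1 _ (t.mul_smooth hΩ (cX 0))] at k
    have e : (fun x : Plane => x 1 * (1 / x 1 * φ x)) = φ := by
      ext x
      by_cases hx : x ∈ Ω
      · have : x 1 ≠ 0 := ne_of_gt (hΩh hx)
        field_simp
      · simp [hφ.eq_zero hx]
    rw [e] at k
    linarith

/-- Potentials `E` are given only near each point, whereas the codifferential is tested against
forms supported anywhere in a chart; this bridges the two. -/
theorem WeakCodazzi.of_local (hΩ : IsOpen Ω) (hΩh : Ω ⊆ halfPlane) (ha : LocallyIntegrableOn a Ω)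
    (hb : LocallyIntegrableOn b Ω) (hc : LocallyIntegrableOn c Ω)
    (h : ∀ x ∈ Ω, ∃ V, IsOpen V ∧ x ∈ V ∧ WeakCodazzi a b c V) : WeakCodazzi a b c Ω := by
  have h0 : LocallyIntegrableOn (fun _ : Plane => (0 : ℝ)) Ω :=
    (locallyIntegrable_const (0 : ℝ)).locallyIntegrableOn Ω
  have h2 : LocallyIntegrableOn (fun x => -(a x + c x) / x 1) Ω := by
    have := (ha.add hc).neg.contDiffOn_mul hΩ (contDiffOn_inv_coord hΩh)
    convert this using 2 with x
    simp [div_eq_inv_mul]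
  intro φ hφ
  exact ⟨divPairing_eq_zero_of_local hc hb.neg h0 (fun x hx => by
      obtain ⟨V, hV, hxV, hW⟩ := h x hx
      exact ⟨V, hV, hxV, fun φ hφ => (hW φ hφ).1⟩) hφ,
    divPairing_eq_zero_of_local hb.neg ha h2 (fun x hx => by
      obtain ⟨V, hV, hxV, hW⟩ := h x hx
      exact ⟨V, hV, hxV, fun φ hφ => (hW φ hφ).2⟩) hφ⟩

/-- The substitution `φ = y² η` absorbs the factor `y²` of the integrand, and its derivative
supplies the missing Christoffel terms. Forms `η` with one zero component separate the two
equations. -/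
theorem weakCodiffZero_iff {R : ℝ} {G S : MatField} (hR : R < 0) (hΩ : IsOpen Ω)
    (hΩh : Ω ⊆ halfPlane) (hG : ∀ x ∈ Ω, G x = hypMetric R x) (hS : ∀ x i j, S x i j = S x j i)
    (hSi : ∀ i j, LocallyIntegrableOn (fun x => S x i j) Ω) :
    WeakCodiffZero G S Ω ↔
      WeakCodazzi (fun x => S x 1 1) (fun x => -S x 0 1) (fun x => S x 0 0) Ω := by
  have h0 : LocallyIntegrableOn (fun _ : Plane => (0 : ℝ)) Ω :=
    (locallyIntegrable_const (0 : ℝ)).locallyIntegrableOn Ω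
  have hsq : ContDiffOn ℝ ∞ (fun x : Plane => x 1 ^ 2) Ω := ((contDiff_coord 1).pow 2).contDiffOn
  have h2 : LocallyIntegrableOn (fun x => -(S x 1 1 + S x 0 0) / x 1) Ω := by
    have := ((hSi 1 1).add (hSi 0 0)).neg.contDiffOn_mul hΩ (contDiffOn_inv_coord hΩh)
    convert this using 2 with x
    simp [div_eq_inv_mul]
  have hS01 : LocallyIntegrableOn (fun x => - -S x 0 1) Ω := by simpa using hSi 0 1
  have key : ∀ η : Fin 2 → Plane → ℝ, (∀ i, IsTest Ω (η i)) →
      ∫ x in Ω, (∑ i, ∑ j, ∑ k, ∑ l,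
        (G x)⁻¹ i k * (G x)⁻¹ j l * S x k l * covDerivForm G η i j x) * volDensity G x =
      -R * (divPairing (fun x => S x 0 0) (fun x => - -S x 0 1) (fun _ => 0)
          (fun x => x 1 ^ 2 * η 0 x) +
        divPairing (fun x => - -S x 0 1) (fun x => S x 1 1) (fun x => -(S x 1 1 + S x 0 0) / x 1)
          (fun x => x 1 ^ 2 * η 1 x)) := by
    intro η hη
    have t0 := (hη 0).mul_smooth hΩ hsq
    have t1 := (hη 1).mul_smooth hΩ hsq
    have i1 := integrable_divPairing t0 (hSi 0 0) hS01 h0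
    have i2 := integrable_divPairing t1 hS01 (hSi 1 1) h2
    unfold divPairing
    rw [← integral_add i1 i2, ← integral_const_mul]
    refine Eq.trans ?_ (setIntegral_eq_integral_of_forall_compl_eq_zero (s := Ω) fun x hx => by
      simp only [t0.eq_zero hx, t1.eq_zero hx, (t0.pd _).eq_zero hx, (t1.pd _).eq_zero hx]; simp)
    refine setIntegral_congr_fun hΩ.measurableSet fun x hx => ?_
    have hx0 : x 1 ≠ 0 := ne_of_gt (hΩh hx)
    have pdm : ∀ i j, pd j (fun x => x 1 ^ 2 * η i x) x =
        2 * x 1 * (if 1 = j then 1 else 0) * η i x + x 1 ^ 2 * pd j (η i) x := fun i j => by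
      rw [pd_mul ((differentiableAt_coord 1 x).fun_pow 2) ((hη i).differentiableAt x),
        pd_pow (differentiableAt_coord 1 x), pd_coord]
      simp
    simp only []
    rw [weakCodiff_integrand_eq hR hΩ hΩh hG hx hS]
    simp only [pdm]
    simp
    field_simp
    ring
  have hR0 : -R ≠ 0 := by linarith
  have hdz : ∀ f₀ f₁ f₂ : Plane → ℝ, divPairing f₀ f₁ f₂ (fun x => x 1 ^ 2 * 0) = 0 := fun _ _ _ => by
    simp [divPairing, pd_const]
  have tz : IsTest Ω (fun _ => (0 : ℝ)) := IsTest.of_contDiff_of_subset contDiff_const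
    isCompact_empty (empty_subset _) fun _ _ => rfl
  constructor
  · intro h φ hφ
    have hinv : ContDiffOn ℝ ∞ (fun x : Plane => 1 / x 1 ^ 2) Ω :=
      contDiffOn_const.div hsq fun x hx => pow_ne_zero _ (ne_of_gt (hΩh hx))
    have t := hφ.mul_smooth hΩ hinv
    have e : (fun x : Plane => x 1 ^ 2 * (1 / x 1 ^ 2 * φ x)) = φ := by
      ext x
      by_cases hx : x ∈ Ω
      · have : x 1 ≠ 0 := ne_of_gt (hΩh hx)
        field_simp
      · simp [hφ.eq_zero hx]
    constructor
    · have hη : ∀ i, IsTest Ω ((![fun x => 1 / x 1 ^ 2 * φ x, fun _ => 0] : Fin 2 → Plane → ℝ) i) :=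
        Fin.forall_fin_two.mpr ⟨t, tz⟩
      have k := key _ hη
      rw [h _ hη] at k
      simp only [Matrix.cons_val_zero, Matrix.cons_val_one, hdz, add_zero, e] at k
      exact (mul_eq_zero.mp k.symm).resolve_left hR0
    · have hη : ∀ i, IsTest Ω ((![fun _ => 0, fun x => 1 / x 1 ^ 2 * φ x] : Fin 2 → Plane → ℝ) i) :=
        Fin.forall_fin_two.mpr ⟨tz, t⟩
      have k := key _ hη
      rw [h _ hη] at k
      simp only [Matrix.cons_val_zero, Matrix.cons_val_one, hdz, zero_add, e] at k
      exact (mul_eq_zero.mp k.symm).resolve_left hR0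
  · intro h η hη
    rw [key η hη, (h _ ((hη 0).mul_smooth hΩ hsq)).1, (h _ ((hη 1).mul_smooth hΩ hsq)).2]
    simp

end

/-! ### The equation `T = ∇dE + R g E` in the sense of distributions -/

theorem HasWeakPD.congr_on {i : Fin 2} {f f' f₂ f₂' : Plane → ℝ} {Ω : Set Plane}
    (h : HasWeakPD i f f' Ω) (hΩ : IsOpen Ω) (e : ∀ x ∈ Ω, f x = f₂ x)
    (e' : ∀ᵐ x ∂(volume.restrict Ω), f' x = f₂' x) : HasWeakPD i f₂ f₂' Ω :=
  h.congr_ae (ae_restrict_of_forall_mem hΩ.measurableSet e) e'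

theorem HasWeakPD.congr_on' {i : Fin 2} {f f' f₂ f₂' : Plane → ℝ} {Ω : Set Plane}
    (h : HasWeakPD i f f' Ω) (hΩ : IsOpen Ω) (e : ∀ x ∈ Ω, f x = f₂ x)
    (e' : ∀ x ∈ Ω, f' x = f₂' x) : HasWeakPD i f₂ f₂' Ω :=
  h.congr_on hΩ e (ae_restrict_of_forall_mem hΩ.measurableSet e')

section

variable {R : ℝ} {G T : MatField} {E : Plane → ℝ} {V : Set Plane}

theorem weakHessEq_iff (hR : R < 0) (hV : IsOpen V) (hVh : V ⊆ halfPlane)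
    (hG : ∀ x ∈ V, G x = hypMetric R x) :
    WeakHessEq G R T E V ↔ LocallyIntegrableOn E V ∧
      ∃ (D : Fin 2 → Plane → ℝ) (H : Fin 2 → Fin 2 → Plane → ℝ),
        (∀ i, LocallyIntegrableOn (D i) V ∧ HasWeakPD i E (D i) V) ∧
        (∀ i j, LocallyIntegrableOn (H i j) V ∧ HasWeakPD i (D j) (H i j) V) ∧
        ∀ i j, ∀ᵐ x ∂(volume.restrict V), T x i j = H i j x -
          ∑ k, hypChr k i j / x 1 * D k x - if i = j then E x / x 1 ^ 2 else 0 := by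
  have hR0 : R ≠ 0 := by linarith
  refine and_congr_right fun _ => exists_congr fun D => exists_congr fun H => and_congr_right fun _ =>
    and_congr_right fun _ => forall₂_congr fun i j => ?_
  refine Filter.eventually_congr ?_
  filter_upwards [ae_restrict_mem hV.measurableSet] with x hx
  have hx0 : x 1 ≠ 0 := ne_of_gt (hVh hx)
  simp only [christoffel_eq hR hV hVh hG hx, hG x hx, hypMetric_apply]
  by_cases hij : i = j
  · simp only [hij, if_true]
    have : R * (1 / (-R * x 1 ^ 2)) * E x = - (E x / x 1 ^ 2) := by field_simp
    rw [this, sub_eq_add_neg _ (E x / x 1 ^ 2)]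
  · simp [hij]

/-- A solution of `T = ∇dE + R g E` gives a solution `(y E, p, q)` of a first order system. -/
theorem WeakHessEq.exists_first_order (hR : R < 0) (hV : IsOpen V) (hVh : V ⊆ halfPlane)
    (hG : ∀ x ∈ V, G x = hypMetric R x) (hT : ∀ x ∈ V, T x 1 0 = T x 0 1)
    (h : WeakHessEq G R T E V) :
    ∃ p q : Plane → ℝ, LocallyIntegrableOn p V ∧ LocallyIntegrableOn q V ∧
      HasWeakPD 0 p (fun x => 1 / 2 * T x 0 1) V ∧ HasWeakPD 1 p (fun x => 1 / 2 * T x 1 1) V ∧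
      HasWeakPD 0 q (fun x => x 1 * T x 0 0 - x 0 * T x 0 1) V ∧
      HasWeakPD 1 q (fun x => x 1 * T x 0 1 - x 0 * T x 1 1) V ∧
      HasWeakPD 0 (fun x => x 1 * E x) (fun x => q x + 2 * (x 0 * p x)) V ∧
      HasWeakPD 1 (fun x => x 1 * E x) (fun x => 2 * (x 1 * p x)) V := by
  obtain ⟨hE, D, H, hD, hH, hTe⟩ := (weakHessEq_iff hR hV hVh hG).mp h
  have cX : ∀ i, ContDiffOn ℝ ∞ (fun x : Plane => x i) V := fun i => (contDiff_coord i).contDiffOn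
  have cI := contDiffOn_inv_coord hVh
  have hy : ∀ x ∈ V, x 1 ≠ 0 := fun x hx => ne_of_gt (hVh hx)
  have pdI : ∀ i, ∀ x ∈ V, pd i (fun x : Plane => 1 / x 1) x = if 1 = i then -1 / x 1 ^ 2 else 0 := by
    intro i x hx
    rw [pd_div (differentiableAt_const _) (differentiableAt_coord 1 x) (hy x hx), pd_const, pd_coord]
    fin_cases i <;> simp
  have c2 : ContDiffOn ℝ ∞ (fun _ : Plane => (1 / 2 : ℝ)) V := contDiffOn_const
  have cm2 : ContDiffOn ℝ ∞ (fun _ : Plane => (-2 : ℝ)) V := contDiffOn_const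
  have lEy := hE.contDiffOn_mul hV cI
  have lp := (lEy.add (hD 1).1).contDiffOn_mul hV c2
  -- Here `p = (E/y + ∂₁E)/2`: the entries `01` and `11` of the equation are twice its derivatives.
  set p : Plane → ℝ := fun x => 1 / 2 * (1 / x 1 * E x + D 1 x)
  have hpd : ∀ i, HasWeakPD i p (fun x => 1 / 2 * ((if 1 = i then -1 / x 1 ^ 2 else 0) * E x
      + 1 / x 1 * D i x + H i 1 x)) V ∧ LocallyIntegrableOn (fun x => 1 / 2 *
      ((if 1 = i then -1 / x 1 ^ 2 else 0) * E x + 1 / x 1 * D i x + H i 1 x)) V := by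
    intro i
    have l1 := (hE.contDiffOn_mul hV (cI.pd (n := ∞) (m := ∞) hV (by simp) i)).add
      ((hD i).1.contDiffOn_mul hV cI)
    have w1 := ((hD i).2.smooth_mul hV cI hE (hD i).1).add lEy l1 (hD 1).1 (hH i 1).1 (hH i 1).2
    have l2 := l1.add (hH i 1).1
    have w2 := w1.smooth_mul hV c2 (lEy.add (hD 1).1) l2
    refine ⟨w2.congr_on' hV (fun _ _ => rfl) fun x hx => ?_,
      (l2.contDiffOn_mul hV c2).congr ?_⟩
    · rw [pd_const]
      simp only [Pi.add_apply]
      rw [pdI i x hx]; ring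
    · filter_upwards [ae_restrict_mem hV.measurableSet] with x hx
      simp only [Pi.add_apply]
      rw [pdI i x hx]
  have hp0 : HasWeakPD 0 p (fun x => 1 / 2 * T x 0 1) V := (hpd 0).1.congr_on hV (fun _ _ => rfl) (by
    filter_upwards [hTe 0 1, ae_restrict_mem hV.measurableSet] with x hx hxV
    have := hy x hxV
    rw [hx]; simp [hypChr]; ring)
  have hp1 : HasWeakPD 1 p (fun x => 1 / 2 * T x 1 1) V := (hpd 1).1.congr_on hV (fun _ _ => rfl) (by
    filter_upwards [hTe 1 1, ae_restrict_mem hV.measurableSet] with x hx hxV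
    have := hy x hxV
    rw [hx]; simp [hypChr]; ring)
  -- This function is `q = y ∂₀E - 2xp`. Its derivative is left as the Leibniz rule produces it and
  -- is simplified almost everywhere afterwards.
  have hqd : ∀ i, HasWeakPD i (fun x => x 1 * D 0 x + -2 * (x 0 * p x)) _ V := fun i =>
    ((hH i 0).2.smooth_mul hV (cX 1) (hD 0).1 (hH i 0).1).add ((hD 0).1.contDiffOn_mul hV (cX 1))
      (((hD 0).1.contDiffOn_mul hV ((cX 1).pd (n := ∞) (m := ∞) hV (by simp) i)).add
        ((hH i 0).1.contDiffOn_mul hV (cX 1)))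
      ((lp.contDiffOn_mul hV (cX 0)).contDiffOn_mul hV cm2)
      (((lp.contDiffOn_mul hV (cX 0)).contDiffOn_mul hV (cm2.pd (n := ∞) (m := ∞) hV (by simp) i)).add
        (((lp.contDiffOn_mul hV ((cX 0).pd (n := ∞) (m := ∞) hV (by simp) i)).add
          ((hpd i).2.contDiffOn_mul hV (cX 0))).contDiffOn_mul hV cm2))
      (((hpd i).1.smooth_mul hV (cX 0) lp (hpd i).2).smooth_mul hV cm2 (lp.contDiffOn_mul hV (cX 0))
        ((lp.contDiffOn_mul hV ((cX 0).pd (n := ∞) (m := ∞) hV (by simp) i)).add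
          ((hpd i).2.contDiffOn_mul hV (cX 0))))
  refine ⟨p, fun x => x 1 * D 0 x + -2 * (x 0 * p x), lp,
    ((hD 0).1.contDiffOn_mul hV (cX 1)).add ((lp.contDiffOn_mul hV (cX 0)).contDiffOn_mul hV cm2),
    hp0, hp1, (hqd 0).congr_on hV (fun _ _ => rfl) ?_, (hqd 1).congr_on hV (fun _ _ => rfl) ?_, ?_, ?_⟩
  · filter_upwards [hTe 0 0, hTe 0 1, ae_restrict_mem hV.measurableSet] with x h0 h1 hxV
    have := hy x hxV
    rw [h0, h1]
    simp only [pd_coord, pd_const]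
    simp [hypChr]
    field_simp
    ring
  · filter_upwards [hTe 1 0, hTe 1 1, ae_restrict_mem hV.measurableSet] with x h0 h1 hxV
    have := hy x hxV
    rw [← hT x hxV, h0, h1]
    simp only [pd_coord, pd_const]
    simp [hypChr]
    field_simp
    ring
  · refine ((hD 0).2.smooth_mul hV (cX 1) hE (hD 0).1).congr_on' hV (fun _ _ => rfl) fun x hx => ?_
    simp only [pd_coord]
    simp
  · refine ((hD 1).2.smooth_mul hV (cX 1) hE (hD 1).1).congr_on' hV (fun _ _ => rfl) fun x hx => ?_
    have := hy x hx
    simp only [pd_coord, p]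
    simp
    field_simp

theorem WeakHessEq.weakCodazzi (hR : R < 0) (hV : IsOpen V) (hVh : V ⊆ halfPlane)
    (hG : ∀ x ∈ V, G x = hypMetric R x) (hT : ∀ x ∈ V, T x 1 0 = T x 0 1)
    (hTi : ∀ i j, LocallyIntegrableOn (fun x => T x i j) V) (h : WeakHessEq G R T E V) :
    WeakCodazzi (fun x => T x 0 0) (fun x => T x 0 1) (fun x => T x 1 1) V := by
  obtain ⟨p, q, -, -, hp0, hp1, hq0, hq1, -, -⟩ := h.exists_first_order hR hV hVh hG hT
  rw [weakCodazzi_iff hV hVh (hTi 0 0) (hTi 0 1) (hTi 1 1)]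
  refine ⟨fun φ hφ => ?_, WeakClosed.of_hasWeakPD hq0 hq1⟩
  have := WeakClosed.of_hasWeakPD hp0 hp1 φ hφ
  simp only [mul_assoc, integral_const_mul] at this
  linarith

end

theorem exists_box_subset {Ω : Set Plane} (hΩ : IsOpen Ω) {x₀ : Plane} (hx₀ : x₀ ∈ Ω) :
    ∃ ε > 0, box (fun i => Icc (x₀ i - ε) (x₀ i + ε)) ⊆ Ω := by
  have h1 : IsOpen ((WithLp.toLp 2 : (Fin 2 → ℝ) → Plane) ⁻¹' Ω) :=
    hΩ.preimage (PiLp.continuous_toLp 2 _)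
  obtain ⟨δ, hδ, hball⟩ := Metric.isOpen_iff.mp h1 x₀.ofLp hx₀
  refine ⟨δ / 2, by positivity, fun x hx => ?_⟩
  suffices x.ofLp ∈ Metric.ball x₀.ofLp δ from hball this
  refine lt_of_le_of_lt ((dist_pi_le_iff (by positivity : 0 ≤ δ / 2)).mpr fun i => ?_)
    (half_lt_self hδ)
  have := hx i
  rw [Real.dist_eq, abs_le]
  constructor <;> linarith [this.1, this.2]

/-- Extension by zero makes the form integrable on the plane; closedness is tested only inside the
box. -/
theorem exists_hasWeakPD_of_weakClosed {A : Fin 2 → Set ℝ} (hAo : ∀ i, IsOpen (A i))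
    (hA : ∀ i, (A i).OrdConnected) (hne : ∀ i, (A i).Nonempty) {α β : Plane → ℝ}
    (hα : IntegrableOn α (box A)) (hβ : IntegrableOn β (box A)) (h : WeakClosed α β (box A)) :
    ∃ f, LocallyIntegrable f ∧ HasWeakPD 0 f α (box A) ∧ HasWeakPD 1 f β (box A) := by
  have hm : MeasurableSet (box A) := (isOpen_box hAo).measurableSet
  have hi : ∀ (γ : Plane → ℝ) (i) (φ), IsTest (box A) φ →
      ∫ x, (box A).indicator γ x * pd i φ x = ∫ x, γ x * pd i φ x := fun γ i φ hφ => by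
    congr 1; ext x
    by_cases hx : x ∈ box A
    · rw [indicator_of_mem hx]
    · rw [(hφ.pd i).eq_zero hx, mul_zero, mul_zero]
  obtain ⟨f, hf, h0, h1⟩ := exists_hasWeakPD_of_closed hAo hA hne
    ((integrable_indicator_iff hm).mpr hα) ((integrable_indicator_iff hm).mpr hβ)
    (fun φ hφ => by rw [hi _ _ _ hφ, hi _ _ _ hφ]; exact h φ hφ)
  exact ⟨f, hf, h0.congr_on' (isOpen_box hAo) (fun _ _ => rfl) fun x hx => indicator_of_mem hx _,
    h1.congr_on' (isOpen_box hAo) (fun _ _ => rfl) fun x hx => indicator_of_mem hx _⟩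

/-- The distributional Codazzi equations imply that `T = ∇dE + R g E` is locally solvable. -/
theorem WeakCodazzi.exists_weakHessEq {R : ℝ} {G T : MatField} {Ω : Set Plane} (hR : R < 0)
    (hΩ : IsOpen Ω) (hΩh : Ω ⊆ halfPlane) (hG : ∀ x ∈ Ω, G x = hypMetric R x)
    (hT : ∀ x ∈ Ω, T x 1 0 = T x 0 1) (hTi : ∀ i j, LocallyIntegrableOn (fun x => T x i j) Ω)
    (h : WeakCodazzi (fun x => T x 0 0) (fun x => T x 0 1) (fun x => T x 1 1) Ω)
    {x₀ : Plane} (hx₀ : x₀ ∈ Ω) :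
    ∃ V, IsOpen V ∧ x₀ ∈ V ∧ V ⊆ Ω ∧ ∃ E, WeakHessEq G R T E V := by
  obtain ⟨hc1, hc2⟩ := (weakCodazzi_iff hΩ hΩh (hTi 0 0) (hTi 0 1) (hTi 1 1)).mp h
  obtain ⟨ε, hε, hK⟩ := exists_box_subset hΩ hx₀
  -- An open cube with compact closure in `Ω` is used, so that local integrability yields
  -- integrability on it.
  set A : Fin 2 → Set ℝ := fun i => Ioo (x₀ i - ε) (x₀ i + ε) with hAdef
  set K : Set Plane := box fun i => Icc (x₀ i - ε) (x₀ i + ε)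
  have hKc : IsCompact K := isCompact_box_Icc _ _
  have hVK : box A ⊆ K := fun x hx i => Ioo_subset_Icc_self (hx i)
  have hAo : ∀ i, IsOpen (A i) := fun i => isOpen_Ioo
  have hA : ∀ i, (A i).OrdConnected := fun i => ordConnected_Ioo
  have hne : ∀ i, (A i).Nonempty := fun i => nonempty_Ioo.mpr (by linarith)
  have hV : IsOpen (box A) := isOpen_box hAo
  have hVΩ : box A ⊆ Ω := hVK.trans hK
  have hVh : box A ⊆ halfPlane := hVΩ.trans hΩh
  have hy : ∀ x ∈ box A, x 1 ≠ 0 := fun x hx => ne_of_gt (hVh hx)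
  have cX : ∀ i, ContDiffOn ℝ ∞ (fun x : Plane => x i) (box A) := fun i => (contDiff_coord i).contDiffOn
  have cI := contDiffOn_inv_coord hVh
  have kX : ∀ i, ContinuousOn (fun x : Plane => x i) K := fun i =>
    (contDiff_coord i (n := 0)).continuous.continuousOn
  have hTK : ∀ i j, IntegrableOn (fun x => T x i j) K := fun i j =>
    (hTi i j).integrableOn_compact_subset hK hKc
  have mulX : ∀ (i) {f : Plane → ℝ}, IntegrableOn f K → IntegrableOn (fun x => x i * f x) K :=
    fun i f hf => hf.continuousOn_mul (kX i) hKc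
  have c2 : ContDiffOn ℝ ∞ (fun _ : Plane => (2 : ℝ)) (box A) := contDiffOn_const
  obtain ⟨p, hp, hp0, hp1⟩ := exists_hasWeakPD_of_weakClosed hAo hA hne
    (α := fun x => 1 / 2 * T x 0 1) (β := fun x => 1 / 2 * T x 1 1)
    (IntegrableOn.mono_set ((hTK 0 1).const_mul _) hVK)
    (IntegrableOn.mono_set ((hTK 1 1).const_mul _) hVK)
    (fun φ hφ => by
      have := hc1 φ (hφ.mono hVΩ)
      simp only [mul_assoc, integral_const_mul] at this ⊢
      rw [this])
  obtain ⟨q, hq, hq0, hq1⟩ := exists_hasWeakPD_of_weakClosed hAo hA hne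
    (((mulX 1 (hTK 0 0)).sub (mulX 0 (hTK 0 1))).mono_set hVK)
    (((mulX 1 (hTK 0 1)).sub (mulX 0 (hTK 1 1))).mono_set hVK)
    (fun φ hφ => hc2 φ (hφ.mono hVΩ))
  have lp := hp.locallyIntegrableOn (box A)
  have lq := hq.locallyIntegrableOn (box A)
  have lT : ∀ i j, LocallyIntegrableOn (fun x => T x i j) (box A) := fun i j =>
    ((hTK i j).mono_set hVK).locallyIntegrableOn
  have lTh : ∀ i j, LocallyIntegrableOn (fun x => 1 / 2 * T x i j) (box A) := fun i j =>
    (IntegrableOn.mono_set ((hTK i j).const_mul _) hVK).locallyIntegrableOn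
  have lq0 : LocallyIntegrableOn (fun x => x 1 * T x 0 0 - x 0 * T x 0 1) (box A) :=
    ((lT 0 0).contDiffOn_mul hV (cX 1)).sub ((lT 0 1).contDiffOn_mul hV (cX 0))
  have lq1 : LocallyIntegrableOn (fun x => x 1 * T x 0 1 - x 0 * T x 1 1) (box A) :=
    ((lT 0 1).contDiffOn_mul hV (cX 1)).sub ((lT 1 1).contDiffOn_mul hV (cX 0))
  have lxp := fun i => (lp.contDiffOn_mul hV (cX i))
  have l2xp := fun i => (lxp i).contDiffOn_mul hV c2
  have lr : LocallyIntegrableOn (fun x => q x + 2 * (x 0 * p x)) (box A) := lq.add (l2xp 0)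
  have wxp : ∀ i j (p' : Plane → ℝ), LocallyIntegrableOn p' (box A) → HasWeakPD j p p' (box A) →
      HasWeakPD j (fun x => 2 * (x i * p x))
        (fun x => 2 * ((if i = j then 1 else 0) * p x + x i * p' x)) (box A) ∧
      LocallyIntegrableOn (fun x => 2 * ((if i = j then 1 else 0) * p x + x i * p' x)) (box A) := by
    intro i j p' lp' hp'
    have e : ∀ x, pd j (fun x : Plane => x i) x = if i = j then 1 else 0 := fun x => pd_coord j i x
    have w1 := hp'.smooth_mul hV (cX i) lp lp'
    have l1 := (lp.contDiffOn_mul hV ((cX i).pd (n := ∞) (m := ∞) hV (by simp) j)).add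
      (lp'.contDiffOn_mul hV (cX i))
    have w2 := w1.smooth_mul hV c2 (lxp i) l1
    simp only [e, pd_const, zero_mul, zero_add] at w2
    have l2 := l1.contDiffOn_mul hV c2
    simp only [e, Pi.add_apply] at l2
    exact ⟨w2, l2⟩
  have hr : ∀ j (p' q' : Plane → ℝ), LocallyIntegrableOn p' (box A) → HasWeakPD j p p' (box A) →
      LocallyIntegrableOn q' (box A) → HasWeakPD j q q' (box A) →
      HasWeakPD j (fun x => q x + 2 * (x 0 * p x))
        (fun x => q' x + 2 * ((if 0 = j then 1 else 0) * p x + x 0 * p' x)) (box A) ∧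
      LocallyIntegrableOn (fun x => q' x + 2 * ((if 0 = j then 1 else 0) * p x + x 0 * p' x)) (box A) :=
    fun j p' q' lp' hp' lq' hq' =>
      have w := wxp 0 j p' lp' hp'
      ⟨hq'.add lq lq' (l2xp 0) w.2 w.1, lq'.add w.2⟩
  have r0 := hr 0 _ _ (lTh 0 1) hp0 lq0 hq0
  have r1 := hr 1 _ _ (lTh 1 1) hp1 lq1 hq1
  have s0 := wxp 1 0 _ (lTh 0 1) hp0
  -- As in the smooth case, the two weak cross derivatives both simplify to `y T₀₁`.
  obtain ⟨u, hu, hu0, hu1⟩ := exists_hasWeakPD_of_weakClosed hAo hA hne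
    (α := fun x => q x + 2 * (x 0 * p x)) (β := fun x => 2 * (x 1 * p x))
    (((hq.integrableOn_isCompact hKc).add
      ((mulX 0 (hp.integrableOn_isCompact hKc)).const_mul 2)).mono_set hVK)
    (IntegrableOn.mono_set ((mulX 1 (hp.integrableOn_isCompact hKc)).const_mul 2) hVK) (fun φ hφ => by
      have e1 := hasWeakPD_iff.mp r1.1 φ hφ
      have e0 := hasWeakPD_iff.mp s0.1 φ hφ
      rw [e1, e0]
      congr 2; ext x
      simp only [Fin.isValue, zero_ne_one, one_ne_zero, if_false]
      ring)
  have lu := hu.locallyIntegrableOn (box A)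
  have pdI : ∀ i, ∀ x ∈ box A, pd i (fun x : Plane => 1 / x 1) x =
      if 1 = i then -1 / x 1 ^ 2 else 0 := by
    intro i x hx
    rw [pd_div (differentiableAt_const _) (differentiableAt_coord 1 x) (hy x hx), pd_const, pd_coord]
    fin_cases i <;> simp
  have wdiv : ∀ j (f f' : Plane → ℝ), LocallyIntegrableOn f (box A) → LocallyIntegrableOn f' (box A) →
      HasWeakPD j f f' (box A) → HasWeakPD j (fun x => f x / x 1)
        (fun x => f' x / x 1 - (if 1 = j then f x / x 1 ^ 2 else 0)) (box A) ∧
      LocallyIntegrableOn (fun x => f' x / x 1 - (if 1 = j then f x / x 1 ^ 2 else 0)) (box A) := by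
    intro j f f' lf lf' hf
    refine ⟨(hf.smooth_mul hV cI lf lf').congr_on' hV (fun x hx => by ring) fun x hx => ?_,
      ((lf.contDiffOn_mul hV (cI.pd (n := ∞) (m := ∞) hV (by simp) j)).add
        (lf'.contDiffOn_mul hV cI)).congr ?_⟩
    · rw [pdI j x hx]; split_ifs <;> ring
    · filter_upwards [ae_restrict_mem hV.measurableSet] with x hx
      simp only [Pi.add_apply]
      rw [pdI j x hx]; split_ifs <;> ring
  have ldiv : ∀ f : Plane → ℝ, LocallyIntegrableOn f (box A) →
      LocallyIntegrableOn (fun x => f x / x 1) (box A) := fun f lf => by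
    convert lf.contDiffOn_mul hV cI using 2 with x
    ring
  have E0 := wdiv 0 _ _ lu lr hu0
  have E1 := wdiv 1 _ _ lu (l2xp 1) hu1
  have D00 := wdiv 0 _ _ lr r0.2 r0.1
  have D10 := wdiv 1 _ _ lr r1.2 r1.1
  have luy := ldiv _ (ldiv _ lu)
  have D1 : ∀ j (p' : Plane → ℝ), LocallyIntegrableOn p' (box A) → HasWeakPD j p p' (box A) →
      ∀ u', LocallyIntegrableOn u' (box A) → HasWeakPD j u u' (box A) →
      HasWeakPD j (fun x => 2 * p x - u x / x 1 ^ 2) (fun x => 2 * p' x - (u' x / x 1 ^ 2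
        - (if 1 = j then 2 * u x / x 1 ^ 3 else 0))) (box A) ∧
      LocallyIntegrableOn (fun x => 2 * p' x - (u' x / x 1 ^ 2
        - (if 1 = j then 2 * u x / x 1 ^ 3 else 0))) (box A) := by
    intro j p' lp' hp' u' lu' hu'
    have w1 := wdiv j _ _ lu lu' hu'
    have w2 := wdiv j _ _ (ldiv _ lu) w1.2 w1.1
    have w3 := w2.1.smooth_mul hV (c := fun _ => (-1 : ℝ)) contDiffOn_const luy w2.2
    have w4 := hp'.smooth_mul hV c2 lp lp'
    simp only [pd_const, zero_mul, zero_add] at w3 w4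
    have l3 := w2.2.contDiffOn_mul hV (g := fun _ => (-1 : ℝ)) contDiffOn_const
    have l4 := lp'.contDiffOn_mul hV c2
    have w5 := w4.add (lp.contDiffOn_mul hV c2) l4
      (luy.contDiffOn_mul hV (g := fun _ => (-1 : ℝ)) contDiffOn_const) l3 w3
    have key : ∀ x ∈ box A, 2 * p' x + -1 * (((u' x / x 1 - if 1 = j then u x / x 1 ^ 2 else 0) / x 1 -
        if 1 = j then u x / x 1 / x 1 ^ 2 else 0)) = 2 * p' x - (u' x / x 1 ^ 2
        - (if 1 = j then 2 * u x / x 1 ^ 3 else 0)) := fun x hx => by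
      have := hy x hx
      split_ifs <;> field_simp <;> ring
    refine ⟨w5.congr_on' hV (fun x hx => ?_) key, (l4.add l3).congr ?_⟩
    · have := hy x hx
      field_simp
      ring
    · filter_upwards [ae_restrict_mem hV.measurableSet] with x hx
      exact key x hx
  have D01 := D1 0 _ (lTh 0 1) hp0 _ lr hu0
  have D11 := D1 1 _ (lTh 1 1) hp1 _ (l2xp 1) hu1
  refine ⟨box A, hV, fun i => ⟨by linarith, by linarith⟩, hVΩ, fun x => u x / x 1, ?_⟩
  rw [weakHessEq_iff hR hV hVh fun x hx => hG x (hVΩ hx)]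
  have hE1 : HasWeakPD 1 (fun x => u x / x 1) (fun x => 2 * p x - u x / x 1 ^ 2) (box A) ∧
      LocallyIntegrableOn (fun x => 2 * p x - u x / x 1 ^ 2) (box A) := by
    have key : ∀ x ∈ box A, 2 * (x 1 * p x) / x 1 - (if (1 : Fin 2) = 1 then u x / x 1 ^ 2 else 0) =
        2 * p x - u x / x 1 ^ 2 := fun x hx => by
      have := hy x hx
      simp
      field_simp
    refine ⟨E1.1.congr_on' hV (fun _ _ => rfl) key, E1.2.congr ?_⟩
    filter_upwards [ae_restrict_mem hV.measurableSet] with x hx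
    exact key x hx
  have hE0 : HasWeakPD 0 (fun x => u x / x 1) (fun x => (q x + 2 * (x 0 * p x)) / x 1) (box A) :=
    E0.1.congr_on' hV (fun _ _ => rfl) fun x _ => by simp
  -- The first derivatives of `u/y` are written out; the second derivatives are read off by
  -- unification from `D00`, `D01`, `D10`, `D11`.
  refine ⟨ldiv _ lu, ![fun x => (q x + 2 * (x 0 * p x)) / x 1, fun x => 2 * p x - u x / x 1 ^ 2],
    ![![_, _], ![_, _]], Fin.forall_fin_two.mpr ⟨⟨ldiv _ lr, hE0⟩, ⟨hE1.2, hE1.1⟩⟩,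
    Fin.forall_fin_two.mpr ⟨Fin.forall_fin_two.mpr ⟨⟨D00.2, D00.1⟩, ⟨D01.2, D01.1⟩⟩,
      Fin.forall_fin_two.mpr ⟨⟨D10.2, D10.1⟩, ⟨D11.2, D11.1⟩⟩⟩, fun i j => ?_⟩
  refine ae_restrict_of_forall_mem hV.measurableSet fun x hx => ?_
  have hx0 := hy x hx
  have hTx := hT x (hVΩ hx)
  fin_cases i <;> fin_cases j <;> simp [hypChr, hTx] <;> field_simp <;> ring

/-! ### The kernel of `∇d + R g` on the hyperbolic plane -/

theorem inCoord_apply (f : ℍ → ℝ) {x : Plane} (hx : x ∈ halfPlane) :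
    inCoord f x = f ⟨⟨x 0, x 1⟩, hx⟩ := by
  rw [inCoord, UpperHalfPlane.ofComplex_apply_of_im_pos (show 0 < (⟨x 0, x 1⟩ : ℂ).im from hx)]

theorem eq_of_inCoord_eqOn {f g : ℍ → ℝ} (h : EqOn (inCoord f) (inCoord g) halfPlane) : f = g := by
  ext z
  have hz : !₂[z.re, z.im] ∈ halfPlane := z.im_pos
  have := h hz
  rw [inCoord_apply f hz, inCoord_apply g hz] at this
  exact this

/-- The general element of the kernel, in coordinates. -/
noncomputable def kerComb (c : Fin 3 → ℝ) (x : Plane) : ℝ :=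
  (c 0 * x 0 + c 1 + c 2 * (x 0 ^ 2 + x 1 ^ 2)) / x 1

theorem inCoord_sum_kerFun (c : Fin 3 → ℝ) {x : Plane} (hx : x ∈ halfPlane) :
    inCoord (∑ j, c j • kerFun j) x = kerComb c x := by
  rw [inCoord_apply _ hx]
  simp only [Finset.sum_apply, Pi.smul_apply, Fin.sum_univ_three, kerFun, kerComb]
  change c 0 * (x 0 / x 1) + c 1 * (1 / x 1) + c 2 * ((x 0 ^ 2 + x 1 ^ 2) / x 1) = _
  ring

theorem contDiffOn_kerComb (c : Fin 3 → ℝ) {n : WithTop ℕ∞} : ContDiffOn ℝ n (kerComb c) halfPlane := by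
  have c0 := contDiff_coord 0 (n := n)
  have c1 := contDiff_coord 1 (n := n)
  exact (((contDiff_const.mul c0).add contDiff_const).add
    (contDiff_const.mul ((c0.pow 2).add (c1.pow 2)))).contDiffOn.div c1.contDiffOn
    fun x hx => ne_of_gt hx

section

variable {x : Plane}

theorem pd_kerComb (c : Fin 3 → ℝ) (hx : x ∈ halfPlane) :
    pd 0 (kerComb c) x = (c 0 + 2 * c 2 * x 0) / x 1 ∧
    pd 1 (kerComb c) x = c 2 - (c 0 * x 0 + c 1 + c 2 * x 0 ^ 2) / x 1 ^ 2 := by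
  have hx0 : x 1 ≠ 0 := ne_of_gt hx
  have d0 := differentiableAt_coord 0 x
  have d1 := differentiableAt_coord 1 x
  have e : kerComb c = fun x => (c 0 * x 0 + c 1 + c 2 * (x 0 ^ 2 + x 1 ^ 2)) / x 1 := rfl
  have dn : DifferentiableAt ℝ (fun x : Plane => c 0 * x 0 + c 1) x :=
    (d0.const_mul _).add_const _
  have dm : DifferentiableAt ℝ (fun x : Plane => c 2 * (x 0 ^ 2 + x 1 ^ 2)) x :=
    ((d0.fun_pow 2).fun_add (d1.fun_pow 2)).const_mul _
  have hpd : ∀ i, pd i (kerComb c) x = ((c 0 * pd i (fun x => x 0) x + c 2 *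
      (2 * x 0 * pd i (fun x => x 0) x + 2 * x 1 * pd i (fun x => x 1) x)) * x 1 -
      (c 0 * x 0 + c 1 + c 2 * (x 0 ^ 2 + x 1 ^ 2)) * pd i (fun x => x 1) x) / x 1 ^ 2 := fun i => by
    rw [e, pd_div (dn.fun_add dm) d1 hx0, pd_add dn dm, pd_add (d0.const_mul _) (differentiableAt_const _),
      pd_const_mul d0, pd_const, pd_const_mul ((d0.fun_pow 2).fun_add (d1.fun_pow 2)),
      pd_add (d0.fun_pow 2) (d1.fun_pow 2), pd_pow d0, pd_pow d1]
    simp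
  rw [hpd, hpd]
  simp only [pd_coord]
  constructor <;> (simp; field_simp) <;> ring

theorem hypHess_kerComb (c : Fin 3 → ℝ) (hx : x ∈ halfPlane) (i j : Fin 2) :
    hypHess (kerComb c) i j x = 0 := by
  have hx0 : x 1 ≠ 0 := ne_of_gt hx
  have d0 := differentiableAt_coord 0 x
  have d1 := differentiableAt_coord 1 x
  have hsq : x 1 ^ 2 ≠ 0 := pow_ne_zero _ hx0
  have h0 : ∀ i, pd i (pd 0 (kerComb c)) x = pd i (fun x => (c 0 + 2 * c 2 * x 0) / x 1) x :=
    fun i => pd_eq_of_eqOn isOpen_halfPlane (fun y hy => (pd_kerComb c hy).1) hx i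
  have h1 : ∀ i, pd i (pd 1 (kerComb c)) x =
      pd i (fun x => c 2 - (c 0 * x 0 + c 1 + c 2 * x 0 ^ 2) / x 1 ^ 2) x :=
    fun i => pd_eq_of_eqOn isOpen_halfPlane (fun y hy => (pd_kerComb c hy).2) hx i
  have dn : DifferentiableAt ℝ (fun x : Plane => c 0 + 2 * c 2 * x 0) x :=
    (d0.const_mul _).const_add _
  have da : DifferentiableAt ℝ (fun x : Plane => c 0 * x 0 + c 1) x := (d0.const_mul _).add_const _
  have db : DifferentiableAt ℝ (fun x : Plane => c 2 * x 0 ^ 2) x := (d0.fun_pow 2).const_mul _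
  simp only [pd_div dn d1 hx0, pd_add (differentiableAt_const _) (d0.const_mul _), pd_const,
    pd_const_mul d0] at h0
  simp only [pd_sub (differentiableAt_const _) (differentiableAt_fun_div (da.fun_add db)
    (d1.fun_pow 2) hsq), pd_const, pd_div (da.fun_add db) (d1.fun_pow 2) hsq, pd_pow d1,
    pd_add da db, pd_add (d0.const_mul _) (differentiableAt_const _), pd_const_mul d0,
    pd_const_mul (d0.fun_pow 2), pd_pow d0] at h1
  unfold hypHess
  have hk : kerComb c x = (c 0 * x 0 + c 1 + c 2 * (x 0 ^ 2 + x 1 ^ 2)) / x 1 := rfl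
  fin_cases i <;> fin_cases j <;>
    simp [h0, h1, hypChr, (pd_kerComb c hx).1, (pd_kerComb c hx).2, hk, pd_coord] <;>
    field_simp <;> ring

end

theorem convex_halfPlane : Convex ℝ halfPlane := by
  intro x hx y hy a b ha hb hab
  have hx' : 0 < x 1 := hx
  have hy' : 0 < y 1 := hy
  change 0 < a * x 1 + b * y 1
  rcases ha.eq_or_lt with rfl | ha
  · rw [zero_add] at hab; subst hab; linarith
  · have := mul_pos ha hx'
    have := mul_nonneg hb hy'.le
    linarith

theorem exists_eq_const_of_pd_eq_zero {f : Plane → ℝ} (hd : ∀ x ∈ halfPlane, DifferentiableAt ℝ f x)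
    (h : ∀ x ∈ halfPlane, ∀ i, pd i f x = 0) : ∃ c, ∀ x ∈ halfPlane, f x = c := by
  have hne : !₂[(0 : ℝ), 1] ∈ halfPlane := by simp [halfPlane]
  refine ⟨f !₂[0, 1], fun x hx => ?_⟩
  refine isOpen_halfPlane.is_const_of_fderiv_eq_zero convex_halfPlane.isPreconnected
    (fun y hy => (hd y hy).differentiableWithinAt) (fun y hy => ?_) hx hne
  ext v
  rw [fderiv_apply_eq_pd, h y hy, h y hy]; simp

/-- A solution has three first integrals, found one after the other. Each involves at most first
derivatives of `E`, so `C²` regularity suffices. -/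
theorem mem_hessKernel_iff {R : ℝ} (hR : R < 0) (E : ℍ → ℝ) :
    E ∈ hessKernel R ↔ ∃ c : Fin 3 → ℝ, E = ∑ j, c j • kerFun j := by
  have heq := fun (E : Plane → ℝ) (i j) (x) (hx : x ∈ halfPlane) =>
    hess_eq hR isOpen_halfPlane subset_rfl (fun _ _ => rfl) hx E i j
  constructor
  · rintro ⟨hE, hz⟩
    set F := inCoord E
    have hz' : ∀ x ∈ halfPlane, ∀ i j, hypHess F i j x = 0 := fun x hx i j => by
      rw [← hz x hx i j, heq F i j x hx, hypHess]
    have c1 : ∀ i, ContDiffOn ℝ 1 (pd i F) halfPlane := fun i =>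
      hE.pd isOpen_halfPlane (by norm_num) i
    have dF : ∀ x ∈ halfPlane, DifferentiableAt ℝ F x := fun x hx =>
      (hE.contDiffAt (isOpen_halfPlane.mem_nhds hx)).differentiableAt (by norm_num)
    have dD : ∀ i, ∀ x ∈ halfPlane, DifferentiableAt ℝ (pd i F) x := fun i x hx =>
      ((c1 i).contDiffAt (isOpen_halfPlane.mem_nhds hx)).differentiableAt (by norm_num)
    have d0 := differentiableAt_coord 0
    have d1 := differentiableAt_coord 1
    have hy : ∀ x ∈ halfPlane, x 1 ≠ 0 := fun x hx => ne_of_gt hx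
    have dq : ∀ x ∈ halfPlane, DifferentiableAt ℝ (fun x => F x / x 1) x := fun x hx =>
      differentiableAt_fun_div (dF x hx) (d1 x) (hy x hx)
    have dp : ∀ x ∈ halfPlane, DifferentiableAt ℝ (fun x => F x / x 1 + pd 1 F x) x := fun x hx =>
      (dq x hx).fun_add (dD 1 x hx)
    -- `E/y + ∂₁E`, which is twice the `p` of the general system, is constant by the entries `01`
    -- and `11`.
    obtain ⟨P, hP⟩ := exists_eq_const_of_pd_eq_zero dp (fun x hx i => by
      have hx0 := hy x hx
      have h01 := hz' x hx 0 1
      have h11 := hz' x hx 1 1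
      rw [hypHess_zero_one] at h01
      rw [hypHess_one_one] at h11
      rw [pd_add (dq x hx) (dD 1 x hx), pd_div (dF x hx) (d1 x) hx0, pd_coord]
      fin_cases i
      · simp only [Fin.isValue, Fin.zero_eta, one_ne_zero, if_false]
        have : pd 0 (pd 1 F) x = - (pd 0 F x / x 1) := by linarith
        rw [this]; field_simp; ring
      · simp only [Fin.isValue, Fin.mk_one, if_true]
        have : pd 1 (pd 1 F) x = F x / x 1 ^ 2 - pd 1 F x / x 1 := by linarith
        rw [this]; field_simp; ring)
    obtain ⟨Q, hQ⟩ := exists_eq_const_of_pd_eq_zero (f := fun x => x 1 * pd 0 F x - P * x 0)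
      (fun x hx => ((d1 x).fun_mul (dD 0 x hx)).fun_sub ((d0 x).const_mul P)) (fun x hx i => by
      have hx0 := hy x hx
      have h00 := hz' x hx 0 0
      have h10 := hz' x hx 1 0
      have hp := hP x hx
      rw [hypHess_zero_zero] at h00
      rw [hypHess_one_zero] at h10
      rw [pd_sub ((d1 x).fun_mul (dD 0 x hx)) ((d0 x).const_mul P), pd_mul (d1 x) (dD 0 x hx),
        pd_const_mul (d0 x), pd_coord, pd_coord]
      fin_cases i
      · simp only [Fin.isValue, Fin.zero_eta, one_ne_zero, if_false, if_true]
        have : pd 0 (pd 0 F) x = pd 1 F x / x 1 + F x / x 1 ^ 2 := by linarith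
        rw [this, ← hp]; field_simp; ring
      · simp only [Fin.isValue, Fin.mk_one, if_true, zero_ne_one, if_false]
        have : pd 1 (pd 0 F) x = - (pd 0 F x / x 1) := by linarith
        rw [this]; field_simp; ring)
    have du : ∀ x ∈ halfPlane, DifferentiableAt ℝ
        (fun x : Plane => Q * x 0 + P / 2 * (x 0 ^ 2 + x 1 ^ 2)) x := fun x _ =>
      ((d0 x).const_mul Q).fun_add ((((d0 x).fun_pow 2).fun_add ((d1 x).fun_pow 2)).const_mul _)
    -- With `P` and `Q` constant, `d(yE) = (Q + Px) dx + Py dy` has the explicit quadratic primitive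
    -- subtracted here.
    obtain ⟨C, hC⟩ := exists_eq_const_of_pd_eq_zero
      (f := fun x => x 1 * F x - (Q * x 0 + P / 2 * (x 0 ^ 2 + x 1 ^ 2)))
      (fun x hx => ((d1 x).fun_mul (dF x hx)).fun_sub (du x hx)) (fun x hx i => by
      have hx0 := hy x hx
      have hp := hP x hx
      have hq := hQ x hx
      rw [pd_sub ((d1 x).fun_mul (dF x hx)) (du x hx), pd_mul (d1 x) (dF x hx),
        pd_add ((d0 x).const_mul Q) ((((d0 x).fun_pow 2).fun_add ((d1 x).fun_pow 2)).const_mul _),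
        pd_const_mul (d0 x), pd_const_mul (((d0 x).fun_pow 2).fun_add ((d1 x).fun_pow 2)),
        pd_add ((d0 x).fun_pow 2) ((d1 x).fun_pow 2), pd_pow (d0 x), pd_pow (d1 x), pd_coord, pd_coord]
      fin_cases i
      · simp only [Fin.isValue, Fin.zero_eta, one_ne_zero, if_false, if_true]
        rw [← hq]; norm_num; ring
      · simp only [Fin.isValue, Fin.mk_one, if_true, zero_ne_one, if_false]
        rw [← hp]; norm_num; field_simp; ring)
    refine ⟨![Q, C, P / 2], eq_of_inCoord_eqOn fun x hx => ?_⟩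
    have hx0 := hy x hx
    rw [inCoord_sum_kerFun _ hx, kerComb]
    have := hC x hx
    simp
    field_simp
    linarith
  · rintro ⟨c, rfl⟩
    have e : EqOn (inCoord (∑ j, c j • kerFun j)) (kerComb c) halfPlane := fun x hx =>
      inCoord_sum_kerFun c hx
    refine ⟨(contDiffOn_kerComb c).congr e, fun x hx i j => ?_⟩
    have e1 : ∀ i, EqOn (pd i (inCoord (∑ j, c j • kerFun j))) (pd i (kerComb c)) halfPlane :=
      fun i x hx => pd_eq_of_eqOn isOpen_halfPlane e hx i
    rw [heq _ i j x hx, pd_eq_of_eqOn isOpen_halfPlane (e1 j) hx i, e hx]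
    simp only [fun k => e1 k hx]
    exact hypHess_kerComb c hx i j

theorem hessKernel_eq {R : ℝ} (hR : R < 0) :
    hessKernel R = (Submodule.span ℝ (Set.range kerFun) : Set (ℍ → ℝ)) := by
  ext E
  rw [mem_hessKernel_iff hR, SetLike.mem_coe, Submodule.mem_span_range_iff_exists_fun]
  exact exists_congr fun c => eq_comm

theorem linearIndependent_kerFun : LinearIndependent ℝ kerFun := by
  rw [Fintype.linearIndependent_iff]
  intro c hc
  have key : ∀ x ∈ halfPlane, kerComb c x = 0 := fun x hx => by
    rw [← inCoord_sum_kerFun c hx, hc]; rfl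
  have h1 := key !₂[0, 1] (by simp [halfPlane])
  have h2 := key !₂[0, 2] (by simp [halfPlane])
  have h3 := key !₂[1, 1] (by simp [halfPlane])
  simp [kerComb] at h1 h2 h3
  intro i
  fin_cases i <;> simp <;> linarith

theorem finrank_span_kerFun : Module.finrank ℝ (Submodule.span ℝ (Set.range kerFun)) = 3 := by
  rw [finrank_span_eq_card linearIndependent_kerFun]; simp

/-- Boxes may be unbounded, so constancy of functions with zero weak derivatives holds on the half
plane at once, without gluing. -/
theorem halfPlane_eq_box : halfPlane = box ![univ, Ioi 0] := by
  ext x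
  simp [halfPlane, box]

theorem weakHessKernel_eq {R : ℝ} (hR : R < 0) :
    weakHessKernel R = {E | ∃ k ∈ hessKernel R,
      inCoord E =ᵐ[volume.restrict halfPlane] inCoord k} := by
  have hV := isOpen_halfPlane
  have hm := hV.measurableSet
  ext E
  constructor
  · intro h
    obtain ⟨p, q, lp, lq, hp0, hp1, hq0, hq1, hu0, hu1⟩ :=
      WeakHessEq.exists_first_order hR hV subset_rfl (fun _ _ => rfl) (fun _ _ => rfl) h
    have hconst : ∀ f : Plane → ℝ, LocallyIntegrableOn f halfPlane →
        HasWeakPD 0 f (fun _ => 0) halfPlane → HasWeakPD 1 f (fun _ => 0) halfPlane →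
        ∃ c, ∀ᵐ x ∂(volume.restrict halfPlane), f x = c := by
      rw [halfPlane_eq_box]
      intro f hf h0 h1
      exact exists_ae_eq_const_of_hasWeakPD_zero (Fin.forall_fin_two.mpr ⟨isOpen_univ, isOpen_Ioi⟩)
        (Fin.forall_fin_two.mpr ⟨ordConnected_univ, ordConnected_Ioi⟩)
        (Fin.forall_fin_two.mpr ⟨univ_nonempty, nonempty_Ioi⟩) hf (Fin.forall_fin_two.mpr ⟨h0, h1⟩)
    obtain ⟨P, hP⟩ := hconst p lp (by simpa using hp0) (by simpa using hp1)
    obtain ⟨Q, hQ⟩ := hconst q lq (by simpa using hq0) (by simpa using hq1)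
    -- With `p = P` and `q = Q`, `-s` is a primitive of `d(yE)`, so `yE + s` has zero weak
    -- derivatives.
    set s : Plane → ℝ := fun x => -Q * x 0 + -P * (x 0 ^ 2 + x 1 ^ 2)
    have hs : ContDiff ℝ ∞ s := (contDiff_const.mul (contDiff_coord 0)).add
      (contDiff_const.mul (((contDiff_coord 0).pow 2).add ((contDiff_coord 1).pow 2)))
    have pds : ∀ i x, pd i s x = -Q * (if 0 = i then 1 else 0) + -P *
        (2 * x 0 * (if 0 = i then 1 else 0) + 2 * x 1 * (if 1 = i then 1 else 0)) := fun i x => by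
      have d0 := differentiableAt_coord 0 x
      have d1 := differentiableAt_coord 1 x
      rw [pd_add (d0.const_mul _) (((d0.fun_pow 2).fun_add (d1.fun_pow 2)).const_mul _),
        pd_const_mul d0, pd_const_mul ((d0.fun_pow 2).fun_add (d1.fun_pow 2)),
        pd_add (d0.fun_pow 2) (d1.fun_pow 2), pd_pow d0, pd_pow d1, pd_coord, pd_coord]
      simp
    have lin : ∀ {f : Plane → ℝ}, Continuous f → LocallyIntegrableOn f halfPlane := fun hf =>
      hf.locallyIntegrable.locallyIntegrableOn _
    have cX : ∀ i, ContDiffOn ℝ ∞ (fun x : Plane => x i) halfPlane := fun i =>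
      (contDiff_coord i).contDiffOn
    have c2 : ContDiffOn ℝ ∞ (fun _ : Plane => (2 : ℝ)) halfPlane := contDiffOn_const
    have lE : LocallyIntegrableOn (inCoord E) halfPlane := h.1
    have lu := lE.contDiffOn_mul hV (cX 1)
    have ls := lin hs.continuous
    have lps := fun i => lin (hs.pd (m := 0) (by simp) i).continuous
    have w0 := hu0.add lu (lq.add ((lp.contDiffOn_mul hV (cX 0)).contDiffOn_mul hV c2)) ls (lps 0)
      (HasWeakPD.of_contDiffOn hV hs.contDiffOn 0)
    have w1 := hu1.add lu ((lp.contDiffOn_mul hV (cX 1)).contDiffOn_mul hV c2) ls (lps 1)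
      (HasWeakPD.of_contDiffOn hV hs.contDiffOn 1)
    obtain ⟨C, hC⟩ := hconst _ (lu.add ls) (w0.congr_on hV (fun _ _ => rfl) (by
        filter_upwards [hP, hQ] with x h1 h2
        simp only [Pi.add_apply]
        rw [pds, h1, h2]; simp; ring)) (w1.congr_on hV (fun _ _ => rfl) (by
        filter_upwards [hP] with x h1
        rw [pds, h1]; simp; ring))
    refine ⟨_, (mem_hessKernel_iff hR _).mpr ⟨![Q, C, P], rfl⟩, ?_⟩
    filter_upwards [hC, ae_restrict_mem hm] with x h1 hx
    have hx0 : x 1 ≠ 0 := ne_of_gt hx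
    rw [inCoord_sum_kerFun _ hx, kerComb]
    simp only [Pi.add_apply, s] at h1
    simp
    field_simp
    linarith
  · rintro ⟨k, hk, hEk⟩
    obtain ⟨c, rfl⟩ := (mem_hessKernel_iff hR _).mp hk
    have hE : ∀ᵐ x ∂(volume.restrict halfPlane), kerComb c x = inCoord E x := by
      filter_upwards [hEk, ae_restrict_mem hm] with x h1 hx
      rw [h1, inCoord_sum_kerFun _ hx]
    have c0 : ContDiffOn ℝ ∞ (kerComb c) halfPlane := contDiffOn_kerComb c
    have c1 := fun i => c0.pd (m := ∞) hV (by simp) i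
    have c2 := fun i j => (c1 j).pd (m := ∞) hV (by simp) i
    have li : ∀ {f : Plane → ℝ}, ContDiffOn ℝ ∞ f halfPlane → LocallyIntegrableOn f halfPlane :=
      fun hf => hf.continuousOn.locallyIntegrableOn hm
    refine (weakHessEq_iff hR hV subset_rfl (fun _ _ => rfl)).mpr ⟨(li c0).congr hE,
      fun i => pd i (kerComb c), fun i j => pd i (pd j (kerComb c)), fun i => ⟨li (c1 i),
        (HasWeakPD.of_contDiffOn hV c0 i).congr_ae hE (Filter.Eventually.of_forall fun _ => rfl)⟩,
      fun i j => ⟨li (c2 i j), HasWeakPD.of_contDiffOn hV (c1 j) i⟩, fun i j => ?_⟩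
    filter_upwards [hE, ae_restrict_mem hm] with x h1 hx
    have := hypHess_kerComb c hx i j
    rw [hypHess] at this
    rw [← h1, this]; rfl

/-! ### Killing fields of the hyperbolic plane -/

/-- The general linear combination of the fields `killingField j`. -/
noncomputable def killComb (c : Fin 3 → ℝ) (x : Plane) : Plane := ∑ j, c j • killingField j x

theorem killComb_zero (c : Fin 3 → ℝ) (x : Plane) :
    killComb c x 0 = c 0 * x 0 + c 1 + c 2 * (x 0 ^ 2 - x 1 ^ 2) := by
  simp [killComb, Fin.sum_univ_three, killingField]

theorem killComb_one (c : Fin 3 → ℝ) (x : Plane) :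
    killComb c x 1 = c 0 * x 1 + 2 * c 2 * x 0 * x 1 := by
  simp [killComb, Fin.sum_univ_three, killingField]; ring

theorem plane_ext {v w : Plane} (h0 : v 0 = w 0) (h1 : v 1 = w 1) : v = w := by
  ext i; fin_cases i <;> assumption

theorem smul_killComb (t : ℝ) (c : Fin 3 → ℝ) (x : Plane) : t • killComb c x = killComb (t • c) x := by
  simp [killComb, Finset.smul_sum, smul_smul]

theorem killComb_single (j : Fin 3) (x : Plane) : killComb (Pi.single j 1) x = killingField j x := by
  simp [killComb, Pi.single_apply]

theorem killComb_injective {c d : Fin 3 → ℝ} (h : ∀ x ∈ halfPlane, killComb c x = killComb d x) :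
    c = d := by
  have h1 := h !₂[0, 1] (by simp [halfPlane])
  have h2 := h !₂[0, 2] (by simp [halfPlane])
  have e0 := congrArg (fun v : Plane => v 0) h1
  have e1 := congrArg (fun v : Plane => v 1) h1
  have e2 := congrArg (fun v : Plane => v 0) h2
  simp only [killComb_zero, killComb_one] at e0 e1 e2
  simp at e0 e1 e2
  ext i
  fin_cases i <;> simp <;> linarith

/-- The Killing equations in coordinates. -/
theorem isKilling_iff_pd {R : ℝ} (hR : R < 0) {W : Plane → Plane} :
    IsKilling R W ↔ ContDiffOn ℝ ∞ W halfPlane ∧ ∀ x ∈ halfPlane,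
      pd 0 (fun y => W y 0) x = W x 1 / x 1 ∧ pd 1 (fun y => W y 1) x = W x 1 / x 1 ∧
      pd 0 (fun y => W y 1) x + pd 1 (fun y => W y 0) x = 0 := by
  have hR0 : R ≠ 0 := by linarith
  refine and_congr_right fun _ => forall₂_congr fun x hx => ?_
  have hx0 : x 1 ≠ 0 := ne_of_gt hx
  simp only [pd_hypMetric hR hx]
  simp only [Fin.sum_univ_two, Fin.forall_fin_two, hypMetric_apply]
  simp
  field_simp
  constructor
  · rintro ⟨⟨h1, h2⟩, h3, h4⟩
    exact ⟨by linarith, by linarith, by linarith⟩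
  · rintro ⟨h1, h2, h3⟩
    exact ⟨⟨by linarith, by linarith⟩, by linarith, by linarith⟩

theorem contDiffOn_plane {W : Plane → Plane} {Ω : Set Plane} {n : WithTop ℕ∞} :
    ContDiffOn ℝ n W Ω ↔ ∀ i, ContDiffOn ℝ n (fun x => W x i) Ω := contDiffOn_euclidean

/-- For `W = (X, Y)` and `Z = Y/y` the Killing equations read `∂₁Z = 0`, `∂₀X = Z`, `∂₁X = -y ∂₀Z`.
Equality of the mixed derivatives of `X` forces `∂₀∂₀Z = 0`, so `Z` is affine in `x` and `X` follows
by integration. -/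
theorem isKilling_iff {R : ℝ} (hR : R < 0) {W : Plane → Plane} :
    IsKilling R W ↔ ∃ c, ∀ x ∈ halfPlane, W x = killComb c x := by
  have hV := isOpen_halfPlane
  have d0 := differentiableAt_coord 0
  have d1 := differentiableAt_coord 1
  rw [isKilling_iff_pd hR]
  constructor
  · rintro ⟨hW, hK⟩
    rw [contDiffOn_plane] at hW
    set X : Plane → ℝ := fun x => W x 0
    set Y : Plane → ℝ := fun x => W x 1
    have hy : ∀ x ∈ halfPlane, x 1 ≠ 0 := fun x hx => ne_of_gt hx
    have dX := fun x (hx : x ∈ halfPlane) => (hW 0).differentiableAt_of_isOpen hV hx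
    have dY := fun x (hx : x ∈ halfPlane) => (hW 1).differentiableAt_of_isOpen hV hx
    set Z : Plane → ℝ := fun x => Y x / x 1
    have hZ : ContDiffOn ℝ ∞ Z halfPlane := (hW 1).div (contDiff_coord 1).contDiffOn hy
    have dZ := fun x (hx : x ∈ halfPlane) => hZ.differentiableAt_of_isOpen hV hx
    have hZ' := hZ.pd (m := ∞) hV (by simp) 0
    have dZ' := fun x (hx : x ∈ halfPlane) => hZ'.differentiableAt_of_isOpen hV hx
    have Z1 : ∀ x ∈ halfPlane, pd 1 Z x = 0 := fun x hx => by
      have := hy x hx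
      rw [pd_div (dY x hx) (d1 x) this, (hK x hx).2.1, pd_coord]
      simp only [Fin.isValue, if_true]
      field_simp; ring
    have Z0 : ∀ x ∈ halfPlane, pd 0 Z x = pd 0 Y x / x 1 := fun x hx => by
      have := hy x hx
      rw [pd_div (dY x hx) (d1 x) this, pd_coord]
      simp only [Fin.isValue, one_ne_zero, if_false]
      field_simp; ring
    have X0 : ∀ x ∈ halfPlane, pd 0 X x = Z x := fun x hx => (hK x hx).1
    have X1 : ∀ x ∈ halfPlane, pd 1 X x = - (x 1 * pd 0 Z x) := fun x hx => by
      have := hy x hx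
      rw [Z0 x hx]
      have := (hK x hx).2.2
      field_simp
      linarith
    have Z01 : ∀ x ∈ halfPlane, pd 1 (pd 0 Z) x = 0 := fun x hx => by
      rw [pd_pd_comm hV (hZ.of_le two_le_infty) hx, pd_eq_of_eqOn hV (g := fun _ => 0) Z1 hx, pd_const]
    have Z00 : ∀ x ∈ halfPlane, pd 0 (pd 0 Z) x = 0 := fun x hx => by
      have e := pd_pd_comm hV ((hW 0).of_le two_le_infty) hx 0 1
      rw [pd_eq_of_eqOn hV X1 hx, pd_eq_of_eqOn hV X0 hx, Z1 x hx, pd_neg,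
        pd_mul (d1 x) (dZ' x hx), pd_coord] at e
      simp at e
      exact e.resolve_left (hy x hx)
    obtain ⟨C, hC⟩ := exists_eq_const_of_pd_eq_zero dZ'
      (fun x hx => Fin.forall_fin_two.mpr ⟨Z00 x hx, Z01 x hx⟩)
    obtain ⟨B, hB⟩ := exists_eq_const_of_pd_eq_zero (f := fun x => Z x - C * x 0)
      (fun x hx => (dZ x hx).fun_sub ((d0 x).const_mul C)) (fun x hx => by
        rw [Fin.forall_fin_two, pd_sub (dZ x hx) ((d0 x).const_mul C),
          pd_sub (dZ x hx) ((d0 x).const_mul C), pd_const_mul (d0 x), pd_const_mul (d0 x),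
          pd_coord, pd_coord, Z1 x hx, hC x hx]
        simp)
    have dq : ∀ x, DifferentiableAt ℝ (fun x : Plane => x 0 ^ 2 - x 1 ^ 2) x := fun x =>
      ((d0 x).fun_pow 2).fun_sub ((d1 x).fun_pow 2)
    have dl : ∀ x, DifferentiableAt ℝ (fun x : Plane => B * x 0 + C / 2 * (x 0 ^ 2 - x 1 ^ 2)) x :=
      fun x => ((d0 x).const_mul B).fun_add ((dq x).const_mul _)
    obtain ⟨A, hA⟩ := exists_eq_const_of_pd_eq_zero
      (f := fun x => X x - (B * x 0 + C / 2 * (x 0 ^ 2 - x 1 ^ 2)))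
      (fun x hx => (dX x hx).fun_sub (dl x)) (fun x hx i => by
        have hB' := hB x hx
        rw [pd_sub (dX x hx) (dl x), pd_add ((d0 x).const_mul B) ((dq x).const_mul _),
          pd_const_mul (d0 x), pd_const_mul (dq x), pd_sub ((d0 x).fun_pow 2) ((d1 x).fun_pow 2),
          pd_pow (d0 x), pd_pow (d1 x), pd_coord, pd_coord]
        fin_cases i
        · simp only [Fin.isValue, Fin.zero_eta, one_ne_zero, if_false, if_true]
          rw [X0 x hx, ← hB']; norm_num; ring
        · simp only [Fin.isValue, Fin.mk_one, if_true, zero_ne_one, if_false]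
          rw [X1 x hx, hC x hx]; norm_num; ring)
    refine ⟨![B, A, C / 2], fun x hx => plane_ext ?_ ?_⟩
    · rw [killComb_zero]
      have := hA x hx
      simp only [X] at this
      simp
      linarith
    · rw [killComb_one]
      have := hB x hx
      have hx0 := hy x hx
      have hZY : W x 1 = x 1 * Z x := by simp only [Z, Y]; field_simp
      rw [hZY, ← this]
      simp
      ring
  · rintro ⟨c, hc⟩
    have e0 : EqOn (fun x => W x 0) (fun x => c 0 * x 0 + c 1 + c 2 * (x 0 ^ 2 - x 1 ^ 2)) halfPlane :=
      fun x hx => by simp only [hc x hx, killComb_zero]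
    have e1 : EqOn (fun x => W x 1) (fun x => c 0 * x 1 + 2 * c 2 * (x 0 * x 1)) halfPlane :=
      fun x hx => by simp only [hc x hx, killComb_one]; ring
    have s0 := contDiff_coord 0 (n := ∞)
    have s1 := contDiff_coord 1 (n := ∞)
    constructor
    · rw [contDiffOn_plane]
      refine Fin.forall_fin_two.mpr ⟨?_, ?_⟩
      · exact (((contDiff_const.mul s0).add contDiff_const).add
          (contDiff_const.mul ((s0.pow 2).sub (s1.pow 2)))).contDiffOn.congr e0
      · exact ((contDiff_const.mul s1).add (contDiff_const.mul (s0.mul s1))).contDiffOn.congr e1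
    · intro x hx
      have hx0 : x 1 ≠ 0 := ne_of_gt hx
      have e1' := e1 hx
      simp only at e1'
      simp only [pd_eq_of_eqOn hV e0 hx, pd_eq_of_eqOn hV e1 hx, e1']
      have a0 : ∀ i, pd i (fun x : Plane => c 0 * x 0 + c 1 + c 2 * (x 0 ^ 2 - x 1 ^ 2)) x =
          c 0 * (if 0 = i then 1 else 0) + c 2 * (2 * x 0 * (if 0 = i then 1 else 0) -
            2 * x 1 * (if 1 = i then 1 else 0)) := fun i => by
        rw [pd_add (((d0 x).const_mul _).add_const _)
          ((((d0 x).fun_pow 2).fun_sub ((d1 x).fun_pow 2)).const_mul _),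
          pd_add ((d0 x).const_mul _) (differentiableAt_const _), pd_const_mul (d0 x), pd_const,
          pd_const_mul (((d0 x).fun_pow 2).fun_sub ((d1 x).fun_pow 2)),
          pd_sub ((d0 x).fun_pow 2) ((d1 x).fun_pow 2), pd_pow (d0 x), pd_pow (d1 x), pd_coord, pd_coord]
        simp
      have a1 : ∀ i, pd i (fun x : Plane => c 0 * x 1 + 2 * c 2 * (x 0 * x 1)) x =
          c 0 * (if 1 = i then 1 else 0) + 2 * c 2 * ((if 0 = i then 1 else 0) * x 1 +
            x 0 * (if 1 = i then 1 else 0)) := fun i => by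
        rw [pd_add ((d1 x).const_mul _) (((d0 x).fun_mul (d1 x)).const_mul _), pd_const_mul (d1 x),
          pd_const_mul ((d0 x).fun_mul (d1 x)), pd_mul (d0 x) (d1 x), pd_coord, pd_coord]
      simp only [a0, a1]
      refine ⟨?_, ?_, ?_⟩ <;> (simp; field_simp) <;> ring

/-! ### Hamiltonians of the Killing fields -/

theorem fderiv_inCoord_sum_kerFun (c : Fin 3 → ℝ) {x : Plane} (hx : x ∈ halfPlane) (v : Plane) :
    fderiv ℝ (inCoord (∑ j, c j • kerFun j)) x v = v 0 * ((c 0 + 2 * c 2 * x 0) / x 1) +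
      v 1 * (c 2 - (c 0 * x 0 + c 1 + c 2 * x 0 ^ 2) / x 1 ^ 2) := by
  have e : ∀ i, pd i (inCoord (∑ j, c j • kerFun j)) x = pd i (kerComb c) x := fun i =>
    pd_eq_of_eqOn isOpen_halfPlane (fun x hx => inCoord_sum_kerFun c hx) hx i
  rw [fderiv_apply_eq_pd, e, e, (pd_kerComb c hx).1, (pd_kerComb c hx).2]

/-- The factor `R` in the field cancels the one in the area density `1 / (-R y²)`. -/
theorem isHamiltonian_sum_kerFun {R : ℝ} (hR : R < 0) (c : Fin 3 → ℝ) {W : Plane → Plane}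
    (hW : ∀ x ∈ halfPlane, W x = R • killComb c x) : IsHamiltonian R (∑ j, c j • kerFun j) W := by
  refine ⟨(contDiffOn_kerComb c).congr fun x hx => inCoord_sum_kerFun c hx, fun x hx v => ?_⟩
  have hx0 : x 1 ≠ 0 := ne_of_gt hx
  have hR0 : R ≠ 0 := by linarith
  rw [fderiv_inCoord_sum_kerFun c hx, volDensity_hypMetric hR hx, hW x hx]
  simp only [PiLp.smul_apply, killComb_zero, killComb_one, smul_eq_mul]
  field_simp
  ring

theorem isHamiltonian_smul_sum_kerFun {R : ℝ} (hR : R < 0) (c : Fin 3 → ℝ) {W : Plane → Plane}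
    (hW : ∀ x ∈ halfPlane, W x = killComb c x) : IsHamiltonian R (∑ j, (R⁻¹ • c) j • kerFun j) W := by
  refine isHamiltonian_sum_kerFun hR _ fun x hx => ?_
  rw [hW x hx, smul_killComb, smul_smul, mul_inv_cancel₀ hR.ne, one_smul]

/-- Hamiltonians of one field have equal differentials on the half plane, and no nonzero kernel
function is constant. Three values of the differential already determine the coefficients. -/
theorem IsHamiltonian.coeff_unique {R : ℝ} {c d : Fin 3 → ℝ} {W : Plane → Plane}
    (hc : IsHamiltonian R (∑ j, c j • kerFun j) W) (hd : IsHamiltonian R (∑ j, d j • kerFun j) W) :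
    c = d := by
  have key : ∀ x ∈ halfPlane, ∀ v, _ := fun x hx v => (hc.2 x hx v).symm.trans (hd.2 x hx v)
  have hp1 : !₂[(0 : ℝ), 1] ∈ halfPlane := by simp [halfPlane]
  have hp2 : !₂[(0 : ℝ), 2] ∈ halfPlane := by simp [halfPlane]
  have h1 := key _ hp1 !₂[1, 0]
  have h2 := key _ hp1 !₂[0, 1]
  have h3 := key _ hp2 !₂[0, 1]
  rw [fderiv_inCoord_sum_kerFun c hp1, fderiv_inCoord_sum_kerFun d hp1] at h1 h2
  rw [fderiv_inCoord_sum_kerFun c hp2, fderiv_inCoord_sum_kerFun d hp2] at h3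
  simp at h1 h2 h3
  ext i
  fin_cases i <;> simp <;> linarith

theorem existsUnique_hamiltonian {R : ℝ} (hR : R < 0) {W : Plane → Plane} (hW : IsKilling R W) :
    ∃! k : ℍ → ℝ, k ∈ hessKernel R ∧ IsHamiltonian R k W := by
  obtain ⟨c, hc⟩ := (isKilling_iff hR).mp hW
  have h := isHamiltonian_smul_sum_kerFun hR c hc
  refine ⟨_, ⟨(mem_hessKernel_iff hR _).mpr ⟨_, rfl⟩, h⟩, ?_⟩
  rintro k ⟨hk, hkW⟩
  obtain ⟨d, rfl⟩ := (mem_hessKernel_iff hR _).mp hk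
  rw [hkW.coeff_unique h]

theorem exists_isKilling_isHamiltonian {R : ℝ} (hR : R < 0) {k : ℍ → ℝ} (hk : k ∈ hessKernel R) :
    ∃ W, IsKilling R W ∧ IsHamiltonian R k W := by
  obtain ⟨c, rfl⟩ := (mem_hessKernel_iff hR _).mp hk
  exact ⟨fun x => R • killComb c x, (isKilling_iff hR).mpr ⟨R • c, fun x _ => smul_killComb R c x⟩,
    isHamiltonian_sum_kerFun hR c fun _ _ => rfl⟩

theorem isKilling_killingField {R : ℝ} (hR : R < 0) (j : Fin 3) : IsKilling R (killingField j) ∧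
    IsHamiltonian R (kerFun j) (fun x => R • killingField j x) := by
  refine ⟨(isKilling_iff hR).mpr ⟨Pi.single j 1, fun x _ => (killComb_single j x).symm⟩, ?_⟩
  have := isHamiltonian_sum_kerFun hR (Pi.single j 1) (W := fun x => R • killingField j x)
    fun x _ => by rw [killComb_single]
  simpa [Pi.single_apply] using this

/-! ### The Lie algebra `so(2,1)` -/

theorem mem_so21_iff (A : Matrix (Fin 2 ⊕ Fin 1) (Fin 2 ⊕ Fin 1) ℝ) :
    A ∈ so21 ↔ Aᵀ * LieAlgebra.Orthogonal.indefiniteDiagonal (Fin 2) (Fin 1) ℝ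
      = LieAlgebra.Orthogonal.indefiniteDiagonal (Fin 2) (Fin 1) ℝ * (-A) :=
  mem_skewAdjointMatricesSubmodule _ A

/-- The matrix whose generator is `killComb c`. -/
def genMat (c : Fin 3 → ℝ) : Matrix (Fin 2 ⊕ Fin 1) (Fin 2 ⊕ Fin 1) ℝ :=
  Matrix.fromBlocks !![0, -(c 1 + c 2); c 1 + c 2, 0] !![c 1 - c 2; c 0] !![c 1 - c 2, c 0] !![0]

theorem genMat_mem (c : Fin 3 → ℝ) : genMat c ∈ so21 := by
  rw [mem_so21_iff, LieAlgebra.Orthogonal.indefiniteDiagonal]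
  ext i j
  rw [Matrix.mul_diagonal, Matrix.diagonal_mul]
  rcases i with i | i <;> rcases j with j | j <;> fin_cases i <;> fin_cases j <;> simp [genMat]

/-- The coordinates of an element of `so(2,1)` with respect to the generators of `killingField j`. -/
noncomputable def soCoord : so21 →ₗ[ℝ] (Fin 3 → ℝ) where
  toFun A := ![A.1 (Sum.inl 1) (Sum.inr 0),
    (A.1 (Sum.inl 1) (Sum.inl 0) + A.1 (Sum.inl 0) (Sum.inr 0)) / 2,
    (A.1 (Sum.inl 1) (Sum.inl 0) - A.1 (Sum.inl 0) (Sum.inr 0)) / 2]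
  map_add' A B := by ext i; fin_cases i <;> simp <;> ring
  map_smul' t A := by ext i; fin_cases i <;> simp <;> ring

theorem soCoord_genMat (c : Fin 3 → ℝ) : soCoord ⟨genMat c, genMat_mem c⟩ = c := by
  ext i; fin_cases i <;> simp [soCoord, genMat]

/-- Skew-adjointness for `diag(1, 1, -1)` makes the spatial block antisymmetric, the mixed blocks
transposes of each other and the last entry zero, leaving three free entries. -/
theorem genMat_soCoord (A : so21) : genMat (soCoord A) = A.1 := by
  have h := (mem_so21_iff A.1).mp A.2
  have key : ∀ i j, _ := fun i j => congrFun (congrFun h i) j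
  simp only [LieAlgebra.Orthogonal.indefiniteDiagonal, Matrix.mul_diagonal, Matrix.diagonal_mul] at key
  have k1 := key (Sum.inl 0) (Sum.inl 0)
  have k2 := key (Sum.inl 1) (Sum.inl 1)
  have k3 := key (Sum.inl 0) (Sum.inl 1)
  have k4 := key (Sum.inl 0) (Sum.inr 0)
  have k5 := key (Sum.inl 1) (Sum.inr 0)
  have k6 := key (Sum.inr 0) (Sum.inr 0)
  simp at k1 k2 k3 k4 k5 k6
  ext i j
  rcases i with i | i <;> rcases j with j | j <;> fin_cases i <;> fin_cases j <;>
    simp [genMat, soCoord] <;> linarith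

theorem soCoord_injective : Function.Injective soCoord := fun A B h =>
  Subtype.ext (by rw [← genMat_soCoord A, ← genMat_soCoord B, h])

theorem soCoord_lie (A B : so21) : soCoord ⁅A, B⁆ =
    ![-2 * (soCoord A 1 * soCoord B 2 - soCoord A 2 * soCoord B 1),
      soCoord A 0 * soCoord B 1 - soCoord A 1 * soCoord B 0,
      -(soCoord A 0 * soCoord B 2 - soCoord A 2 * soCoord B 0)] := by
  have h : (⁅A, B⁆ : so21).1 = genMat (soCoord A) * genMat (soCoord B) -
      genMat (soCoord B) * genMat (soCoord A) := by
    rw [genMat_soCoord, genMat_soCoord]; rfl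
  ext i
  conv_lhs => rw [soCoord]
  simp only [LinearMap.coe_mk, AddHom.coe_mk, h]
  fin_cases i <;> simp [genMat, Matrix.mul_apply, Fin.sum_univ_two] <;> ring

theorem fderiv_hyperboloid {x : Plane} (hx : x ∈ halfPlane) (v : Plane) (i : Fin 2 ⊕ Fin 1) :
    fderiv ℝ hyperboloid x v i = fderiv ℝ (fun y => hyperboloid y i) x v ∧
      DifferentiableAt ℝ (fun y => hyperboloid y i) x := by
  -- The coordinates of the hyperboloid are themselves kernel functions, so their known derivatives
  -- apply.
  have e : ∀ i, ∃ c : Fin 3 → ℝ, ∀ y ∈ halfPlane, hyperboloid y i = kerComb c y := by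
    rintro (i | i)
    · fin_cases i
      · exact ⟨![1, 0, 0], fun y hy => by simp [hyperboloid, kerComb]⟩
      · refine ⟨![0, -1 / 2, 1 / 2], fun y hy => ?_⟩
        simp [hyperboloid, kerComb]; ring
    · fin_cases i
      refine ⟨![0, 1 / 2, 1 / 2], fun y hy => ?_⟩
      simp [hyperboloid, kerComb]; ring
  have hd : ∀ i, DifferentiableAt ℝ (fun y => hyperboloid y i) x := fun i => by
    obtain ⟨c, hc⟩ := e i
    exact (((contDiffOn_kerComb c (n := 1)).congr hc).contDiffAt
      (isOpen_halfPlane.mem_nhds hx)).differentiableAt (by norm_num)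
  refine ⟨?_, hd i⟩
  have : HasFDerivAt hyperboloid (ContinuousLinearMap.pi fun i =>
      fderiv ℝ (fun y => hyperboloid y i) x) x := hasFDerivAt_pi.mpr fun i => (hd i).hasFDerivAt
  rw [this.fderiv]; rfl

theorem fderiv_hyperboloid_apply {x : Plane} (hx : x ∈ halfPlane) (v : Plane) :
    fderiv ℝ hyperboloid x v = Sum.elim
      ![v 0 / x 1 - v 1 * x 0 / x 1 ^ 2,
        v 0 * x 0 / x 1 + v 1 * (1 / 2 - (x 0 ^ 2 - 1) / (2 * x 1 ^ 2))]
      ![v 0 * x 0 / x 1 + v 1 * (1 / 2 - (x 0 ^ 2 + 1) / (2 * x 1 ^ 2))] := by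
  have hx0 : x 1 ≠ 0 := ne_of_gt hx
  have key : ∀ (i) (c : Fin 3 → ℝ), (∀ y ∈ halfPlane, hyperboloid y i = kerComb c y) →
      fderiv ℝ hyperboloid x v i = v 0 * ((c 0 + 2 * c 2 * x 0) / x 1) +
      v 1 * (c 2 - (c 0 * x 0 + c 1 + c 2 * x 0 ^ 2) / x 1 ^ 2) := fun i c hc => by
    rw [(fderiv_hyperboloid hx v i).1, fderiv_apply_eq_pd,
      pd_eq_of_eqOn isOpen_halfPlane hc hx, pd_eq_of_eqOn isOpen_halfPlane hc hx,
      (pd_kerComb c hx).1, (pd_kerComb c hx).2]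
  ext i
  rcases i with i | i
  · fin_cases i
    · rw [Fin.zero_eta, key _ ![1, 0, 0] fun y hy => by simp [hyperboloid, kerComb]]
      simp; field_simp; ring
    · rw [Fin.mk_one, key _ ![0, -1 / 2, 1 / 2] fun y hy => by simp [hyperboloid, kerComb]; ring]
      simp; field_simp; ring
  · fin_cases i
    rw [Fin.zero_eta, key _ ![0, 1 / 2, 1 / 2] fun y hy => by simp [hyperboloid, kerComb]; ring]
    simp; field_simp; ring

/-- The field `killComb (soCoord A)` has the required image, and the differential of the embedding
is injective. -/
theorem isGenerator_iff {A : so21} {W : Plane → Plane} :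
    IsGenerator A W ↔ ∀ x ∈ halfPlane, W x = killComb (soCoord A) x := by
  refine forall₂_congr fun x hx => ?_
  have hx0 : x 1 ≠ 0 := ne_of_gt hx
  have h1 : fderiv ℝ hyperboloid x (killComb (soCoord A) x) = A.1 *ᵥ hyperboloid x := by
    rw [fderiv_hyperboloid_apply hx, ← genMat_soCoord A, killComb_zero, killComb_one]
    ext i
    rcases i with i | i
    · fin_cases i
      · simp [genMat, Matrix.mulVec, dotProduct, Fin.sum_univ_two, hyperboloid]; field_simp; ring
      · simp [genMat, Matrix.mulVec, dotProduct, Fin.sum_univ_two, hyperboloid]; field_simp; ring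
    · fin_cases i
      simp [genMat, Matrix.mulVec, dotProduct, Fin.sum_univ_two, hyperboloid]; field_simp; ring
  constructor
  · intro h
    have h2 := h.trans h1.symm
    rw [fderiv_hyperboloid_apply hx, fderiv_hyperboloid_apply hx] at h2
    have a0 := congrFun h2 (Sum.inl 0)
    have a1 := congrFun h2 (Sum.inl 1)
    have a2 := congrFun h2 (Sum.inr 0)
    simp only [Sum.elim_inl, Sum.elim_inr, Matrix.cons_val_zero, Matrix.cons_val_one] at a0 a1 a2
    -- The difference of the last two hyperboloid coordinates is `-1/y`, whose derivative along `W`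
    -- is `W₁/y²`.
    have b1 : W x 1 = killComb (soCoord A) x 1 := by
      have : W x 1 / x 1 ^ 2 = killComb (soCoord A) x 1 / x 1 ^ 2 := by
        linear_combination a1 - a2
      field_simp at this
      exact this
    have b0 : W x 0 = killComb (soCoord A) x 0 := by
      rw [b1] at a0
      have a3 := (div_left_inj' hx0).mp (sub_left_injective a0)
      exact a3
    exact plane_ext b0 b1
  · intro h; rw [h, h1]

theorem isKilling_iff_existsUnique {R : ℝ} (hR : R < 0) (W : Plane → Plane) :
    IsKilling R W ↔ ∃! A : so21, IsGenerator A W := by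
  simp only [isKilling_iff hR, isGenerator_iff]
  constructor
  · rintro ⟨c, hc⟩
    refine ⟨⟨genMat c, genMat_mem c⟩, fun x hx => by rw [soCoord_genMat, hc x hx], fun B hB => ?_⟩
    refine soCoord_injective (killComb_injective fun x hx => ?_)
    rw [← hB x hx, hc x hx, soCoord_genMat]
  · rintro ⟨A, hA, -⟩
    exact ⟨_, hA⟩

/-! ### The comoment map -/

/-- The equivariant comoment map of the action of `SO(2,1)` on the hyperbolic plane. -/
noncomputable def comoment (R : ℝ) : so21 →ₗ[ℝ] (ℍ → ℝ) :=
  (Fintype.linearCombination ℝ kerFun).comp (R⁻¹ • soCoord)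

theorem comoment_apply (R : ℝ) (A : so21) :
    comoment R A = ∑ j, (R⁻¹ • soCoord A) j • kerFun j := by
  simp [comoment, Fintype.linearCombination_apply, Finset.smul_sum, smul_smul]

theorem fderiv_comoment (R : ℝ) (A B : so21) {W : Plane → Plane} (hW : IsGenerator A W) {x : Plane}
    (hx : x ∈ halfPlane) :
    fderiv ℝ (inCoord (comoment R B)) x (W x) = - inCoord (comoment R ⁅A, B⁆) x := by
  have hx0 : x 1 ≠ 0 := ne_of_gt hx
  rw [comoment_apply, comoment_apply, fderiv_inCoord_sum_kerFun _ hx, inCoord_sum_kerFun _ hx,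
    isGenerator_iff.mp hW x hx, killComb_zero, killComb_one, kerComb, soCoord_lie]
  simp only [Pi.smul_apply, smul_eq_mul]
  simp
  field_simp
  ring

theorem isComoment_comoment {R : ℝ} (hR : R < 0) : IsComoment R (comoment R) := fun A W hW =>
  ⟨by rw [comoment_apply]; exact isHamiltonian_smul_sum_kerFun hR _ (isGenerator_iff.mp hW),
    fun B _ hx => fderiv_comoment R A B hW hx⟩

theorem exists_isGenerator (A : so21) : ∃ W, IsGenerator A W :=
  ⟨killComb (soCoord A), isGenerator_iff.mpr fun _ _ => rfl⟩

/-- Hamiltonians are determined only up to constants, but equivariance fixes `μ` on every bracket,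
and `so(2,1)` is a perfect Lie algebra. -/
theorem IsComoment.eq_comoment {R : ℝ} (hR : R < 0) {μ : so21 →ₗ[ℝ] (ℍ → ℝ)} (h : IsComoment R μ) :
    μ = comoment R := by
  have hlie : ∀ A B : so21, μ ⁅A, B⁆ = comoment R ⁅A, B⁆ := fun A B => by
    obtain ⟨W, hW⟩ := exists_isGenerator A
    obtain ⟨W', hW'⟩ := exists_isGenerator B
    refine eq_of_inCoord_eqOn fun x hx => ?_
    have h1 := (h A W hW).2 B x hx
    have h2 := fderiv_comoment R A B hW hx
    -- The Hamiltonian identity for `B` replaces the derivative of `μ B` along `W` by `ω(W', W)`,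
    -- which does not involve `μ`.
    rw [← (h B W' hW').1.2 x hx] at h1
    rw [← (isComoment_comoment hR B W' hW').1.2 x hx] at h2
    linarith
  set e : Fin 3 → so21 := fun j => ⟨genMat (Pi.single j 1), genMat_mem _⟩
  have he : ∀ j, soCoord (e j) = Pi.single j 1 := fun j => soCoord_genMat _
  ext1 A
  -- The coefficients come from `[e₁, e₂] = -2e₀`, `[e₀, e₁] = e₁`, `[e₀, e₂] = -e₂`.
  have hA : A = (-(soCoord A 0) / 2) • ⁅e 1, e 2⁆ + (soCoord A 1) • ⁅e 0, e 1⁆ +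
      (-(soCoord A 2)) • ⁅e 0, e 2⁆ := by
    apply soCoord_injective
    simp only [map_add, map_smul, soCoord_lie, he]
    ext i
    fin_cases i <;> simp
  rw [hA]
  simp only [map_add, map_smul, hlie]

theorem injective_comoment {R : ℝ} (hR : R < 0) : Function.Injective (comoment R) := by
  intro A B h
  rw [comoment_apply, comoment_apply] at h
  have h1 := linearIndependent_kerFun.fintypeLinearCombination_injective
    (a₁ := R⁻¹ • soCoord A) (a₂ := R⁻¹ • soCoord B) (by
      simpa only [Fintype.linearCombination_apply] using h)
  exact soCoord_injective (smul_right_injective _ (inv_ne_zero hR.ne) h1)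

theorem range_comoment {R : ℝ} (hR : R < 0) : Set.range (comoment R) = hessKernel R := by
  ext k
  rw [mem_hessKernel_iff hR]
  constructor
  · rintro ⟨A, rfl⟩
    exact ⟨_, comoment_apply R A⟩
  · rintro ⟨c, rfl⟩
    refine ⟨⟨genMat (R • c), genMat_mem _⟩, ?_⟩
    rw [comoment_apply, soCoord_genMat, smul_smul, inv_mul_cancel₀ hR.ne, one_smul]

/-! ### The equation `D^*S = 0` in hyperbolic coordinates -/

section

variable {R : ℝ} {G S : MatField} {Ω V : Set Plane} {E E' : Plane → ℝ}

theorem hypHess_eq_of_eqOn (hV : IsOpen V) (h : EqOn E E' V) (i j : Fin 2) :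
    EqOn (hypHess E i j) (hypHess E' i j) V := fun x hx => by
  have h1 : ∀ k, EqOn (pd k E) (pd k E') V := fun k y hy => pd_eq_of_eqOn hV h hy k
  simp only [hypHess, pd_eq_of_eqOn hV (h1 j) hx i, h1 _ hx, h hx]

/-- These are the Codazzi equations for `(a, b, c) = (S₁₁, -S₀₁, S₀₀)`, the components of `S^*`. -/
theorem codiff_eq_zero_iff (hR : R < 0) (hΩ : IsOpen Ω) (hΩh : Ω ⊆ halfPlane)
    (hG : ∀ x ∈ Ω, G x = hypMetric R x) {x : Plane} (hx : x ∈ Ω) (hS : ∀ x i j, S x i j = S x j i) :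
    (∀ j, codiff G S j x = 0) ↔
      pd 0 (fun y => S y 0 0) x = pd 1 (fun y => -S y 0 1) x ∧
      pd 1 (fun y => S y 1 1) x + (S x 1 1 + S x 0 0) / x 1 = pd 0 (fun y => -S y 0 1) x := by
  obtain ⟨h0, h1⟩ := codiff_eq hR hΩ hΩh hG hx hS
  have hne : R * x 1 ^ 2 ≠ 0 := mul_ne_zero hR.ne (pow_ne_zero _ (ne_of_gt (hΩh hx)))
  rw [Fin.forall_fin_two, h0, h1, mul_eq_zero_iff_left hne, mul_eq_zero_iff_left hne, pd_neg, pd_neg,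
    add_comm (S x 1 1)]
  constructor <;> rintro ⟨h, h'⟩ <;> constructor <;> linarith

theorem starTensor_eq_hess_iff (hR : R < 0) (hΩ : IsOpen Ω) (hΩh : Ω ⊆ halfPlane)
    (hG : ∀ x ∈ Ω, G x = hypMetric R x) {x : Plane} (hx : x ∈ Ω) (hS : ∀ x i j, S x i j = S x j i) :
    (∀ i j, starTensor G S x i j = hess G E i j x + R * G x i j * E x) ↔
      hypHess E 0 0 x = S x 1 1 ∧ hypHess E 0 1 x = -S x 0 1 ∧ hypHess E 1 0 x = -S x 0 1 ∧
        hypHess E 1 1 x = S x 0 0 := by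
  have h : ∀ i j, hess G E i j x + R * G x i j * E x = hypHess E i j x := hess_eq hR hΩ hΩh hG hx E
  simp only [h, starTensor_eq hR hΩh hG hx S, Fin.forall_fin_two, hS x 1 0]
  simp [eq_comm, and_assoc]

theorem codiff_eq_zero_of_hess (hR : R < 0) (hV : IsOpen V) (hVh : V ⊆ halfPlane)
    (hG : ∀ x ∈ V, G x = hypMetric R x) (hS : ∀ x i j, S x i j = S x j i)
    (hE : ContDiffOn ℝ ∞ E V)
    (h : ∀ x ∈ V, ∀ i j, starTensor G S x i j = hess G E i j x + R * G x i j * E x)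
    {x : Plane} (hx : x ∈ V) (j : Fin 2) : codiff G S j x = 0 := by
  have key := fun x hx => (starTensor_eq_hess_iff hR hV hVh hG hx hS).mp (h x hx)
  refine (codiff_eq_zero_iff hR hV hVh hG hx hS).mpr ?_ j
  obtain ⟨c0, c1⟩ := hypHess_codazzi hV hVh hE hx
  rw [pd_eq_of_eqOn hV (fun x hx => (key x hx).2.2.2) hx,
    pd_eq_of_eqOn hV (fun x hx => (key x hx).2.1) hx] at c0
  rw [pd_eq_of_eqOn hV (fun x hx => (key x hx).1) hx, (key x hx).1, (key x hx).2.2.2,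
    pd_eq_of_eqOn hV (fun x hx => (key x hx).2.1) hx] at c1
  exact ⟨c0, c1⟩

theorem exists_hess_of_codiff_eq_zero (hR : R < 0) (hV : IsOpen V) (hVh : V ⊆ halfPlane)
    (hc : Convex ℝ V) (hG : ∀ x ∈ V, G x = hypMetric R x) (hS : ∀ x i j, S x i j = S x j i)
    (hSs : ∀ i j, ContDiffOn ℝ ∞ (fun x => S x i j) V) (h : ∀ x ∈ V, ∀ j, codiff G S j x = 0) :
    ∃ E, ContDiffOn ℝ ∞ E V ∧
      ∀ x ∈ V, ∀ i j, starTensor G S x i j = hess G E i j x + R * G x i j * E x := by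
  have key := fun x hx => (codiff_eq_zero_iff hR hV hVh hG hx hS).mp (h x hx)
  obtain ⟨E, hE, hEq⟩ := exists_hypHess_eq hV hVh hc (hSs 1 1) (hSs 0 1).neg (hSs 0 0)
    (fun x hx => (key x hx).1) (fun x hx => (key x hx).2)
  exact ⟨E, hE, fun x hx => (starTensor_eq_hess_iff hR hV hVh hG hx hS).mpr (hEq x hx)⟩

theorem WeakCodazzi.congr {a b c a' b' c' : Plane → ℝ} (h : WeakCodazzi a b c Ω)
    (ha : EqOn a a' Ω) (hb : EqOn b b' Ω) (hc : EqOn c c' Ω) : WeakCodazzi a' b' c' Ω := by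
  have key : ∀ {f₀ f₁ f₂ g₀ g₁ g₂ φ : Plane → ℝ}, IsTest Ω φ → EqOn f₀ g₀ Ω → EqOn f₁ g₁ Ω →
      EqOn f₂ g₂ Ω → divPairing f₀ f₁ f₂ φ = divPairing g₀ g₁ g₂ φ := by
    intro f₀ f₁ f₂ g₀ g₁ g₂ φ hφ h₀ h₁ h₂
    refine integral_congr_ae (.of_forall fun x => ?_)
    beta_reduce
    by_cases hx : x ∈ Ω
    · rw [h₀ hx, h₁ hx, h₂ hx]
    · rw [hφ.eq_zero hx, (hφ.pd 0).eq_zero hx, (hφ.pd 1).eq_zero hx]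
      simp
  intro φ hφ
  have hb' : EqOn (fun x => -b x) (fun x => -b' x) Ω := fun x hx => congrArg _ (hb hx)
  rw [← key hφ hc hb' fun _ _ => rfl, ← key hφ hb' ha fun x hx => by
    change -(a x + c x) / x 1 = -(a' x + c' x) / x 1
    rw [ha hx, hc hx]]
  exact h φ hφ

theorem WeakHessEq.congr_fun {T : MatField} (h : WeakHessEq G R T E V) (hV : IsOpen V)
    (hE : EqOn E E' V) : WeakHessEq G R T E' V := by
  obtain ⟨hi, D, H, hD, hH, hT⟩ := h
  have hae := ae_restrict_of_forall_mem (μ := volume) hV.measurableSet hE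
  refine ⟨hi.congr hae, D, H,
    fun i => ⟨(hD i).1, (hD i).2.congr_on' hV hE fun _ _ => rfl⟩, hH, fun i j => ?_⟩
  filter_upwards [hT i j, hae] with x h1 h2
  rw [h1, h2]

theorem locallyIntegrableOn_starTensor (hR : R < 0) (hΩ : IsOpen Ω) (hΩh : Ω ⊆ halfPlane)
    (hG : ∀ x ∈ Ω, G x = hypMetric R x) (hSi : ∀ i j, LocallyIntegrableOn (fun x => S x i j) Ω)
    (i j : Fin 2) : LocallyIntegrableOn (fun x => starTensor G S x i j) Ω := by
  have h : LocallyIntegrableOn (fun x => !![S x 1 1, -S x 1 0; -S x 0 1, S x 0 0] i j) Ω := by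
    fin_cases i <;> fin_cases j
    exacts [hSi 1 1, (hSi 1 0).neg, (hSi 0 1).neg, hSi 0 0]
  exact h.congr (ae_restrict_of_forall_mem hΩ.measurableSet fun x hx => by
    beta_reduce
    rw [starTensor_eq hR hΩh hG hx S])

theorem weakCodiffZero_iff_starTensor (hR : R < 0) (hΩ : IsOpen Ω) (hΩh : Ω ⊆ halfPlane)
    (hG : ∀ x ∈ Ω, G x = hypMetric R x) (hS : ∀ x i j, S x i j = S x j i)
    (hSi : ∀ i j, LocallyIntegrableOn (fun x => S x i j) Ω) :
    WeakCodiffZero G S Ω ↔ WeakCodazzi (fun x => starTensor G S x 0 0)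
      (fun x => starTensor G S x 0 1) (fun x => starTensor G S x 1 1) Ω := by
  have h0 : EqOn (fun x => starTensor G S x 0 0) (fun x => S x 1 1) Ω := fun x hx => by
    simp [starTensor_eq hR hΩh hG hx S]
  have h1 : EqOn (fun x => starTensor G S x 0 1) (fun x => -S x 0 1) Ω := fun x hx => by
    simp [starTensor_eq hR hΩh hG hx S, hS x 1 0]
  have h2 : EqOn (fun x => starTensor G S x 1 1) (fun x => S x 0 0) Ω := fun x hx => by
    simp [starTensor_eq hR hΩh hG hx S]
  rw [weakCodiffZero_iff hR hΩ hΩh hG hS hSi]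
  exact ⟨fun h => h.congr h0.symm h1.symm h2.symm, fun h => h.congr h0 h1 h2⟩

theorem starTensor_symm (hR : R < 0) (hΩh : Ω ⊆ halfPlane) (hG : ∀ x ∈ Ω, G x = hypMetric R x)
    (hS : ∀ x i j, S x i j = S x j i) {x : Plane} (hx : x ∈ Ω) :
    starTensor G S x 1 0 = starTensor G S x 0 1 := by
  simp [starTensor_eq hR hΩh hG hx S, hS x 1 0]

end

/-! ### The equation `D^*S = 0` on a hyperbolic surface -/

section

variable {M : Type*} [TopologicalSpace M]

theorem OpenPartialHomeomorph.target_inter_preimage_source_inter_preimage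
    (e : OpenPartialHomeomorph M Plane) {V : Set Plane} (hV : V ⊆ e.target) :
    e.target ∩ e.symm ⁻¹' (e.source ∩ e ⁻¹' V) = V := by
  ext x
  constructor
  · rintro ⟨hx, -, h⟩
    simpa [e.right_inv hx] using h
  · intro hx
    exact ⟨hV hx, e.map_target (hV hx), by simpa [e.right_inv (hV hx)] using hx⟩

theorem OpenPartialHomeomorph.eqOn_comp_symm (e : OpenPartialHomeomorph M Plane) {V : Set Plane}
    (hV : V ⊆ e.target) (E : Plane → ℝ) : EqOn ((E ∘ e) ∘ e.symm) E V := fun x hx => by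
  simp [e.right_inv (hV hx)]

variable [ChartedSpace Plane M]

theorem comp_symm_apply {S : ∀ p : M, TangentSpace (𝓡 2) p →L[ℝ] TangentSpace (𝓡 2) p →L[ℝ] ℝ}
    (hS : ∀ p v w, S p v w = S p w v) (e : OpenPartialHomeomorph M Plane) (x : Plane) (i j : Fin 2) :
    comp S e x i j = comp S e x j i := hS _ _ _

variable [IsManifold (𝓡 2) ∞ M] {R : ℝ} {g : SurfaceMetric M}
  {S : ∀ p : M, TangentSpace (𝓡 2) p →L[ℝ] TangentSpace (𝓡 2) p →L[ℝ] ℝ}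

/-- Both sides are compared chart by chart. A coordinate ball supplies the convexity needed by the
Poincaré lemma; conversely, the codifferential at a point depends only on a neighbourhood. -/
theorem codiffZero_iff_locallyHess (hR : R < 0) (hS : ∀ p v w, S p v w = S p w v)
    (hSs : IsSmoothTensor R g S) : CodiffZero R g S ↔ LocallyHess R g S := by
  refine forall₂_congr fun e he => ?_
  have hS' := comp_symm_apply hS e
  constructor
  · intro h p hp
    obtain ⟨ε, hε, hB⟩ := Metric.isOpen_iff.mp e.open_target (e p) (e.map_source hp)
    set B := Metric.ball (e p) ε
    have hBo : IsOpen B := Metric.isOpen_ball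
    have hBh := hB.trans he.target_subset
    have hG : ∀ x ∈ B, comp g.inner e x = hypMetric R x := fun x hx => he.isometric x (hB hx)
    obtain ⟨E, hE, hEq⟩ := exists_hess_of_codiff_eq_zero hR hBo hBh (convex_ball _ _) hG hS'
      (fun i j => (hSs e he i j).mono hB) fun x hx => h x (hB hx)
    refine ⟨e.source ∩ e ⁻¹' B, e.isOpen_inter_preimage hBo, ⟨hp, Metric.mem_ball_self hε⟩,
      inter_subset_left, E ∘ e, ?_, ?_⟩
    · exact (contMDiffOn_iff_contDiffOn.mpr hE).comp
        ((contMDiffOn_of_mem_maximalAtlas he.mem_atlas).mono inter_subset_left) fun _ hx => hx.2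
    · rw [e.target_inter_preimage_source_inter_preimage hB]
      intro x hx
      have hEE := e.eqOn_comp_symm hB E
      have h1 := (starTensor_eq_hess_iff hR hBo hBh hG hx hS').mp (hEq x hx)
      refine (starTensor_eq_hess_iff hR hBo hBh hG hx hS').mpr ?_
      simpa only [hypHess_eq_of_eqOn hBo hEE _ _ hx] using h1
  · intro h x hx j
    obtain ⟨U, hU, hxU, -, E, hE, hEq⟩ := h (e.symm x) (e.map_target hx)
    have hsub : e.target ∩ e.symm ⁻¹' U ⊆ e.target := inter_subset_left
    refine codiff_eq_zero_of_hess hR (e.isOpen_inter_preimage_symm hU)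
      (hsub.trans he.target_subset) (fun y hy => he.isometric y hy.1) hS' ?_ hEq ⟨hx, hxU⟩ j
    exact contMDiffOn_iff_contDiffOn.mp
      (hE.comp ((contMDiffOn_symm_of_mem_maximalAtlas he.mem_atlas).mono hsub) fun _ hy => hy.2)

/-- Both sides are translated into the weak Codazzi equations for `S^*`, which are locally solvable
and, by a partition of unity, can be checked locally. -/
theorem distribCodiffZero_iff_distribLocallyHess (hR : R < 0) (hS : ∀ p v w, S p v w = S p w v)
    (hSi : IsLocIntegrableTensor R g S) : DistribCodiffZero R g S ↔ DistribLocallyHess R g S := by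
  refine forall₂_congr fun e he => ?_
  have hS' := comp_symm_apply hS e
  have hT := fun x hx => starTensor_symm hR he.target_subset he.isometric hS' (x := x) hx
  have hTi := locallyIntegrableOn_starTensor hR e.open_target he.target_subset he.isometric (hSi e he)
  rw [weakCodiffZero_iff_starTensor hR e.open_target he.target_subset he.isometric hS' (hSi e he)]
  constructor
  · intro h p hp
    obtain ⟨V, hV, hpV, hVe, E, hE⟩ := h.exists_weakHessEq hR e.open_target he.target_subset
      he.isometric hT hTi (e.map_source hp)
    refine ⟨e.source ∩ e ⁻¹' V, e.isOpen_inter_preimage hV, ⟨hp, hpV⟩, inter_subset_left, E ∘ e, ?_⟩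
    rw [e.target_inter_preimage_source_inter_preimage hVe]
    exact hE.congr_fun hV (e.eqOn_comp_symm hVe E).symm
  · intro h
    refine WeakCodazzi.of_local e.open_target he.target_subset (hTi 0 0) (hTi 0 1) (hTi 1 1)
      fun x hx => ?_
    obtain ⟨U, hU, hxU, -, E, hE⟩ := h (e.symm x) (e.map_target hx)
    have hsub : e.target ∩ e.symm ⁻¹' U ⊆ e.target := inter_subset_left
    exact ⟨_, e.isOpen_inter_preimage_symm hU, ⟨hx, hxU⟩,
      hE.weakCodazzi hR (e.isOpen_inter_preimage_symm hU) (hsub.trans he.target_subset)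
        (fun y hy => he.isometric y hy.1) (fun y hy => hT y hy.1)
        fun i j => (hTi i j).mono_set hsub⟩

end

/-! ### The main theorem -/

theorem mainTheorem3 {M : Type*} [TopologicalSpace M] [ChartedSpace Plane M]
    [IsManifold (𝓡 2) ∞ M] (R : ℝ) (hR : R < 0) (g : SurfaceMetric M)
    (hg : IsHyperbolicSurface R g) :
    -- `R` is the constant curvature
    (∀ e, IsHypChart R g e → ∀ x ∈ e.target, gaussCurvature (comp g.inner e) x = R) ∧
    -- the equation `D^*S = 0`, for smooth tensors and in the sense of distributions
    (∀ S : ∀ p : M, TangentSpace (𝓡 2) p →L[ℝ] TangentSpace (𝓡 2) p →L[ℝ] ℝ,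
      (∀ p v w, S p v w = S p w v) →
        (IsSmoothTensor R g S → (CodiffZero R g S ↔ LocallyHess R g S)) ∧
        (IsLocIntegrableTensor R g S → (DistribCodiffZero R g S ↔ DistribLocallyHess R g S))) ∧
    -- the kernel
    (hessKernel R = (Submodule.span ℝ (Set.range kerFun) : Set (ℍ → ℝ)) ∧
      Module.finrank ℝ (Submodule.span ℝ (Set.range kerFun)) = 3 ∧
      weakHessKernel R = {E | ∃ k ∈ hessKernel R,
        inCoord E =ᵐ[volume.restrict halfPlane] inCoord k}) ∧
    -- the Killing fields are the infinitesimal action of `SO(2,1)`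
    ((∀ A : so21, ∃ W, IsGenerator A W) ∧
      (∀ W : Plane → Plane, IsKilling R W ↔ ∃! A : so21, IsGenerator A W)) ∧
    -- the kernel consists of the Hamiltonians of the Killing fields
    ((∀ W, IsKilling R W → ∃! k : ℍ → ℝ, k ∈ hessKernel R ∧ IsHamiltonian R k W) ∧
      (∀ k ∈ hessKernel R, ∃ W, IsKilling R W ∧ IsHamiltonian R k W) ∧
      (∀ j, IsKilling R (killingField j) ∧
        IsHamiltonian R (kerFun j) (fun x => R • killingField j x)) ∧
      (∃! μ : so21 →ₗ[ℝ] (ℍ → ℝ), IsComoment R μ) ∧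
      (∀ μ : so21 →ₗ[ℝ] (ℍ → ℝ), IsComoment R μ →
        Function.Injective μ ∧ Set.range μ = hessKernel R)) := by
  refine ⟨fun e he x hx => gaussCurvature_eq hR e.open_target he.target_subset he.isometric hx,
    fun S hS => ⟨codiffZero_iff_locallyHess hR hS, distribCodiffZero_iff_distribLocallyHess hR hS⟩,
    ⟨hessKernel_eq hR, finrank_span_kerFun, weakHessKernel_eq hR⟩,
    ⟨exists_isGenerator, isKilling_iff_existsUnique hR⟩,
    fun W => existsUnique_hamiltonian hR, fun k => exists_isKilling_isHamiltonian hR,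
    isKilling_killingField hR,
    ⟨comoment R, isComoment_comoment hR, fun μ h => h.eq_comoment hR⟩, fun μ h => ?_⟩
  rw [h.eq_comoment hR]
  exact ⟨injective_comoment hR, range_comoment hR⟩
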